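/- A *stabiliser operator* on $N$ qubits is an operator $\pm\sigma_1\otimes\cdots\otimes\sigma_N$ with $\sigma_i\in\{\mathbb 1,X,Y,Z\}$. A *generator set* is a list $g_1,\dots,g_K$ of mutually commuting stabiliser operators that is independent ($g_1^{s_1}\cdots g_K^{s_K}=\mathbb 1$ exactly if all $s_k$ are even) and such that $-\mathbb 1$ is not a product of the $g_k$. Its stabiliser projector and mixed stabiliser state are $$\mathcal P=\prod_{k=1}^K\frac{\mathbb 1+g_k}{2},\qquad \rho=2^{-(N-K)}\mathcal P .$$ Let $\mathcal P_1,\rho_1$ and $\mathcal P_2,\rho_2$ be the projectors and states of two generator sets with $K_1$ and $K_2$ generators on $N$ qubits. *Algorithm OVERLAP* works on the composite array of Pauli symbols and phases of the $K_1+K_2$ generators. Its elementary operations are row transposition, row multiplication, the six one-qubit column operations that permute the Pauli operators (up to signs), column transposition and CNOT on two columns; column operations act on all rows. "Deleting" a row or column below means excluding it from the active region. 1. (Normal form of the first array.) The active region is the full first array. While it is non-empty, consider its first column. (a) If it contains no Pauli operator, exchange it with the last active column and delete it. (b) If it contains one kind of Pauli operator, bring the first row containing it to the top, turn the operator into $X$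 by a one-qubit operation, multiply the top row with all other active rows that have an $X$ in this column, turn all other Pauli operators in the top row into $X$ by one-qubit operations, remove these $X$ by CNOTs controlled by the first active column, and delete the top row and the first column. (c) If it contains at least two kinds, bring the first row with a Pauli operator and the first row with a different one to the two top positions, turn this pair into $X,Z$ by a one-qubit operation, find the first further column with an anticommuting pair in the two top rows, turn this pair into $X,Y$, and apply a CNOT from the first active column to it. Let $R_1$ be the number of $X$ obtained. 2. (Elimination.) Set $T=1$. The active region is all rows of the second array and the first $R_1$ columns. While it is non-empty, consider its first column, the $j$-th one say. (a) If it contains no Pauli operator, delete it. (b) If it contains one kind of Pauli operator $\sigma$, bring the first row containing it to the top and multiply it with all other active rows that contain $\sigma$ there; if $\sigma\ne X$, divide $T$ by $2$ and delete the top row, and if $\sigma=X$, multiply row $j$ of the first array to the top row; delete the column. (c) If it contains at least two kinds, bring the first two different ones to the two top rows, clear the other active rows in this column by multiplication with the top row, the second row, or both; arrange by a row transposition or by multiplying the top row to the second one that the second row has an $X$ in this column and the top row does not; multiply row $j$ of the first array to the second row; divide $T$ by $2$, delete the top row and the column. 3. (End game.) Reduce the block of the remaining rows of the second array and of the columns $R_1+1,\dots,N$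 to row-reduced echelon form, with phases: column by column, use the first row with a Pauli operator, and the first row with a different Pauli operator if there is one, to clear all other active rows in the column, and delete these one or two rows together with the column. Let $R_2$ be the total number of rows deleted in this reduction (the rank of the block). If one of the rows then left over (all of them $\pm\mathbb 1$) has phase $-1$, set $T=0$. Set $C=2^{N-R_1-R_2}$ and return $F=CT/2^{(N-K_1)+(N-K_2)}$ and $F_u=C\sqrt{T/2^{(N-K_1)+(N-K_2)}}$. **Theorem.** There is a polynomial $p$ such that for all $N,K_1,K_2$ and all pairs of generator sets as above, algorithm OVERLAP terminates after at most $p(N+K_1+K_2)$ elementary steps (reading or writing a single array entry or phase, or updating a counter or scalar), and the following holds for the values $R_1,R_2,T$ that it computes. * $R_1=K_1$, $R_2\le K_2$, $K_1+R_2\le N$, and $T$ is $0$ or a power $2^{-j}$, $j\ge 0$. * There are a unitary $U$, composed of Hadamard gates, $\pi/4$ phase gates, qubit transpositions and CNOT gates, and signs $s_i=\pm1$ with $$U\mathcal P_1U^\dagger=\bigotimes_{i=1}^{K_1}\frac{\mathbb 1+s_iX}{2}\otimes\mathbb 1^{\otimes(N-K_1)},\qquad U\,\mathcal P_1\mathcal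 P_2\mathcal P_1\,U^\dagger=T\;\bigotimes_{i=1}^{K_1+R_2}\frac{\mathbb 1+s_iX}{2}\otimes\mathbb 1^{\otimes(N-K_1-R_2)} .$$ * The overlap is $\operatorname{Tr}[\rho_1\rho_2]=2^{-(N-K_2+R_2)}\,T$, which equals the return value $F$ and is either $0$ or $2^{-j}$ with an integer $0\le j\le N$. * The Uhlmann fidelity is $F_u(\rho_1,\rho_2):=\operatorname{Tr}\sqrt{\sqrt{\rho_1}\,\rho_2\sqrt{\rho_1}}=2^{(K_2-K_1)/2-R_2}\sqrt T\le 1$, which equals the return value $F_u$. * Hence the Bures distance $D(\rho_1,\rho_2):=2\sqrt{1-F_u(\rho_1,\rho_2)}$ is $2\sqrt{1-2^{(K_2-K_1)/2-R_2}\sqrt T}$. -/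

import Mathlib

open scoped MatrixOrder

namespace StabOverlap

/-! ### Pauli operators and stabiliser operators -/

/-- The identity and the three Pauli operators on one qubit. -/
inductive Pauli where
  | I | X | Y | Z
  deriving DecidableEq

/-- The `2 × 2` matrix of a Pauli symbol. -/
def Pauli.toMatrix : Pauli → Matrix (Fin 2) (Fin 2) ℂ
  | .I => 1
  | .X => !![0, 1; 1, 0]
  | .Y => !![0, -Complex.I; Complex.I, 0]
  | .Z => !![1, 0; 0, -1]

/-- Operators on `N` qubits, in the computational basis indexed by `Fin N → Fin 2`. -/
abbrev Op (N : ℕ) := Matrix (Fin N → Fin 2) (Fin N → Fin 2) ℂ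

/-- The tensor (Kronecker) product of `N` one-qubit operators. -/
def tensor {N : ℕ} (M : Fin N → Matrix (Fin 2) (Fin 2) ℂ) : Op N :=
  Matrix.of fun a b => ∏ i, M i (a i) (b i)

/-- A stabiliser operator on `N` qubits: a sign `±1` and a string of `N` Pauli symbols. -/
structure StabOp (N : ℕ) where
  sign : ℤˣ
  op : Fin N → Pauli

/-- The operator `± σ₁ ⊗ ⋯ ⊗ σ_N`. -/
def StabOp.toMatrix {N : ℕ} (g : StabOp N) : Op N :=
  (((g.sign : ℤˣ) : ℤ) : ℂ) • tensor fun i => (g.op i).toMatrix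

/-- The product `g₁ ^ s₁ ⋯ g_K ^ s_K`. -/
def genProd {K N : ℕ} (g : Fin K → StabOp N) (s : Fin K → ℕ) : Op N :=
  (List.ofFn fun k => (g k).toMatrix ^ s k).prod

/-- `g₁, …, g_K` is a generator set of a stabiliser state: the operators commute, are independent
(a product of powers is the identity exactly if all exponents are even), and `-1` is not a product
of them, so that they have a common `+1` eigenvector. -/
structure IsGeneratorSet {K N : ℕ} (g : Fin K → StabOp N) : Prop where
  comm : ∀ i j, Commute (g i).toMatrix (g j).toMatrix
  indep : ∀ s : Fin K → ℕ, genProd g s = 1 ↔ ∀ k, Even (s k)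
  neg_one : ∀ s : Fin K → ℕ, genProd g s ≠ -1

/-- The stabiliser projector `∏ₖ (1 + gₖ) / 2`. -/
noncomputable def stabProj {K N : ℕ} (g : Fin K → StabOp N) : Op N :=
  (List.ofFn fun k => (2⁻¹ : ℂ) • (1 + (g k).toMatrix)).prod

/-- The mixed stabiliser state `2 ^ (-(N - K)) ∏ₖ (1 + gₖ) / 2`. -/
noncomputable def stabState {K N : ℕ} (g : Fin K → StabOp N) : Op N :=
  (2 : ℂ) ^ (-((N : ℤ) - (K : ℤ))) • stabProj g

/-! ### Overlap, Uhlmann fidelity, Bures distance -/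

/-- The overlap `Tr (ρ₁ ρ₂)`. -/
def overlap {N : ℕ} (ρ₁ ρ₂ : Op N) : ℂ := (ρ₁ * ρ₂).trace

/-- The Uhlmann fidelity `Tr √(√ρ₁ ρ₂ √ρ₁)` (a real number). -/
noncomputable def uhlmannFidelity {N : ℕ} (ρ₁ ρ₂ : Op N) : ℝ :=
  (CFC.sqrt (CFC.sqrt ρ₁ * ρ₂ * CFC.sqrt ρ₁)).trace.re

/-- The Bures distance, in the normalisation `2 √(1 - F_u)`. -/
noncomputable def buresDistance {N : ℕ} (ρ₁ ρ₂ : Op N) : ℝ :=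
  2 * Real.sqrt (1 - uhlmannFidelity ρ₁ ρ₂)

/-! ### Elementary unitaries on qubits -/

/-- The Hadamard gate. -/
noncomputable def hadamard : Matrix (Fin 2) (Fin 2) ℂ :=
  ((Real.sqrt 2 : ℝ) : ℂ)⁻¹ • !![1, 1; 1, -1]

/-- The `π/4` phase gate. -/
noncomputable def phaseGate : Matrix (Fin 2) (Fin 2) ℂ := !![1, 0; 0, Complex.I]

/-- A one-qubit gate acting on qubit `j`. -/
def onQubit {N : ℕ} (j : Fin N) (M : Matrix (Fin 2) (Fin 2) ℂ) : Op N :=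
  tensor (Function.update (fun _ => 1) j M)

/-- The transposition of the qubits `i` and `j`. -/
def swapGate {N : ℕ} (i j : Fin N) : Op N :=
  Matrix.of fun a b => if a = b ∘ Equiv.swap i j then 1 else 0

/-- The CNOT gate with control qubit `c` and target qubit `t`. -/
def cnotGate {N : ℕ} (c t : Fin N) : Op N :=
  Matrix.of fun a b => if a = Function.update b t (b t + b c) then 1 else 0

/-- Unitaries composed of Hadamard gates, phase gates, qubit transpositions and CNOT gates. -/
noncomputable def cliffordCircuits (N : ℕ) : Submonoid (Op N) :=
  Submonoid.closure
    ({U | ∃ j, U = onQubit j hadamard} ∪ {U | ∃ j, U = onQubit j phaseGate} ∪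
      {U | ∃ i j, U = swapGate i j} ∪ {U | ∃ c t, c ≠ t ∧ U = cnotGate c t})

/-- The rank-one projector `(1 + s X) / 2` of a qubit, for a sign `s = ±1`. -/
noncomputable def projX (s : ℤˣ) : Matrix (Fin 2) (Fin 2) ℂ :=
  (2⁻¹ : ℂ) • (1 + ((s : ℤ) : ℂ) • Pauli.X.toMatrix)

/-- `⨂_{i < r} (1 + sᵢ X) / 2 ⊗ 1 ^ {⊗ (N - r)}`: `r` rank-one projectors, then identities. -/
noncomputable def tensorProj {N : ℕ} (s : Fin N → ℤˣ) (r : ℕ) : Op N :=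
  tensor fun i => if (i : ℕ) < r then projX (s i) else 1

/-! ### Tables for the symbolic manipulation of stabiliser arrays

A phase factor `i ^ k` is stored as `k : ZMod 4`. -/

/-- The product of two Pauli symbols: the phase and the symbol. -/
def Pauli.mul : Pauli → Pauli → ZMod 4 × Pauli
  | .I, σ => (0, σ)
  | σ, .I => (0, σ)
  | .X, .X => (0, .I)
  | .X, .Y => (1, .Z)
  | .X, .Z => (3, .Y)
  | .Y, .X => (3, .Z)
  | .Y, .Y => (0, .I)
  | .Y, .Z => (1, .X)
  | .Z, .X => (1, .Y)
  | .Z, .Y => (3, .X)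
  | .Z, .Z => (0, .I)

/-- The six one-qubit column operations, named by the images of `X`, `Y`, `Z` up to sign. -/
inductive Rot where
  | xyz | zxy | yzx | xzy | yxz | zyx

/-- The action of a one-qubit column operation on a Pauli symbol: the phase and the symbol. -/
def Rot.act : Rot → Pauli → ZMod 4 × Pauli
  | _, .I => (0, .I)
  | .xyz, σ => (0, σ)
  | .zxy, .X => (0, .Z)
  | .zxy, .Y => (0, .X)
  | .zxy, .Z => (0, .Y)
  | .yzx, .X => (0, .Y)
  | .yzx, .Y => (0, .Z)
  | .yzx, .Z => (0, .X)
  | .xzy, .X => (2, .X)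
  | .xzy, .Y => (0, .Z)
  | .xzy, .Z => (0, .Y)
  | .yxz, .X => (0, .Y)
  | .yxz, .Y => (0, .X)
  | .yxz, .Z => (2, .Z)
  | .zyx, .X => (0, .Z)
  | .zyx, .Y => (2, .Y)
  | .zyx, .Z => (0, .X)

/-- The list of the six one-qubit column operations. -/
def Rot.all : List Rot := [.xyz, .zxy, .yzx, .xzy, .yxz, .zyx]

/-- A column operation that turns `σ` into `X` (up to sign). -/
def Rot.toX (σ : Pauli) : Rot :=
  (Rot.all.find? fun u => (u.act σ).2 = .X).getD .xyz

/-- A column operation that turns the pair `σ₁, σ₂` into the pair `τ₁, τ₂` (up to signs). -/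
def Rot.toPair (σ₁ σ₂ τ₁ τ₂ : Pauli) : Rot :=
  (Rot.all.find? fun u => (u.act σ₁).2 = τ₁ ∧ (u.act σ₂).2 = τ₂).getD .xyz

/-- The action of CNOT on the symbols of control and target: the phase and the two symbols. -/
def cnotAct : Pauli → Pauli → ZMod 4 × Pauli × Pauli
  | .I, .I => (0, .I, .I)
  | .I, .X => (0, .I, .X)
  | .I, .Y => (0, .Z, .Y)
  | .I, .Z => (0, .Z, .Z)
  | .X, .I => (0, .X, .X)
  | .X, .X => (0, .X, .I)
  | .X, .Y => (0, .Y, .Z)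
  | .X, .Z => (2, .Y, .Y)
  | .Y, .I => (0, .Y, .X)
  | .Y, .X => (0, .Y, .I)
  | .Y, .Y => (2, .X, .Z)
  | .Y, .Z => (0, .X, .Y)
  | .Z, .I => (0, .Z, .I)
  | .Z, .X => (0, .Z, .X)
  | .Z, .Y => (0, .I, .Y)
  | .Z, .Z => (0, .I, .Z)

/-! ### Arrays and elementary operations

Rows and columns of an array are numbered from `0`. Rows are stored as functions on `ℕ`; only the
first `N` columns and the first `K₁ + K₂` rows are ever used, the rest is filled with identities.
An active region consists of the rows `KU ≤ r < KL` and the columns `NL ≤ j < NR`. -/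

/-- A row of an array, with its phase factor `i ^ phase`. -/
structure Row where
  phase : ZMod 4
  op : ℕ → Pauli

/-- The identity row. -/
def Row.one : Row := ⟨0, fun _ => .I⟩

/-- Elementwise product of two rows of length `N`, with the phase factors collected. -/
def Row.mul (N : ℕ) (a b : Row) : Row where
  phase := a.phase + b.phase + ∑ j ∈ Finset.range N, (Pauli.mul (a.op j) (b.op j)).1
  op j := (Pauli.mul (a.op j) (b.op j)).2

/-- One-qubit operation on column `j`. -/
def Row.rot (j : ℕ) (u : Rot) (a : Row) : Row where
  phase := a.phase + (u.act (a.op j)).1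
  op := Function.update a.op j (u.act (a.op j)).2

/-- CNOT with control column `c` and target column `t`. -/
def Row.cnot (c t : ℕ) (a : Row) : Row where
  phase := a.phase + (cnotAct (a.op c) (a.op t)).1
  op := Function.update (Function.update a.op c (cnotAct (a.op c) (a.op t)).2.1)
    t (cnotAct (a.op c) (a.op t)).2.2

/-- Transposition of the columns `i` and `j`. -/
def Row.swap (i j : ℕ) (a : Row) : Row where
  phase := a.phase
  op := a.op ∘ Equiv.swap i j

/-- The row of a stabiliser operator. -/
def StabOp.toRow {N : ℕ} (g : StabOp N) : Row where
  phase := if g.sign = 1 then 0 else 2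
  op j := if h : j < N then g.op ⟨j, h⟩ else .I

/-- The four stages of the algorithm: normal form of the first array, elimination in the second
array, echelon form of the remaining block of the second array, end. -/
inductive Stage where
  | cnf | trace | rref | halt

/-- A configuration of the algorithm. `cost` counts the elementary steps done so far: every
operation on rows or columns is charged for the array entries and phases that it reads and writes,
every search for the entries in its range, every update of counters and scalars by their number. -/
structure Config where
  stage : Stage
  arr : ℕ → Row
  KU : ℕ
  KL : ℕ
  NL : ℕ
  NR : ℕ
  R₁ : ℕ
  R₂ : ℕ
  T : ℚ
  C : ℚ
  cost : ℕ

namespace Config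

/-- The entry in row `r` and column `j`. -/
def entry (c : Config) (r j : ℕ) : Pauli := (c.arr r).op j

/-- Add `n` elementary steps to the cost. -/
def charge (n : ℕ) (c : Config) : Config := { c with cost := c.cost + n }

def swapRows (N i j : ℕ) (c : Config) : Config :=
  { c with arr := c.arr ∘ Equiv.swap i j }.charge (4 * (N + 1))

/-- Multiply row `k` with row `l`, that is, replace row `l` by the product of the two rows. -/
def mulRow (N k l : ℕ) (c : Config) : Config :=
  { c with arr := Function.update c.arr l (Row.mul N (c.arr k) (c.arr l)) }.charge (3 * (N + 1))

/-- The column operations act on all `K` rows of the composite array. -/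
def swapCols (K i j : ℕ) (c : Config) : Config :=
  { c with arr := fun r => (c.arr r).swap i j }.charge (4 * K)

def rotCol (K j : ℕ) (u : Rot) (c : Config) : Config :=
  { c with arr := fun r => (c.arr r).rot j u }.charge (4 * K)

def cnotCols (K i j : ℕ) (c : Config) : Config :=
  { c with arr := fun r => (c.arr r).cnot i j }.charge (6 * K)

/-- The first row of the active region with a Pauli operator in column `NL`. -/
def first (c : Config) : Option ℕ :=
  (List.range' c.KU (c.KL - c.KU)).find? fun r => c.entry r c.NL ≠ .I

/-- The first row of the active region with a Pauli operator other than `σ` in column `NL`. -/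
def firstOther (c : Config) (σ : Pauli) : Option ℕ :=
  (List.range' c.KU (c.KL - c.KU)).find? fun r => c.entry r c.NL ≠ .I ∧ c.entry r c.NL ≠ σ

/-- Apply `f r` successively for `r = a, a + 1, …, b - 1`. -/
def forRange (a b : ℕ) (f : ℕ → Config → Config) (c : Config) : Config :=
  (List.range' a (b - a)).foldl (fun c r => (f r c).charge 1) c

/-- Multiply row `k` with all rows in `[a, KL)` that have the symbol `σ` in column `NL`. -/
def clearOne (N k a : ℕ) (σ : Pauli) (c : Config) : Config :=
  forRange a c.KL (fun r c => if c.entry r c.NL = σ then c.mulRow N k r else c) c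

/-- Remove the Pauli operators in column `NL` from the rows in `[a, KL)` with the help of row `k₁`
(symbol `σ₁`) and row `k₂` (symbol `σ₂ ≠ σ₁`). -/
def clearTwo (N k₁ k₂ a : ℕ) (σ₁ σ₂ : Pauli) (c : Config) : Config :=
  forRange a c.KL (fun r c =>
    if c.entry r c.NL = .I then c
    else if c.entry r c.NL = σ₁ then c.mulRow N k₁ r
    else if c.entry r c.NL = σ₂ then c.mulRow N k₂ r
    else (c.mulRow N k₁ r).mulRow N k₂ r) c

/-- The first column right of `NL` in the active region with two different Pauli operators
(none of them the identity) in the rows `KU` and `KU + 1`. -/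
def anticommCol (c : Config) : Option ℕ :=
  (List.range' (c.NL + 1) (c.NR - (c.NL + 1))).find? fun l =>
    c.entry c.KU l ≠ .I ∧ c.entry (c.KU + 1) l ≠ .I ∧ c.entry c.KU l ≠ c.entry (c.KU + 1) l

/-- The active region is not empty. -/
def Active (c : Config) : Prop := c.NL < c.NR ∧ c.KU < c.KL

instance (c : Config) : Decidable c.Active := inferInstanceAs (Decidable (_ ∧ _))

/-! #### Normal form of the first array -/

/-- Only one kind of Pauli operator, `σ`, in column `NL`; `k` is the first row containing it. -/
def cnfOne (K N k : ℕ) (σ : Pauli) (c : Config) : Config :=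
  let c := c.swapRows N k c.KU
  let c := c.rotCol K c.NL (Rot.toX σ)
  let c := c.clearOne N c.KU (c.KU + 1) .X
  let c := forRange (c.NL + 1) c.NR (fun j c =>
    if c.entry c.KU j ≠ .I ∧ c.entry c.KU j ≠ .X
    then c.rotCol K j (Rot.toX (c.entry c.KU j)) else c) c
  let c := forRange (c.NL + 1) c.NR (fun j c =>
    if c.entry c.KU j = .X then c.cnotCols K c.NL j else c) c
  { c with KU := c.KU + 1, NL := c.NL + 1 }.charge 2

/-- At least two kinds of Pauli operators in column `NL`, first `σ₁` in row `k₁`, then `σ₂ ≠ σ₁` in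
row `k₂`. -/
def cnfTwo (K N k₁ k₂ : ℕ) (σ₁ σ₂ : Pauli) (c : Config) : Config :=
  let c := c.swapRows N k₁ c.KU
  let c := c.swapRows N k₂ (c.KU + 1)
  let c := c.rotCol K c.NL (Rot.toPair σ₁ σ₂ .X .Z)
  let c := c.charge (2 * N)
  match c.anticommCol with
  | none => c
  | some l =>
    let c := c.rotCol K l (Rot.toPair (c.entry c.KU l) (c.entry (c.KU + 1) l) .X .Y)
    c.cnotCols K c.NL l

/-- One iteration of the reduction of the first array, or the passage to the elimination. -/
def cnfStep (K₁ K₂ N : ℕ) (c : Config) : Config :=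
  if c.Active then
    let c := c.charge (2 * (c.KL - c.KU))
    match c.first with
    | none => { c.swapCols (K₁ + K₂) c.NL (c.NR - 1) with NR := c.NR - 1 }.charge 1
    | some k₁ =>
      match c.firstOther (c.entry k₁ c.NL) with
      | none => c.cnfOne (K₁ + K₂) N k₁ (c.entry k₁ c.NL)
      | some k₂ => c.cnfTwo (K₁ + K₂) N k₁ k₂ (c.entry k₁ c.NL) (c.entry k₂ c.NL)
  else
    { c with
      stage := .trace, R₁ := c.KU, KU := K₁, KL := K₁ + K₂, NL := 0, NR := c.KU, T := 1 }.charge 6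

/-! #### Elimination of the columns of the normal form from the second array -/

/-- One kind of Pauli operator, `σ`, first in row `k`. Row `NL` is the row of the first array that
has its `X` in column `NL`. -/
def traceOne (N k : ℕ) (σ : Pauli) (c : Config) : Config :=
  let c := c.swapRows N k c.KU
  let c := c.clearOne N c.KU (c.KU + 1) σ
  let c := if σ = .X then c.mulRow N c.NL c.KU
    else { c with T := c.T / 2, KU := c.KU + 1 }.charge 2
  { c with NL := c.NL + 1 }.charge 1

/-- At least two kinds of Pauli operators, first `σ₁` in row `k₁`, then `σ₂ ≠ σ₁` in row `k₂`. -/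
def traceTwo (N k₁ k₂ : ℕ) (σ₁ σ₂ : Pauli) (c : Config) : Config :=
  let c := c.swapRows N k₁ c.KU
  let c := c.swapRows N k₂ (c.KU + 1)
  let c := c.clearTwo N c.KU (c.KU + 1) (c.KU + 2) σ₁ σ₂
  let c := if σ₁ = .X then c.swapRows N c.KU (c.KU + 1)
    else if σ₂ = .X then c
    else c.mulRow N c.KU (c.KU + 1)
  let c := c.mulRow N c.NL (c.KU + 1)
  { c with T := c.T / 2, KU := c.KU + 1, NL := c.NL + 1 }.charge 3

/-- One iteration of the elimination, or the passage to the end game. -/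
def traceStep (N : ℕ) (c : Config) : Config :=
  if c.Active then
    let c := c.charge (2 * (c.KL - c.KU))
    match c.first with
    | none => { c with NL := c.NL + 1 }.charge 1
    | some k₁ =>
      match c.firstOther (c.entry k₁ c.NL) with
      | none => c.traceOne N k₁ (c.entry k₁ c.NL)
      | some k₂ => c.traceTwo N k₁ k₂ (c.entry k₁ c.NL) (c.entry k₂ c.NL)
  else
    { c with stage := .rref, NL := c.R₁, NR := N, R₂ := 0 }.charge 3

/-! #### End game: rank and phases of the remaining block -/

/-- One kind of Pauli operator, `σ`, first in row `k`. -/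
def rrefOne (N k : ℕ) (σ : Pauli) (c : Config) : Config :=
  let c := c.swapRows N k c.KU
  let c := c.clearOne N c.KU (c.KU + 1) σ
  { c with KU := c.KU + 1, NL := c.NL + 1, R₂ := c.R₂ + 1 }.charge 3

/-- At least two kinds of Pauli operators, first `σ₁` in row `k₁`, then `σ₂ ≠ σ₁` in row `k₂`. -/
def rrefTwo (N k₁ k₂ : ℕ) (σ₁ σ₂ : Pauli) (c : Config) : Config :=
  let c := c.swapRows N k₁ c.KU
  let c := c.swapRows N k₂ (c.KU + 1)
  let c := c.clearTwo N c.KU (c.KU + 1) (c.KU + 2) σ₁ σ₂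
  { c with KU := c.KU + 2, NL := c.NL + 1, R₂ := c.R₂ + 2 }.charge 3

/-- Steps of the reduction to echelon form. When it is complete, the rows `KU ≤ r < KL` are
identities up to a phase factor; if one of the phase factors is not `1`, set `T = 0`. -/
def rrefStep (N : ℕ) (c : Config) : Config :=
  if c.Active then
    let c := c.charge (2 * (c.KL - c.KU))
    match c.first with
    | none => { c with NL := c.NL + 1 }.charge 1
    | some k₁ =>
      match c.firstOther (c.entry k₁ c.NL) with
      | none => c.rrefOne N k₁ (c.entry k₁ c.NL)
      | some k₂ => c.rrefTwo N k₁ k₂ (c.entry k₁ c.NL) (c.entry k₂ c.NL)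
  else
    { c with
      stage := .halt
      T := if ∃ r ∈ List.range' c.KU (c.KL - c.KU), (c.arr r).phase ≠ 0 then 0 else c.T
      C := 2 ^ (N - c.R₁ - c.R₂) }.charge ((c.KL - c.KU) + N + 3)

/-- One iteration of the algorithm. -/
def step (K₁ K₂ N : ℕ) (c : Config) : Config :=
  match c.stage with
  | .cnf => c.cnfStep K₁ K₂ N
  | .trace => c.traceStep N
  | .rref => c.rrefStep N
  | .halt => c

/-- The return value for the overlap. -/
noncomputable def overlapValue (K₁ K₂ N : ℕ) (c : Config) : ℝ :=
  (c.C : ℝ) * (c.T : ℝ) / (2 : ℝ) ^ (((N : ℤ) - K₁) + ((N : ℤ) - K₂))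

/-- The return value for the Uhlmann fidelity. -/
noncomputable def fidelityValue (K₁ K₂ N : ℕ) (c : Config) : ℝ :=
  (c.C : ℝ) * Real.sqrt ((c.T : ℝ) / (2 : ℝ) ^ (((N : ℤ) - K₁) + ((N : ℤ) - K₂)))

end Config

/-- The initial configuration: the composite array of the two generator sets (the first array in
the rows `0, …, K₁ - 1`, the second in the rows `K₁, …, K₁ + K₂ - 1`), with the first array as
active region. -/
def initial {K₁ K₂ N : ℕ} (g₁ : Fin K₁ → StabOp N) (g₂ : Fin K₂ → StabOp N) : Config where
  stage := .cnf
  arr r := if h : r < K₁ + K₂ then (Fin.append g₁ g₂ ⟨r, h⟩).toRow else Row.one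
  KU := 0
  KL := K₁
  NL := 0
  NR := N
  R₁ := 0
  R₂ := 0
  T := 1
  C := 1
  cost := (K₁ + K₂) * (N + 1)

/-- Algorithm OVERLAP, run for `n` iterations. -/
def run {K₁ K₂ N : ℕ} (g₁ : Fin K₁ → StabOp N) (g₂ : Fin K₂ → StabOp N) (n : ℕ) : Config :=
  (Config.step K₁ K₂ N)^[n] (initial g₁ g₂)

/-- `out` is the final configuration of algorithm OVERLAP on the input `g₁`, `g₂`. -/
def Halts {K₁ K₂ N : ℕ} (g₁ : Fin K₁ → StabOp N) (g₂ : Fin K₂ → StabOp N) (out : Config) : Prop :=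
  out.stage = .halt ∧ ∃ n, run g₁ g₂ n = out

end StabOverlap

namespace StabOverlap

/-! ### Phase factors and tensor products -/

/-! Every row is read as the operator that it denotes (`Row.toMatrix`), and two facts carry the
symbolic algorithm over to operators. A column operation conjugates all rows by one and the same
Clifford unitary (`Row.toMatrix_rot`, `Row.toMatrix_swap`, `Row.toMatrix_cnot`). Transpositions and
multiplications inside a family of commuting involutions `f r` do not change `∏ (1 + f r) / 2`,
because this projector is determined by the operators that the family fixes (`proj_eq_of_fixedBy`).

Normal form: once a row is `± X_u`, every row commuting with it has only `1` or `X` in column `u`,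
which is why the signs of the CNOT side effects need no attention. An iteration with two kinds of
Pauli operators deletes nothing but lowers the weight of the top row, so the loop ends. Independence
and the exclusion of `-1` give `2 ^ K * Tr P = 2 ^ N`; rows left over at the end would be `± 1` and
give the wrong trace, so all rows are used up (`CnfInv.eq_hi`).

Elimination: let `A` be the projector of the rows `± X_r` and `x` one of these rows, so that `x A =
A x = A`. Multiplying an active row that commutes with `x` by `x` is invisible behind `A`. If `g`
anticommutes with `x` while the product `R` of the other factors commutes with it, then `A g R A = A
x g R A = -A g x R A = -A g R A`, hence `A g R A = 0`, and the factor `(1 + g) / 2` may be replaced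
by `1 / 2` (`Single.delete`). So `A B A = T • A B' A`, where `B'` belongs to rows that are trivial
on the first `K₁` columns and hence commutes with `A`.

End game: in echelon form each pivot column kills the traces of the products containing its pivot
rows (`TraceScalar`), so `A` times the `R₂` pivot factors has trace `2 ^ (N - K₁ - R₂)`. The other
rows are `± 1` and contribute the factor `1` or `0`. The tensor product form comes from a second,
purely theoretical run of the normal form reduction, on the `K₁` normalised rows followed by the
`R₂` pivot rows (`RrefInv.finish`).

Therefore `P₁ P₂ P₁ = T • Q` with a projector `Q` of known rank. Cyclicity of the trace gives the
overlap, and square roots of multiples of projectors give the fidelity. Comparing the ranks of `Q`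
and `P₂` yields `K₂ ≤ K₁ + R₂` when `T ≠ 0`, hence the bound `1`. -/

/-- The phase factor `i ^ k`. -/
noncomputable def iPow (k : ZMod 4) : ℂ := Complex.I ^ k.val

@[simp] theorem iPow_zero : iPow 0 = 1 := by simp [iPow]

theorem iPow_two : iPow 2 = -1 := by
  have : (2 : ZMod 4).val = 2 := rfl
  simp [iPow, this]

theorem iPow_one : iPow 1 = Complex.I := by
  have : (1 : ZMod 4).val = 1 := rfl
  simp [iPow, this]

theorem iPow_three : iPow 3 = -Complex.I := by
  have : (3 : ZMod 4).val = 3 := rfl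
  simp [iPow, this, Complex.I_pow_three]

theorem iPow_add (a b : ZMod 4) : iPow (a + b) = iPow a * iPow b := by
  rw [iPow, iPow, iPow, ← pow_add, ZMod.val_add]
  conv_rhs => rw [← Nat.div_add_mod (a.val + b.val) 4, pow_add, pow_mul, Complex.I_pow_four, one_pow,
    one_mul]

theorem iPow_sum {ι : Type*} (s : Finset ι) (f : ι → ZMod 4) :
    iPow (∑ j ∈ s, f j) = ∏ j ∈ s, iPow (f j) := by
  classical
  induction s using Finset.induction_on with
  | empty => simp
  | insert a s ha ih => rw [Finset.sum_insert ha, Finset.prod_insert ha, iPow_add, ih]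

theorem iPow_ne_zero (k : ZMod 4) : iPow k ≠ 0 := pow_ne_zero _ Complex.I_ne_zero

/-- Phases are stored in `ZMod 4`, but the rows that occur are involutions; this is what forces
their phase factors to be real. -/
theorem iPow_mul_self_eq_one {k : ZMod 4} (h : iPow k * iPow k = 1) : k = 0 ∨ k = 2 := by
  revert h
  have : k = 0 ∨ k = 1 ∨ k = 2 ∨ k = 3 := by revert k; decide
  rcases this with rfl | rfl | rfl | rfl
  · simp
  · rw [iPow_one]; intro h; norm_num at h
  · simp
  · rw [iPow_three]; intro h; norm_num at h

theorem tensor_mul {N : ℕ} (A B : Fin N → Matrix (Fin 2) (Fin 2) ℂ) :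
    tensor A * tensor B = tensor fun i => A i * B i := by
  ext a b
  simp only [tensor, Matrix.mul_apply, Matrix.of_apply, Finset.prod_univ_sum,
    Fintype.piFinset_univ, Finset.prod_mul_distrib]

theorem tensor_smul {N : ℕ} (z : Fin N → ℂ) (A : Fin N → Matrix (Fin 2) (Fin 2) ℂ) :
    (tensor fun i => z i • A i) = (∏ i, z i) • tensor A := by
  ext a b
  simp [tensor, Finset.prod_mul_distrib]

theorem trace_tensor {N : ℕ} (A : Fin N → Matrix (Fin 2) (Fin 2) ℂ) :
    (tensor A).trace = ∏ i, (A i).trace := by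
  simp only [tensor, Matrix.trace, Matrix.diag, Matrix.of_apply, Finset.prod_univ_sum,
    Fintype.piFinset_univ]

theorem star_tensor {N : ℕ} (A : Fin N → Matrix (Fin 2) (Fin 2) ℂ) :
    star (tensor A) = tensor fun i => star (A i) := by
  ext a b
  simp [tensor, Matrix.star_apply]

theorem tensor_one {N : ℕ} : tensor (fun _ : Fin N => 1) = 1 := by
  ext a b
  simp only [tensor, Matrix.of_apply, Matrix.one_apply]
  by_cases h : a = b
  · simp [h]
  · rw [if_neg h]
    obtain ⟨i, hi⟩ := Function.ne_iff.mp h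
    exact Finset.prod_eq_zero (Finset.mem_univ i) (by simp [hi])

theorem tensor_update_mul_tensor {N : ℕ} (j : Fin N) (V : Matrix (Fin 2) (Fin 2) ℂ)
    (A : Fin N → Matrix (Fin 2) (Fin 2) ℂ) :
    onQubit j V * tensor A = tensor (Function.update A j (V * A j)) := by
  rw [onQubit, tensor_mul]
  congr 1; ext1 i
  by_cases h : i = j
  · subst h; simp
  · simp [h]

theorem tensor_mul_tensor_update {N : ℕ} (j : Fin N) (V : Matrix (Fin 2) (Fin 2) ℂ)
    (A : Fin N → Matrix (Fin 2) (Fin 2) ℂ) :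
    tensor A * onQubit j V = tensor (Function.update A j (A j * V)) := by
  rw [onQubit, tensor_mul]
  congr 1; ext1 i
  by_cases h : i = j
  · subst h; simp
  · simp [h]

theorem tensor_update_smul {N : ℕ} (j : Fin N) (z : ℂ) (V : Matrix (Fin 2) (Fin 2) ℂ)
    (A : Fin N → Matrix (Fin 2) (Fin 2) ℂ) :
    tensor (Function.update A j (z • V)) = z • tensor (Function.update A j V) := by
  have : Function.update A j (z • V) =
      fun i => (Function.update (fun _ => 1) j z : Fin N → ℂ) i • Function.update A j V i := by
    ext1 i
    by_cases h : i = j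
    · subst h; simp
    · simp [h]
  rw [this, tensor_smul, Finset.prod_update_of_mem (Finset.mem_univ j)]
  simp

theorem onQubit_mul {N : ℕ} (j : Fin N) (V W : Matrix (Fin 2) (Fin 2) ℂ) :
    onQubit j (V * W) = onQubit j V * onQubit j W := by
  conv_rhs => rw [onQubit.eq_1 j W, tensor_update_mul_tensor]
  simp [onQubit]

theorem onQubit_one {N : ℕ} (j : Fin N) : onQubit j 1 = 1 := by
  rw [onQubit, Function.update_eq_self_iff.mpr rfl, tensor_one]

theorem star_onQubit {N : ℕ} (j : Fin N) (V : Matrix (Fin 2) (Fin 2) ℂ) :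
    star (onQubit j V) = onQubit j (star V) := by
  rw [onQubit, star_tensor, onQubit]
  congr 1; ext1 i
  by_cases h : i = j
  · subst h; simp
  · simp [h]

/-! ### Matrices of Pauli symbols -/

theorem Pauli.toMatrix_mul (σ τ : Pauli) :
    σ.toMatrix * τ.toMatrix = iPow (Pauli.mul σ τ).1 • (Pauli.mul σ τ).2.toMatrix := by
  cases σ <;> cases τ <;> ext a b <;> fin_cases a <;> fin_cases b <;>
    simp [Pauli.mul, Pauli.toMatrix, iPow_one, iPow_three]

theorem Pauli.trace_toMatrix {σ : Pauli} (h : σ ≠ .I) : σ.toMatrix.trace = 0 := by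
  cases σ <;> simp_all [Pauli.toMatrix, Matrix.trace_fin_two]

/-- The sign in `σ τ = ± τ σ`. -/
def Pauli.swapSign (σ τ : Pauli) : ℤˣ :=
  if σ ≠ .I ∧ τ ≠ .I ∧ σ ≠ τ then -1 else 1

theorem Pauli.toMatrix_mul_comm (σ τ : Pauli) :
    σ.toMatrix * τ.toMatrix = (((swapSign σ τ : ℤˣ) : ℤ) : ℂ) • (τ.toMatrix * σ.toMatrix) := by
  cases σ <;> cases τ <;> ext a b <;> fin_cases a <;> fin_cases b <;>
    simp [Pauli.swapSign, Pauli.toMatrix]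

theorem Pauli.toMatrix_I : Pauli.I.toMatrix = 1 := rfl

theorem Pauli.mul_self (σ : Pauli) : Pauli.mul σ σ = (0, .I) := by cases σ <;> rfl

theorem Pauli.mul_I (σ : Pauli) : Pauli.mul σ .I = (0, σ) := by cases σ <;> rfl

/-! ### Matrices of rows -/

/-- The matrix of the first `N` columns of a row. -/
noncomputable def Row.toMatrix (N : ℕ) (a : Row) : Op N :=
  iPow a.phase • tensor fun i : Fin N => (a.op i).toMatrix

theorem Row.toMatrix_one (N : ℕ) : Row.one.toMatrix N = 1 := by
  simp [Row.one, Row.toMatrix, Pauli.toMatrix, tensor_one]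

theorem Row.toMatrix_mul (N : ℕ) (a b : Row) :
    (Row.mul N a b).toMatrix N = a.toMatrix N * b.toMatrix N := by
  simp only [Row.toMatrix, Row.mul, iPow_add, iPow_sum, smul_mul_smul_comm, tensor_mul,
    Pauli.toMatrix_mul, tensor_smul, smul_smul]
  rw [Finset.prod_range]

theorem StabOp.toMatrix_toRow {N : ℕ} (g : StabOp N) : g.toRow.toMatrix N = g.toMatrix := by
  have h : iPow (if g.sign = 1 then 0 else 2) = (((g.sign : ℤˣ) : ℤ) : ℂ) := by
    rcases Int.units_eq_one_or g.sign with h | h <;> simp [h, iPow_two]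
  simp [StabOp.toRow, Row.toMatrix, StabOp.toMatrix, h]

theorem Row.trace_eq_zero {N : ℕ} {a : Row} {j : ℕ} (hj : j < N) (h : a.op j ≠ .I) :
    (a.toMatrix N).trace = 0 := by
  rw [Row.toMatrix, Matrix.trace_smul, trace_tensor,
    Finset.prod_eq_zero (Finset.mem_univ ⟨j, hj⟩) (Pauli.trace_toMatrix h), smul_zero]

theorem Row.toMatrix_of_forall_eq_I {N : ℕ} {a : Row} (h : ∀ j < N, a.op j = .I) :
    a.toMatrix N = iPow a.phase • 1 := by
  have : (fun i : Fin N => (a.op i).toMatrix) = fun _ => 1 := by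
    ext1 i; simp [h i i.2, Pauli.toMatrix]
  rw [Row.toMatrix, this, tensor_one]

theorem Row.toMatrix_mul_comm (N : ℕ) (a b : Row) :
    a.toMatrix N * b.toMatrix N =
      (∏ i : Fin N, (((Pauli.swapSign (a.op i) (b.op i) : ℤˣ) : ℤ) : ℂ)) •
        (b.toMatrix N * a.toMatrix N) := by
  simp only [Row.toMatrix, smul_mul_smul_comm, tensor_mul]
  simp only [fun i : Fin N => Pauli.toMatrix_mul_comm (a.op i) (b.op i), tensor_smul]
  rw [smul_comm, mul_comm]

theorem Row.toMatrix_mul_self_eq (N : ℕ) (a : Row) :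
    a.toMatrix N * a.toMatrix N = (iPow a.phase * iPow a.phase) • 1 := by
  simp only [Row.toMatrix, smul_mul_smul_comm, tensor_mul, Pauli.toMatrix_mul, Pauli.mul_self,
    iPow_zero, one_smul, Pauli.toMatrix_I, tensor_one]

theorem Row.toMatrix_ne_zero (N : ℕ) (a : Row) : a.toMatrix N ≠ 0 := by
  intro h
  have := Row.toMatrix_mul_self_eq N a
  rw [h, mul_zero] at this
  have h2 := congrFun (congrFun this 0) 0
  simp [iPow_ne_zero] at h2

theorem Row.phase_of_mul_self {N : ℕ} {a : Row} (h : a.toMatrix N * a.toMatrix N = 1) :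
    a.phase = 0 ∨ a.phase = 2 := by
  rw [Row.toMatrix_mul_self_eq] at h
  apply iPow_mul_self_eq_one
  have h2 := congrFun (congrFun h 0) 0
  simpa using h2

theorem Row.commute_of_forall {N : ℕ} {a b : Row}
    (h : ∀ j < N, a.op j = .I ∨ b.op j = .I ∨ a.op j = b.op j) :
    Commute (a.toMatrix N) (b.toMatrix N) := by
  have : ∀ i : Fin N, Pauli.swapSign (a.op i) (b.op i) = 1 := fun i => by
    rw [Pauli.swapSign, if_neg]; have := h i i.2; tauto
  rw [Commute, SemiconjBy, Row.toMatrix_mul_comm]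
  simp [this]

theorem Row.anticommute_of_unique {N : ℕ} {a b : Row} {k : ℕ} (hk : k < N)
    (ha : a.op k ≠ .I) (hb : b.op k ≠ .I) (hab : a.op k ≠ b.op k)
    (h : ∀ j < N, j ≠ k → a.op j = .I ∨ b.op j = .I ∨ a.op j = b.op j) :
    a.toMatrix N * b.toMatrix N = -(b.toMatrix N * a.toMatrix N) := by
  rw [Row.toMatrix_mul_comm, Finset.prod_eq_single (⟨k, hk⟩ : Fin N)]
  · simp [Pauli.swapSign, ha, hb, hab]
  · intro i _ hi
    have : Pauli.swapSign (a.op i) (b.op i) = 1 := by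
      rw [Pauli.swapSign, if_neg]
      have := h i i.2 (fun e => hi (Fin.ext e)); tauto
    simp [this]
  · simp

/-- Commuting rows with an anticommuting pair in one column have one in another column. -/
theorem Row.exists_anticommuting {N : ℕ} {a b : Row} {k : ℕ} (hk : k < N)
    (hc : Commute (a.toMatrix N) (b.toMatrix N))
    (ha : a.op k ≠ .I) (hb : b.op k ≠ .I) (hab : a.op k ≠ b.op k) :
    ∃ j < N, j ≠ k ∧ a.op j ≠ .I ∧ b.op j ≠ .I ∧ a.op j ≠ b.op j := by
  by_contra! hcon
  have h := Row.anticommute_of_unique hk ha hb hab (fun j hj hjk => by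
    have := hcon j hj hjk; tauto)
  -- Commuting and anticommuting at once, the two rows would have product zero; but their product is
  -- again a row, and rows are nonzero.
  rw [hc.eq, ← Row.toMatrix_mul, eq_neg_iff_add_eq_zero, ← two_smul ℂ] at h
  exact Row.toMatrix_ne_zero _ _ ((smul_eq_zero.mp h).resolve_left two_ne_zero)

/-! ### Clifford gates -/

theorem star_hadamard : star hadamard = hadamard := by
  ext a b; fin_cases a <;> fin_cases b <;> simp [hadamard, Matrix.star_apply]

theorem hadamard_mul_mul (M : Matrix (Fin 2) (Fin 2) ℂ) :
    hadamard * M * hadamard =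
      (2⁻¹ : ℂ) • (!![1, 1; 1, -1] * M * !![1, 1; 1, -1]) := by
  have h : (((Real.sqrt 2 : ℝ) : ℂ)⁻¹ * ((Real.sqrt 2 : ℝ) : ℂ)⁻¹) = 2⁻¹ := by
    rw [← mul_inv, ← Complex.ofReal_mul, Real.mul_self_sqrt (by norm_num)]; norm_num
  rw [hadamard, Matrix.smul_mul, Matrix.smul_mul, Matrix.mul_smul, smul_smul, h]

theorem hadamard_mul_self : hadamard * hadamard = 1 := by
  have := hadamard_mul_mul 1
  rw [mul_one] at this
  rw [this]
  ext a b; fin_cases a <;> fin_cases b <;> norm_num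

theorem star_phaseGate_mul : star phaseGate * phaseGate = 1 := by
  ext a b; fin_cases a <;> fin_cases b <;>
    simp [phaseGate, Matrix.mul_apply, Matrix.star_apply]

/-- One-qubit unitaries composed of Hadamard and phase gates. -/
noncomputable def qubitCircuits : Submonoid (Matrix (Fin 2) (Fin 2) ℂ) :=
  Submonoid.closure {hadamard, phaseGate}

theorem star_mul_self_of_mem_qubitCircuits {V : Matrix (Fin 2) (Fin 2) ℂ}
    (hV : V ∈ qubitCircuits) : star V * V = 1 := by
  have : qubitCircuits ≤ Matrix.unitaryGroup (Fin 2) ℂ := by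
    refine Submonoid.closure_le.mpr ?_
    rintro V (rfl | rfl)
    · exact Matrix.mem_unitaryGroup_iff'.mpr (by rw [star_hadamard, hadamard_mul_self])
    · exact Matrix.mem_unitaryGroup_iff'.mpr star_phaseGate_mul
  exact Matrix.mem_unitaryGroup_iff'.mp (this hV)

theorem onQubit_mem {N : ℕ} (j : Fin N) {V : Matrix (Fin 2) (Fin 2) ℂ} (hV : V ∈ qubitCircuits) :
    onQubit j V ∈ cliffordCircuits N := by
  induction hV using Submonoid.closure_induction with
  | mem x hx =>
    refine Submonoid.subset_closure ?_
    rcases hx with rfl | rfl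
    · exact Or.inl (Or.inl (Or.inl ⟨j, rfl⟩))
    · exact Or.inl (Or.inl (Or.inr ⟨j, rfl⟩))
  | one => rw [onQubit_one]; exact one_mem _
  | mul x y _ _ hx hy => rw [onQubit_mul]; exact mul_mem hx hy

/-- `φ` describes the conjugation of the Pauli operators by a one-qubit circuit. -/
def Implemented (φ : Pauli → ZMod 4 × Pauli) : Prop :=
  ∃ V ∈ qubitCircuits, ∀ σ, V * σ.toMatrix * star V = iPow (φ σ).1 • (φ σ).2.toMatrix

theorem Implemented.comp {φ ψ : Pauli → ZMod 4 × Pauli} (hφ : Implemented φ)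
    (hψ : Implemented ψ) :
    Implemented fun σ => ((ψ σ).1 + (φ (ψ σ).2).1, (φ (ψ σ).2).2) := by
  obtain ⟨V, hV, h⟩ := hφ
  obtain ⟨W, hW, h'⟩ := hψ
  refine ⟨V * W, mul_mem hV hW, fun σ => ?_⟩
  rw [star_mul, show V * W * σ.toMatrix * (star W * star V) =
    V * (W * σ.toMatrix * star W) * star V by simp only [mul_assoc], h', Matrix.mul_smul,
    Matrix.smul_mul, h, smul_smul, iPow_add]

theorem implemented_zyx : Implemented Rot.zyx.act := by
  refine ⟨hadamard, Submonoid.subset_closure (Or.inl rfl), fun σ => ?_⟩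
  rw [star_hadamard, hadamard_mul_mul]
  cases σ <;> ext a b <;> fin_cases a <;> fin_cases b <;>
    norm_num [Rot.act, Pauli.toMatrix, iPow_two] <;> ring

theorem implemented_phaseGate : Implemented
    fun | .I => (0, .I) | .X => (0, .Y) | .Y => (2, .X) | .Z => (0, .Z) := by
  refine ⟨phaseGate, Submonoid.subset_closure (Or.inr rfl), fun σ => ?_⟩
  cases σ <;> ext a b <;> fin_cases a <;> fin_cases b <;>
    simp [phaseGate, Pauli.toMatrix, Matrix.mul_apply, Matrix.star_apply, iPow_two]

/-- Hadamard after which the phase gate is applied permutes `X`, `Y`, `Z` cyclically without signs,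
so its powers give the three even permutations. The odd ones are Hadamard itself, a conjugate of it
by the cycle, and a phase gate corrected by `H S² H = X`, which puts the sign where the table has
it. -/
theorem Rot.implemented (u : Rot) : Implemented u.act := by
  have hS := implemented_phaseGate
  have hH := implemented_zyx
  have h1 : Implemented Rot.zxy.act := by
    convert hS.comp hH using 2 with σ; cases σ <;> rfl
  have h2 : Implemented Rot.yzx.act := by
    convert h1.comp h1 using 2 with σ; cases σ <;> rfl
  cases u
  · convert h1.comp h2 using 2 with σ; cases σ <;> rfl
  · exact h1
  · exact h2
  · convert h1.comp (hH.comp h2) using 2 with σ; cases σ <;> rfl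
  · convert hS.comp (hH.comp (hS.comp (hS.comp hH))) using 2 with σ; cases σ <;> rfl
  · exact hH

theorem Row.toMatrix_rot {N j : ℕ} (hj : j < N) (u : Rot) :
    ∃ U ∈ cliffordCircuits N, ∀ a : Row,
      (a.rot j u).toMatrix N = U * a.toMatrix N * star U := by
  obtain ⟨V, hV, h⟩ := u.implemented
  refine ⟨onQubit ⟨j, hj⟩ V, onQubit_mem _ hV, fun a => ?_⟩
  rw [Row.toMatrix.eq_1 N a, Matrix.mul_smul, Matrix.smul_mul, tensor_update_mul_tensor, star_onQubit,
    tensor_mul_tensor_update, Function.update_self, Function.update_idem, h, tensor_update_smul,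
    smul_smul, Row.toMatrix, Row.rot, iPow_add]
  congr 2; ext1 i
  by_cases hi : i = ⟨j, hj⟩
  · subst hi; simp
  · have : (i : ℕ) ≠ j := fun e => hi (Fin.ext e)
    simp [hi, this]

/-- The permutation matrix of an involution of the basis vectors. -/
theorem permMatrix_conj {N : ℕ} {π : (Fin N → Fin 2) → (Fin N → Fin 2)}
    (hπ : Function.Involutive π) (M : Op N) :
    (Matrix.of fun a b => if a = π b then 1 else 0 : Op N) * M *
      star (Matrix.of fun a b => if a = π b then 1 else 0 : Op N) =
        Matrix.of fun a b => M (π a) (π b) := by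
  have key : ∀ a b, (a = π b) = (π a = b) := fun a b =>
    propext ⟨fun h => by rw [h, hπ], fun h => by rw [← h, hπ]⟩
  ext a b
  simp only [Matrix.mul_apply, Matrix.star_apply, Matrix.of_apply, key]
  simp

theorem swap_involutive {N : ℕ} (i j : Fin N) :
    Function.Involutive fun b : Fin N → Fin 2 => b ∘ Equiv.swap i j := by
  intro b; ext k; simp

theorem cnot_involutive {N : ℕ} {c t : Fin N} (h : c ≠ t) :
    Function.Involutive fun b : Fin N → Fin 2 => Function.update b t (b t + b c) := by
  intro b
  have : b t + b c + b c = b t := by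
    generalize b t = x; generalize b c = y; revert x y; decide
  simp [Function.update_of_ne h, this]

theorem swapGate_conj {N : ℕ} (i j : Fin N) (M : Op N) :
    swapGate i j * M * star (swapGate i j) =
      Matrix.of fun a b => M (a ∘ Equiv.swap i j) (b ∘ Equiv.swap i j) :=
  permMatrix_conj (swap_involutive i j) M

theorem cnotGate_conj {N : ℕ} {c t : Fin N} (h : c ≠ t) (M : Op N) :
    cnotGate c t * M * star (cnotGate c t) =
      Matrix.of fun a b =>
        M (Function.update a t (a t + a c)) (Function.update b t (b t + b c)) :=
  permMatrix_conj (cnot_involutive h) M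

theorem cliffordCircuits_le_unitary (N : ℕ) :
    cliffordCircuits N ≤ Matrix.unitaryGroup (Fin N → Fin 2) ℂ := by
  refine Submonoid.closure_le.mpr ?_
  have one_q : ∀ (j : Fin N), ∀ V ∈ qubitCircuits,
      onQubit j V ∈ Matrix.unitaryGroup (Fin N → Fin 2) ℂ := fun j V hV => by
    rw [Matrix.mem_unitaryGroup_iff', star_onQubit, ← onQubit_mul,
      star_mul_self_of_mem_qubitCircuits hV, onQubit_one]
  rintro U (((⟨j, rfl⟩ | ⟨j, rfl⟩) | ⟨i, j, rfl⟩) | ⟨c, t, h, rfl⟩)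
  · exact one_q j _ (Submonoid.subset_closure (Or.inl rfl))
  · exact one_q j _ (Submonoid.subset_closure (Or.inr rfl))
  -- Conjugating the identity computes `U * star U`; for a bijection of the basis vectors the result
  -- is the identity.
  · have := swapGate_conj i j 1
    rw [mul_one] at this
    refine Matrix.mem_unitaryGroup_iff.mpr (this.trans ?_)
    ext a b
    simp [Matrix.one_apply, (swap_involutive i j).injective.eq_iff]
  · have := cnotGate_conj h 1
    rw [mul_one] at this
    refine Matrix.mem_unitaryGroup_iff.mpr (this.trans ?_)
    ext a b
    simp [Matrix.one_apply, (cnot_involutive h).injective.eq_iff]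

theorem Row.toMatrix_swap {N i j : ℕ} (hi : i < N) (hj : j < N) :
    ∃ U ∈ cliffordCircuits N, ∀ a : Row,
      (a.swap i j).toMatrix N = U * a.toMatrix N * star U := by
  refine ⟨swapGate ⟨i, hi⟩ ⟨j, hj⟩,
    Submonoid.subset_closure (Or.inl (Or.inr ⟨_, _, rfl⟩)), fun a => ?_⟩
  rw [swapGate_conj]
  ext x y
  simp only [Row.toMatrix, Row.swap, tensor, Matrix.smul_apply, Matrix.of_apply]
  congr 1
  -- Relabelling the basis vectors becomes a permutation of the tensor factors once the product is
  -- reindexed by the same transposition.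
  rw [← Equiv.prod_comp (Equiv.swap (⟨i, hi⟩ : Fin N) ⟨j, hj⟩)]
  refine Finset.prod_congr rfl fun k _ => ?_
  have : Equiv.swap i j ((Equiv.swap (⟨i, hi⟩ : Fin N) ⟨j, hj⟩ k : Fin N) : ℕ) = (k : ℕ) := by
    simp only [Equiv.swap_apply_def, Fin.ext_iff]
    split_ifs <;> simp_all
  simp [this]

/-- The CNOT table in matrix entries: conjugation by the permutation matrix adds the control index
to the target index on both sides, so the whole table is a finite check on two qubits. -/
theorem cnotAct_spec (σ τ : Pauli) (a c b d : Fin 2) :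
    σ.toMatrix a b * τ.toMatrix (c + a) (d + b) =
      iPow (cnotAct σ τ).1 *
        ((cnotAct σ τ).2.1.toMatrix a b * (cnotAct σ τ).2.2.toMatrix c d) := by
  cases σ <;> cases τ <;> fin_cases a <;> fin_cases b <;> fin_cases c <;> fin_cases d <;>
    simp [cnotAct, Pauli.toMatrix, iPow_two, Matrix.one_apply]

theorem Row.toMatrix_cnot {N i j : ℕ} (hi : i < N) (hj : j < N) (hij : i ≠ j) :
    ∃ U ∈ cliffordCircuits N, ∀ a : Row,
      (a.cnot i j).toMatrix N = U * a.toMatrix N * star U := by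
  have hne : (⟨i, hi⟩ : Fin N) ≠ ⟨j, hj⟩ := fun e => hij (Fin.ext_iff.mp e)
  refine ⟨cnotGate ⟨i, hi⟩ ⟨j, hj⟩,
    Submonoid.subset_closure (Or.inr ⟨_, _, hne, rfl⟩), fun a => ?_⟩
  rw [cnotGate_conj hne]
  ext x y
  have hm : (⟨i, hi⟩ : Fin N) ∈ Finset.univ.erase (⟨j, hj⟩ : Fin N) := by simp [hij]
  simp only [Row.toMatrix, Row.cnot, tensor, Matrix.smul_apply, Matrix.of_apply, iPow_add,
    smul_eq_mul]
  rw [mul_assoc]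
  congr 1
  -- The factors of target and control are split off; they are covered by `cnotAct_spec`, and all
  -- other factors agree.
  rw [← Finset.mul_prod_erase _ _ (Finset.mem_univ (⟨j, hj⟩ : Fin N)),
    ← Finset.mul_prod_erase _ _ hm, ← Finset.mul_prod_erase _ _ (Finset.mem_univ (⟨j, hj⟩ : Fin N)),
    ← Finset.mul_prod_erase _ _ hm, ← mul_assoc, ← mul_assoc, ← mul_assoc]
  congr 1
  · have := cnotAct_spec (a.op i) (a.op j) (x ⟨i, hi⟩) (x ⟨j, hj⟩) (y ⟨i, hi⟩) (y ⟨j, hj⟩)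
    simp only [Function.update_self, Function.update_of_ne hij, Function.update_of_ne hne]
    rw [mul_comm (Pauli.toMatrix (a.op j) _ _), this]; ring
  · refine Finset.prod_congr rfl fun k hk => ?_
    have h1 : (k : ℕ) ≠ i := fun e => by simp [Fin.ext_iff, e] at hk
    have h2 : (k : ℕ) ≠ j := fun e => by simp [Fin.ext_iff, e] at hk
    have h3 : k ≠ ⟨j, hj⟩ := fun e => h2 (Fin.ext_iff.mp e)
    simp [h1, h2, h3]

/-! ### Projectors of families of commuting involutions -/

/-- The product of the operators `(1 + f r) / 2` for `a ≤ r < b`. -/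
noncomputable def proj {N : ℕ} (f : ℕ → Op N) (a b : ℕ) : Op N :=
  ((List.range' a (b - a)).map fun r => (2⁻¹ : ℂ) • (1 + f r)).prod

/-- The operators `f r` with `a ≤ r < b` are commuting involutions. -/
structure InvolFamily {N : ℕ} (f : ℕ → Op N) (a b : ℕ) : Prop where
  comm : ∀ r s, a ≤ r → r < b → a ≤ s → s < b → Commute (f r) (f s)
  invol : ∀ r, a ≤ r → r < b → f r * f r = 1

/-- `W` is invariant under multiplication by `f r` on both sides for `a ≤ r < b`. -/
def FixedBy {N : ℕ} (f : ℕ → Op N) (a b : ℕ) (W : Op N) : Prop :=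
  ∀ r, a ≤ r → r < b → f r * W = W ∧ W * f r = W

section proj

variable {N : ℕ} {f g : ℕ → Op N} {a b c : ℕ}

theorem InvolFamily.mono (h : InvolFamily f a b) {a' b' : ℕ} (ha : a ≤ a') (hb : b' ≤ b) :
    InvolFamily f a' b' :=
  ⟨fun r s h1 h2 h3 h4 => h.comm r s (by omega) (by omega) (by omega) (by omega),
    fun r h1 h2 => h.invol r (by omega) (by omega)⟩

theorem proj_of_le (h : b ≤ a) : proj f a b = 1 := by
  simp [proj, Nat.sub_eq_zero_of_le h]

theorem proj_succ_left (h : a < b) : proj f a b = ((2⁻¹ : ℂ) • (1 + f a)) * proj f (a + 1) b := by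
  have : b - a = (b - (a + 1)) + 1 := by omega
  rw [proj, this, List.range'_succ, List.map_cons, List.prod_cons, proj]

theorem proj_mul_proj (h : a ≤ b) (h' : b ≤ c) : proj f a b * proj f b c = proj f a c := by
  rw [proj, proj, proj, ← List.prod_append, ← List.map_append]
  have h1 : b = a + (b - a) := by omega
  have h2 : c - a = (b - a) + (c - b) := by omega
  rw [h2]
  conv_lhs => rw [show List.range' b (c - b) = List.range' (a + (b - a)) (c - b) by rw [← h1]]
  rw [List.range'_append_1]

theorem proj_succ_right (h : a ≤ b) : proj f a (b + 1) = proj f a b * ((2⁻¹ : ℂ) • (1 + f b)) := by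
  rw [← proj_mul_proj h (Nat.le_succ b), proj_succ_left (Nat.lt_succ_self b),
    proj_of_le (le_refl (b + 1)), mul_one]

theorem proj_congr (h : ∀ r, a ≤ r → r < b → f r = g r) : proj f a b = proj g a b := by
  rw [proj, proj]
  congr 1
  refine List.map_congr_left fun r hr => ?_
  rw [List.mem_range'_1] at hr
  rw [h r hr.1 (by omega)]

theorem proj_conj {U : Op N} (hU : U ∈ Matrix.unitaryGroup (Fin N → Fin 2) ℂ) :
    proj (fun r => U * f r * star U) a b = U * proj f a b * star U := by
  have h1 : U * star U = 1 := Matrix.mem_unitaryGroup_iff.mp hU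
  have h2 : star U * U = 1 := Matrix.mem_unitaryGroup_iff'.mp hU
  rw [proj, proj]
  generalize List.range' a (b - a) = l
  induction l with
  | nil => simp [h1]
  | cons r l ih =>
    rw [List.map_cons, List.prod_cons, ih, List.map_cons, List.prod_cons]
    have : (2⁻¹ : ℂ) • (1 + U * f r * star U) = U * ((2⁻¹ : ℂ) • (1 + f r)) * star U := by
      rw [Matrix.mul_smul, Matrix.smul_mul, mul_add, add_mul, mul_one, h1]
    rw [this]
    simp only [mul_assoc]
    rw [← mul_assoc (star U) U, h2, one_mul]

theorem commute_half_one_add {V W : Op N} (h : Commute V W) :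
    Commute V ((2⁻¹ : ℂ) • (1 + W)) :=
  ((Commute.one_right V).add_right h).smul_right _

theorem commute_proj {V : Op N} (h : ∀ r, a ≤ r → r < b → Commute V (f r)) :
    Commute V (proj f a b) := by
  refine Commute.list_prod_right _ _ fun x hx => ?_
  obtain ⟨r, hr, rfl⟩ := List.mem_map.mp hx
  rw [List.mem_range'_1] at hr
  exact commute_half_one_add (h r hr.1 (by omega))

theorem mul_half_one_add {V : Op N} (h : V * V = 1) :
    V * ((2⁻¹ : ℂ) • (1 + V)) = (2⁻¹ : ℂ) • (1 + V) := by
  rw [Matrix.mul_smul, mul_add, mul_one, h, add_comm]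

/-- By commutativity `f r` can be moved to its own factor `(1 + f r) / 2`, which absorbs it since `f
r` is an involution. -/
theorem InvolFamily.fixedBy_proj (h : InvolFamily f a b) : FixedBy f a b (proj f a b) := by
  intro r h1 h2
  have hc : Commute (f r) (proj f a b) := commute_proj fun s h3 h4 => h.comm r s h1 h2 h3 h4
  have : f r * proj f a b = proj f a b := by
    have h3 : Commute (f r) (proj f a r) :=
      commute_proj fun s h3 h4 => h.comm r s h1 h2 h3 (by omega)
    rw [← proj_mul_proj h1 h2.le, proj_succ_left h2, ← mul_assoc, h3.eq, mul_assoc,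
      ← mul_assoc (f r), mul_half_one_add (h.invol r h1 h2)]
  exact ⟨this, by rw [← hc.eq, this]⟩

theorem proj_mul_of_fixed {W : Op N} (h : ∀ r, a ≤ r → r < b → f r * W = W) :
    proj f a b * W = W := by
  rw [proj]
  have : ∀ r ∈ List.range' a (b - a), f r * W = W := fun r hr => by
    rw [List.mem_range'_1] at hr
    exact h r hr.1 (by omega)
  generalize List.range' a (b - a) = l at this
  induction l with
  | nil => simp
  | cons r l ih =>
    rw [List.map_cons, List.prod_cons, mul_assoc,
      ih fun s hs => this s (List.mem_cons_of_mem _ hs), Matrix.smul_mul, add_mul, one_mul,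
      this r List.mem_cons_self, ← two_smul ℂ W, smul_smul]
    norm_num

theorem InvolFamily.proj_mul_self (h : InvolFamily f a b) :
    proj f a b * proj f a b = proj f a b :=
  proj_mul_of_fixed fun r h1 h2 => (h.fixedBy_proj r h1 h2).1

theorem mul_proj_of_fixed {W : Op N} (h : ∀ r, a ≤ r → r < b → W * f r = W) :
    W * proj f a b = W := by
  rw [proj]
  have : ∀ r ∈ List.range' a (b - a), W * f r = W := fun r hr => by
    rw [List.mem_range'_1] at hr
    exact h r hr.1 (by omega)
  generalize List.range' a (b - a) = l at this
  induction l with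
  | nil => simp
  | cons r l ih =>
    rw [List.map_cons, List.prod_cons, ← mul_assoc, Matrix.mul_smul, mul_add, mul_one,
      this r List.mem_cons_self, ← two_smul ℂ W, smul_smul, inv_mul_cancel₀ two_ne_zero, one_smul,
      ih fun s hs => this s (List.mem_cons_of_mem _ hs)]

/-- Two families of commuting involutions with the same invariant operators have the same
projector. -/
theorem proj_eq_of_fixedBy (hf : InvolFamily f a b) (hg : InvolFamily g a b)
    (h : ∀ W, FixedBy f a b W ↔ FixedBy g a b W) : proj f a b = proj g a b := by
  -- Each projector is fixed by both families, so the product of the two equals either of them.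
  have h1 : proj f a b * proj g a b = proj g a b :=
    proj_mul_of_fixed fun r h1 h2 => ((h _).mpr hg.fixedBy_proj r h1 h2).1
  have h2 : proj f a b * proj g a b = proj f a b :=
    mul_proj_of_fixed fun r h1 h2 => ((h _).mp hf.fixedBy_proj r h1 h2).2
  exact h2.symm.trans h1

/-- The family `g` arises from the family `f` by invertible multiplications and permutations within
the range `[a, b)`. -/
structure RowEquiv (a b : ℕ) (f g : ℕ → Op N) : Prop where
  comm : ∀ V, (∀ r, a ≤ r → r < b → Commute V (f r)) → ∀ r, a ≤ r → r < b → Commute V (g r)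
  invol : InvolFamily f a b → ∀ r, a ≤ r → r < b → g r * g r = 1
  fixedBy : InvolFamily f a b → ∀ W, FixedBy f a b W ↔ FixedBy g a b W

theorem RowEquiv.refl (f : ℕ → Op N) : RowEquiv a b f f :=
  ⟨fun _ h => h, fun h => h.invol, fun _ _ => Iff.rfl⟩

theorem RowEquiv.involFamily (h : RowEquiv a b f g) (hf : InvolFamily f a b) :
    InvolFamily g a b :=
  ⟨fun r s h1 h2 h3 h4 => h.comm _ (fun s' h5 h6 =>
    (h.comm _ (fun r' h7 h8 => hf.comm s' r' h5 h6 h7 h8) r h1 h2).symm) s h3 h4, h.invol hf⟩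

theorem RowEquiv.trans {k : ℕ → Op N} (h : RowEquiv a b f g) (h' : RowEquiv a b g k) :
    RowEquiv a b f k :=
  ⟨fun V hV => h'.comm V (h.comm V hV), fun hf => h'.invol (h.involFamily hf),
    fun hf W => (h.fixedBy hf W).trans (h'.fixedBy (h.involFamily hf) W)⟩

theorem RowEquiv.proj_eq (h : RowEquiv a b f g) (hf : InvolFamily f a b) :
    proj g a b = proj f a b :=
  (proj_eq_of_fixedBy hf (h.involFamily hf) (h.fixedBy hf)).symm

theorem rowEquiv_comp_swap {i j : ℕ} (hi : a ≤ i ∧ i < b) (hj : a ≤ j ∧ j < b) (f : ℕ → Op N) :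
    RowEquiv a b f (f ∘ Equiv.swap i j) := by
  have key : ∀ r, a ≤ r → r < b → a ≤ Equiv.swap i j r ∧ Equiv.swap i j r < b := fun r h1 h2 => by
    rw [Equiv.swap_apply_def]; split_ifs <;> omega
  refine ⟨fun V hV r h1 h2 => hV _ (key r h1 h2).1 (key r h1 h2).2,
    fun h r h1 h2 => h.invol _ (key r h1 h2).1 (key r h1 h2).2, fun _ W => ⟨fun h r h1 h2 =>
      h _ (key r h1 h2).1 (key r h1 h2).2, fun h r h1 h2 => ?_⟩⟩
  have := h _ (key r h1 h2).1 (key r h1 h2).2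
  simpa using this

/-- A multiplication is undone by repeating it, because `f k` is an involution; this gives the
backward direction for the fixed operators. The condition `k ≠ l` is essential, since otherwise row
`l` would be replaced by its square. -/
theorem rowEquiv_update_mul {k l : ℕ} (hk : a ≤ k ∧ k < b) (hl : a ≤ l ∧ l < b) (hkl : k ≠ l)
    (f : ℕ → Op N) : RowEquiv a b f (Function.update f l (f k * f l)) := by
  refine ⟨fun V hV r h1 h2 => ?_, fun h r h1 h2 => ?_, fun hf W => ⟨fun h r h1 h2 => ?_,
    fun h r h1 h2 => ?_⟩⟩
  · by_cases hr : r = l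
    · subst hr; simpa using (hV k hk.1 hk.2).mul_right (hV r h1 h2)
    · simpa [hr] using hV r h1 h2
  · by_cases hr : r = l
    · subst hr
      rw [Function.update_self, (h.comm r k h1 h2 hk.1 hk.2).mul_mul_mul_comm,
        h.invol k hk.1 hk.2, h.invol r h1 h2, one_mul]
    · simpa [hr] using h.invol r h1 h2
  · by_cases hr : r = l
    · subst hr
      rw [Function.update_self]
      exact ⟨by rw [mul_assoc, (h r h1 h2).1, (h k hk.1 hk.2).1],
        by rw [← mul_assoc, (h k hk.1 hk.2).2, (h r h1 h2).2]⟩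
    · simpa [hr] using h r h1 h2
  · by_cases hr : r = l
    · subst hr
      have hk' := h k hk.1 hk.2
      rw [Function.update_of_ne hkl] at hk'
      have hr' := h r h1 h2
      rw [Function.update_self] at hr'
      have e1 : f r * W = f k * (f k * f r * W) := by
        rw [← mul_assoc, ← mul_assoc, hf.invol k hk.1 hk.2, one_mul]
      have e2 : W * f r = W * (f k * f r) * f k := by
        rw [(hf.comm k r hk.1 hk.2 h1 h2).eq, mul_assoc, mul_assoc, hf.invol k hk.1 hk.2, mul_one]
      exact ⟨by rw [e1, hr'.1, hk'.1], by rw [e2, hr'.2, hk'.2]⟩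
    · have := h r h1 h2
      rwa [Function.update_of_ne hr] at this

end proj

/-! ### Traces -/

/-- The traces of `W` with the Pauli operators supported on the columns `≥ l` are those of
`2 ^ (-k)`. -/
def TraceScalar {N : ℕ} (k l : ℕ) (W : Op N) : Prop :=
  ∀ h : Row, (∀ j < l, h.op j = .I) →
    (2 : ℂ) ^ k * (W * h.toMatrix N).trace = (h.toMatrix N).trace

theorem traceScalar_one {N : ℕ} : TraceScalar 0 0 (1 : Op N) := fun h _ => by simp

theorem TraceScalar.mono {N k l l' : ℕ} {W : Op N} (h : TraceScalar k l W) (hl : l ≤ l') :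
    TraceScalar k l' W := fun a ha => h a fun j hj => ha j (hj.trans_le hl)

theorem TraceScalar.two_pow_mul_trace {N k l : ℕ} {W : Op N} (h : TraceScalar k l W) :
    (2 : ℂ) ^ k * W.trace = 2 ^ N := by
  have := h Row.one fun _ _ => rfl
  rw [Row.toMatrix_one, mul_one, Matrix.trace_one] at this
  simpa using this

/-- Tested against Pauli operators that are trivial up to and including column `l`, the summand with
`a` keeps a Pauli operator in column `l` and has trace zero. Only half of the old trace survives,
which raises the exponent by one. -/
theorem TraceScalar.mul_half_one_add {N k l : ℕ} {W : Op N} (h : TraceScalar k l W) (hl : l < N)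
    {a : Row} (ha : ∀ j < l, a.op j = .I) (ha' : a.op l ≠ .I) :
    TraceScalar (k + 1) (l + 1) (W * ((2⁻¹ : ℂ) • (1 + a.toMatrix N))) := by
  intro b hb
  have h1 := h b fun j hj => hb j (by omega)
  have h2 := h (Row.mul N a b) fun j hj => by simp [Row.mul, ha j hj, hb j (by omega), Pauli.mul_I]
  rw [Row.trace_eq_zero hl (by simp [Row.mul, hb l (by omega), Pauli.mul_I, ha']),
    Row.toMatrix_mul] at h2
  rw [Matrix.mul_smul, Matrix.smul_mul, Matrix.trace_smul, mul_add, add_mul, Matrix.trace_add,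
    mul_one, smul_eq_mul, mul_assoc W]
  linear_combination h1 + h2

/-- Two pivot rows share the column `l`. Expanding the two factors gives four summands; those with
`a`, `b` and `a b` have trace zero, the last one because two different Pauli operators do not
multiply to the identity. Commutation of `a` and `b` plays no role. -/
theorem TraceScalar.mul_half_one_add_two {N k l : ℕ} {W : Op N} (h : TraceScalar k l W)
    (hl : l < N) {a b : Row} (ha : ∀ j < l, a.op j = .I) (ha' : a.op l ≠ .I)
    (hb : ∀ j < l, b.op j = .I) (hb' : b.op l ≠ .I) (hab : a.op l ≠ b.op l) :
    TraceScalar (k + 2) (l + 1) (W * ((2⁻¹ : ℂ) • (1 + a.toMatrix N)) *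
      ((2⁻¹ : ℂ) • (1 + b.toMatrix N))) := by
  intro c hc
  have h1 := h.mul_half_one_add hl ha ha' c hc
  have h2 := h (Row.mul N b c) fun j hj => by simp [Row.mul, hb j hj, hc j (by omega), Pauli.mul_I]
  have h3 := h (Row.mul N a (Row.mul N b c)) fun j hj => by
    simp [Row.mul, ha j hj, hb j hj, hc j (by omega), Pauli.mul_I]
  rw [Row.trace_eq_zero hl (by simp [Row.mul, hc l (by omega), Pauli.mul_I, hb']),
    Row.toMatrix_mul] at h2
  have hne : (Pauli.mul (a.op l) (b.op l)).2 ≠ .I := by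
    revert hab; cases a.op l <;> cases b.op l <;> simp [Pauli.mul]
  rw [Row.trace_eq_zero hl (by simp [Row.mul, hc l (by omega), Pauli.mul_I, hne]),
    Row.toMatrix_mul, Row.toMatrix_mul] at h3
  have e : W * ((2⁻¹ : ℂ) • (1 + a.toMatrix N)) * ((2⁻¹ : ℂ) • (1 + b.toMatrix N)) * c.toMatrix N =
      (2⁻¹ : ℂ) • (W * ((2⁻¹ : ℂ) • (1 + a.toMatrix N)) * c.toMatrix N +
        (2⁻¹ : ℂ) • (W * (b.toMatrix N * c.toMatrix N) +
          W * (a.toMatrix N * (b.toMatrix N * c.toMatrix N)))) := by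
    simp only [Matrix.mul_smul, Matrix.smul_mul, smul_add, mul_add, add_mul, mul_one, mul_assoc]
  rw [e, Matrix.trace_smul, Matrix.trace_add, Matrix.trace_smul, Matrix.trace_add, smul_eq_mul,
    smul_eq_mul, pow_add]
  rw [pow_succ] at h1
  linear_combination h1 + h2 + h3

/-! ### Generator sets -/

theorem stabProj_eq_proj {K N : ℕ} (g : Fin K → StabOp N) {f : ℕ → Op N} {a : ℕ}
    (h : ∀ k : Fin K, f (a + k) = (g k).toMatrix) : stabProj g = proj f a (a + K) := by
  rw [stabProj, proj]
  congr 1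
  refine List.ext_getElem (by simp) fun i h1 h2 => ?_
  have := h ⟨i, by simpa using h1⟩
  simp at this
  simp [this]

theorem StabOp.toMatrix_mul_self {N : ℕ} (g : StabOp N) : g.toMatrix * g.toMatrix = 1 := by
  rw [← StabOp.toMatrix_toRow, Row.toMatrix_mul_self_eq]
  simp only [StabOp.toRow]
  split_ifs <;> simp [iPow_two]

/-- Products of generators are again Pauli strings with a phase, so the vanishing of traces can be
decided column by column. -/
theorem exists_row_genProd {K N : ℕ} (g : Fin K → StabOp N) (s : Fin K → ℕ) :
    ∃ a : Row, a.toMatrix N = genProd g s := by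
  rw [genProd]
  have : ∀ M ∈ List.ofFn fun k => (g k).toMatrix ^ s k, ∃ a : Row, a.toMatrix N = M := by
    intro M hM
    obtain ⟨k, rfl⟩ := List.mem_ofFn.mp hM
    induction s k with
    | zero => exact ⟨Row.one, by simp [Row.toMatrix_one]⟩
    | succ n ih =>
      obtain ⟨a, ha⟩ := ih
      exact ⟨Row.mul N a (g k).toRow, by
        rw [Row.toMatrix_mul, ha, StabOp.toMatrix_toRow, pow_succ]⟩
  generalize (List.ofFn fun k => (g k).toMatrix ^ s k) = l at this
  induction l with
  | nil => exact ⟨Row.one, by simp [Row.toMatrix_one]⟩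
  | cons M l ih =>
    obtain ⟨a, ha⟩ := ih fun M' h => this M' (List.mem_cons_of_mem _ h)
    obtain ⟨b, hb⟩ := this M List.mem_cons_self
    exact ⟨Row.mul N b a, by rw [Row.toMatrix_mul, ha, hb, List.prod_cons]⟩

theorem prod_mul_self_of_commute {R : Type*} [Monoid R] (l : List R)
    (hc : ∀ x ∈ l, ∀ y ∈ l, Commute x y) (hs : ∀ x ∈ l, x * x = 1) : l.prod * l.prod = 1 := by
  induction l with
  | nil => simp
  | cons x l ih =>
    have h : Commute l.prod x := Commute.list_prod_left _ _ fun y hy =>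
      hc y (List.mem_cons_of_mem _ hy) x List.mem_cons_self
    rw [List.prod_cons, h.mul_mul_mul_comm, hs x List.mem_cons_self, one_mul,
      ih (fun a ha b hb => hc a (List.mem_cons_of_mem _ ha) b (List.mem_cons_of_mem _ hb))
        fun a ha => hs a (List.mem_cons_of_mem _ ha)]

theorem IsGeneratorSet.genProd_mul_self {K N : ℕ} {g : Fin K → StabOp N} (hg : IsGeneratorSet g)
    (s : Fin K → ℕ) : genProd g s * genProd g s = 1 := by
  refine prod_mul_self_of_commute _ (fun x hx y hy => ?_) fun x hx => ?_
  · obtain ⟨i, rfl⟩ := List.mem_ofFn.mp hx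
    obtain ⟨j, rfl⟩ := List.mem_ofFn.mp hy
    exact (hg.comm i j).pow_pow _ _
  · obtain ⟨i, rfl⟩ := List.mem_ofFn.mp hx
    rw [← (Commute.refl (g i).toMatrix).mul_pow, StabOp.toMatrix_mul_self, one_pow]

/-- The product is a Pauli string. If it has a nontrivial symbol, its trace is zero; if not, being
an involution it is `1` or `-1`, and these are excluded by independence and by the condition on
`-1`. -/
theorem IsGeneratorSet.trace_genProd {K N : ℕ} {g : Fin K → StabOp N} (hg : IsGeneratorSet g)
    {s : Fin K → ℕ} (hs : ¬ ∀ k, Even (s k)) : (genProd g s).trace = 0 := by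
  obtain ⟨a, ha⟩ := exists_row_genProd g s
  by_cases h : ∀ j < N, a.op j = .I
  · exfalso
    have h1 := Row.phase_of_mul_self (a := a) (N := N) (by rw [ha, hg.genProd_mul_self])
    rw [Row.toMatrix_of_forall_eq_I h] at ha
    rcases h1 with h1 | h1
    · rw [h1, iPow_zero, one_smul] at ha
      exact hs ((hg.indep s).mp ha.symm)
    · rw [h1, iPow_two, neg_smul, one_smul] at ha
      exact hg.neg_one s ha.symm
  · push Not at h
    obtain ⟨j, hj, hne⟩ := h
    rw [← ha, Row.trace_eq_zero hj hne]

theorem genProd_cons {K N : ℕ} (g : Fin (K + 1) → StabOp N) (n : ℕ) (s : Fin K → ℕ) :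
    genProd g (Fin.cons n s) = (g 0).toMatrix ^ n * genProd (fun k => g k.succ) s := by
  simp [genProd, List.ofFn_succ]

theorem genProd_zero {K N : ℕ} (g : Fin K → StabOp N) : genProd g (fun _ => 0) = 1 := by
  simp [genProd]

/-- Expanding `∏ (1 + g k)` gives all products with exponents `0` and `1`, and by hypothesis only
the empty one contributes. In the induction the first factor is absorbed into `W`. -/
theorem trace_mul_prod_one_add {N : ℕ} : ∀ {K : ℕ} (g : Fin K → StabOp N) (W : Op N),
    (∀ s : Fin K → ℕ, (∀ k, s k ≤ 1) → (∃ k, s k ≠ 0) → (W * genProd g s).trace = 0) →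
    2 ^ K * (W * stabProj g).trace = W.trace
  | 0, g, W, _ => by simp [stabProj]
  | K + 1, g, W, h => by
    have ih := trace_mul_prod_one_add (fun k => g k.succ) (W * ((2⁻¹ : ℂ) • (1 + (g 0).toMatrix)))
      fun s hs ⟨k, hk⟩ => by
        have h0 := h (Fin.cons 0 s) (Fin.cases (by simp) (by simpa using hs)) ⟨k.succ, by simpa⟩
        have h1 := h (Fin.cons 1 s) (Fin.cases (by simp) (by simpa using hs)) ⟨k.succ, by simpa⟩
        rw [genProd_cons] at h0 h1
        rw [Matrix.mul_smul, Matrix.smul_mul, Matrix.trace_smul, mul_add, add_mul, mul_one,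
          Matrix.trace_add, mul_assoc]
        rw [pow_zero, one_mul] at h0
        rw [pow_one] at h1
        rw [h0, h1]; simp
    have h1 := h (Fin.cons 1 fun _ => 0) (Fin.cases (by simp) (by simp)) ⟨0, by simp⟩
    rw [genProd_cons, genProd_zero, pow_one, mul_one] at h1
    have e : stabProj g = ((2⁻¹ : ℂ) • (1 + (g 0).toMatrix)) * stabProj fun k => g k.succ := by
      simp [stabProj, List.ofFn_succ]
    rw [e, ← mul_assoc, pow_succ, mul_right_comm, ih, Matrix.mul_smul, Matrix.trace_smul, mul_add,
      Matrix.trace_add, h1, mul_one, smul_eq_mul]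
    ring

theorem IsGeneratorSet.two_pow_mul_trace {K N : ℕ} {g : Fin K → StabOp N}
    (hg : IsGeneratorSet g) : 2 ^ K * (stabProj g).trace = 2 ^ N := by
  have := trace_mul_prod_one_add g 1 fun s hs ⟨k, hk⟩ => by
    rw [one_mul]
    refine hg.trace_genProd fun h => ?_
    have h1 := hs k
    obtain ⟨m, hm⟩ := h k
    omega
  rw [one_mul, Matrix.trace_one] at this
  simpa using this

/-- A loop with a decreasing measure terminates; the cost is bounded by the measure times the cost
of one iteration. -/
theorem exists_iterate {α : Type*} (f : α → α) (Inv Act : α → Prop) (μ cost : α → ℕ) (B : ℕ)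
    (h : ∀ x, Inv x → Act x → Inv (f x) ∧ μ (f x) < μ x ∧ cost (f x) ≤ cost x + B) (x : α)
    (hx : Inv x) :
    ∃ n, Inv (f^[n] x) ∧ ¬ Act (f^[n] x) ∧ cost (f^[n] x) ≤ cost x + μ x * B := by
  induction hm : μ x using Nat.strong_induction_on generalizing x with
  | _ m ih =>
    by_cases ha : Act x
    · obtain ⟨h1, h2, h3⟩ := h x hx ha
      obtain ⟨n, hn1, hn2, hn3⟩ := ih (μ (f x)) (by omega) (f x) h1 rfl
      refine ⟨n + 1, hn1, hn2, hn3.trans ?_⟩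
      have : (μ (f x) + 1) * B ≤ m * B := Nat.mul_le_mul_right B (by omega)
      rw [add_mul, one_mul] at this
      omega
    · exact ⟨0, hx, ha, Nat.le_add_right _ _⟩

/-! ### Row operations on configurations and their cost -/

namespace Config

/-- The matrix of a row. -/
noncomputable def mat (N : ℕ) (c : Config) (r : ℕ) : Op N := (c.arr r).toMatrix N

/-- The configurations differ in the array only, and `d` has cost at most `B` more than `c`. -/
structure Frame (B : ℕ) (c d : Config) : Prop where
  stage : d.stage = c.stage
  KU : d.KU = c.KU
  KL : d.KL = c.KL
  NL : d.NL = c.NL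
  NR : d.NR = c.NR
  R₁ : d.R₁ = c.R₁
  R₂ : d.R₂ = c.R₂
  T : d.T = c.T
  C : d.C = c.C
  cost : d.cost ≤ c.cost + B

theorem Frame.refl (B : ℕ) (c : Config) : Frame B c c :=
  ⟨rfl, rfl, rfl, rfl, rfl, rfl, rfl, rfl, rfl, Nat.le_add_right _ _⟩

theorem Frame.trans {B B' : ℕ} {c d e : Config} (h : Frame B c d) (h' : Frame B' d e) :
    Frame (B + B') c e :=
  ⟨h'.stage.trans h.stage, h'.KU.trans h.KU, h'.KL.trans h.KL, h'.NL.trans h.NL, h'.NR.trans h.NR,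
    h'.R₁.trans h.R₁, h'.R₂.trans h.R₂, h'.T.trans h.T, h'.C.trans h.C, by
    have := h.cost; have := h'.cost; omega⟩

theorem Frame.mono {B B' : ℕ} {c d : Config} (h : Frame B c d) (hB : B ≤ B') : Frame B' c d :=
  { h with cost := by have := h.cost; omega }

theorem frame_charge (n : ℕ) (c : Config) : Frame n c (c.charge n) :=
  ⟨rfl, rfl, rfl, rfl, rfl, rfl, rfl, rfl, rfl, le_rfl⟩

theorem frame_swapRows (N i j : ℕ) (c : Config) : Frame (4 * (N + 1)) c (c.swapRows N i j) :=
  ⟨rfl, rfl, rfl, rfl, rfl, rfl, rfl, rfl, rfl, le_rfl⟩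

theorem frame_mulRow (N k l : ℕ) (c : Config) : Frame (3 * (N + 1)) c (c.mulRow N k l) :=
  ⟨rfl, rfl, rfl, rfl, rfl, rfl, rfl, rfl, rfl, le_rfl⟩

theorem frame_swapCols (K i j : ℕ) (c : Config) : Frame (4 * K) c (c.swapCols K i j) :=
  ⟨rfl, rfl, rfl, rfl, rfl, rfl, rfl, rfl, rfl, le_rfl⟩

theorem frame_rotCol (K j : ℕ) (u : Rot) (c : Config) : Frame (4 * K) c (c.rotCol K j u) :=
  ⟨rfl, rfl, rfl, rfl, rfl, rfl, rfl, rfl, rfl, le_rfl⟩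

theorem frame_cnotCols (K i j : ℕ) (c : Config) : Frame (6 * K) c (c.cnotCols K i j) :=
  ⟨rfl, rfl, rfl, rfl, rfl, rfl, rfl, rfl, rfl, le_rfl⟩

theorem forRange_of_le {a b : ℕ} (h : b ≤ a) (f : ℕ → Config → Config) (c : Config) :
    forRange a b f c = c := by simp [forRange, Nat.sub_eq_zero_of_le h]

/-- The rule for loop invariants: `P r` describes the configuration just before index `r` is
treated, and the counter update charged by the loop is part of each step. -/
theorem forRange_induct {a b : ℕ} {f : ℕ → Config → Config} {c : Config} (P : ℕ → Config → Prop)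
    (hab : a ≤ b) (h0 : P a c)
    (hs : ∀ r d, a ≤ r → r < b → P r d → P (r + 1) ((f r d).charge 1)) :
    P b (forRange a b f c) := by
  obtain ⟨n, rfl⟩ := Nat.exists_eq_add_of_le hab
  rw [forRange, Nat.add_sub_cancel_left]
  clear hab
  induction n generalizing a c with
  | zero => simpa using h0
  | succ n ih =>
    rw [List.range'_succ, List.foldl_cons, show a + (n + 1) = a + 1 + n by omega]
    exact ih (hs a c le_rfl (by omega) h0) fun r d h1 h2 => hs r d (by omega) (by omega)

theorem frame_forRange {B : ℕ} {f : ℕ → Config → Config} (h : ∀ r d, Frame B d (f r d)) (a b : ℕ)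
    (c : Config) : Frame ((b - a) * (B + 1)) c (forRange a b f c) := by
  rcases le_total b a with hab | hab
  · rw [forRange_of_le hab]; exact Frame.refl _ _
  · refine forRange_induct (fun r d => Frame ((r - a) * (B + 1)) c d) hab (Frame.refl _ _)
      fun r d h1 h2 hd => ?_
    refine ((hd.trans (h r d)).trans (frame_charge 1 _)).mono ?_
    rw [show r + 1 - a = r - a + 1 by omega, add_mul]
    omega

theorem frame_clearOne (N k a : ℕ) (σ : Pauli) (c : Config) :
    Frame ((c.KL - a) * (3 * (N + 1) + 1)) c (c.clearOne N k a σ) := by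
  refine frame_forRange (fun r d => ?_) _ _ _
  split_ifs
  · exact frame_mulRow _ _ _ _
  · exact Frame.refl _ _

theorem frame_clearTwo (N k₁ k₂ a : ℕ) (σ₁ σ₂ : Pauli) (c : Config) :
    Frame ((c.KL - a) * (6 * (N + 1) + 1)) c (c.clearTwo N k₁ k₂ a σ₁ σ₂) := by
  refine frame_forRange (fun r d => ?_) _ _ _
  split_ifs
  · exact Frame.refl _ _
  · exact (frame_mulRow _ _ _ _).mono (by omega)
  · exact (frame_mulRow _ _ _ _).mono (by omega)
  · exact ((frame_mulRow N _ _ _).trans (frame_mulRow N _ _ _)).mono (by omega)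

/-- `d` arises from `c` by operations within the rows `a ≤ r < b`. -/
structure RowOp (N a b : ℕ) (c d : Config) : Prop where
  equiv : RowEquiv a b (c.mat N) (d.mat N)
  outside : ∀ r, r < a ∨ b ≤ r → d.arr r = c.arr r
  col : ∀ j, (∀ r, a ≤ r → r < b → c.entry r j = .I) → ∀ r, a ≤ r → r < b → d.entry r j = .I

/-- The rows between `a` and `u` are untouched. They commute with the new rows because whatever
commutes with all old rows of the range commutes with all new ones. -/
theorem RowOp.involFamily {N a u b : ℕ} {c d : Config} (h : RowOp N u b c d) (hau : a ≤ u)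
    (hc : InvolFamily (c.mat N) a b) : InvolFamily (d.mat N) a b := by
  have hin := h.equiv.involFamily (hc.mono hau le_rfl)
  have hout : ∀ r, r < u → d.mat N r = c.mat N r := fun r hr => by
    rw [mat, h.outside r (Or.inl hr), mat]
  have hmix : ∀ r s, a ≤ r → r < u → u ≤ s → s < b → Commute (d.mat N r) (d.mat N s) :=
    fun r s har hr h1 h2 => by
      rw [hout r hr]
      exact h.equiv.comm _ (fun s' h3 h4 => hc.comm r s' har (by omega) (by omega) h4) s h1 h2
  refine ⟨fun r s har hr has hs => ?_, fun r har hr => ?_⟩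
  · rcases lt_or_ge r u with h1 | h1 <;> rcases lt_or_ge s u with h2 | h2
    · rw [hout r h1, hout s h2]
      exact hc.comm r s har hr has hs
    · exact hmix r s har h1 h2 hs
    · exact (hmix s r has h2 h1 hr).symm
    · exact hin.comm r s h1 hr h2 hs
  · rcases lt_or_ge r u with h1 | h1
    · rw [hout r h1]; exact hc.invol r har hr
    · exact hin.invol r h1 hr

theorem RowOp.proj_eq {N a u b : ℕ} {c d : Config} (h : RowOp N u b c d) (hau : a ≤ u)
    (hub : u ≤ b) (hc : InvolFamily (c.mat N) a b) :
    proj (d.mat N) a b = proj (c.mat N) a b := by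
  rw [← proj_mul_proj hau hub, ← proj_mul_proj hau hub, h.equiv.proj_eq (hc.mono hau le_rfl)]
  congr 1
  exact proj_congr fun r _ hr => by rw [mat, h.outside r (Or.inl hr), mat]

theorem RowOp.of_arr_eq {N a b : ℕ} {c d : Config} (h : d.arr = c.arr) : RowOp N a b c d := by
  have h1 : d.mat N = c.mat N := by ext1 r; rw [mat, mat, h]
  exact ⟨h1 ▸ RowEquiv.refl _, fun r _ => by rw [h], fun j hj => by
    simpa only [entry, h] using hj⟩

theorem RowOp.trans {N a b : ℕ} {c d e : Config} (h : RowOp N a b c d) (h' : RowOp N a b d e) :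
    RowOp N a b c e :=
  ⟨h.equiv.trans h'.equiv, fun r hr => (h'.outside r hr).trans (h.outside r hr),
    fun j hj => h'.col j (h.col j hj)⟩

theorem mat_swapRows (N i j : ℕ) (c : Config) :
    (c.swapRows N i j).mat N = c.mat N ∘ Equiv.swap i j := rfl

theorem mat_mulRow (N k l : ℕ) (c : Config) :
    (c.mulRow N k l).mat N = Function.update (c.mat N) l (c.mat N k * c.mat N l) := by
  ext1 r
  by_cases h : r = l
  · subst h; simp [mat, mulRow, charge, Row.toMatrix_mul]
  · simp [mat, mulRow, charge, h]

theorem rowOp_swapRows {N a b i j : ℕ} (hi : a ≤ i ∧ i < b) (hj : a ≤ j ∧ j < b) (c : Config) :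
    RowOp N a b c (c.swapRows N i j) := by
  refine ⟨by rw [mat_swapRows]; exact rowEquiv_comp_swap hi hj _, fun r hr => ?_,
    fun l hl r h1 h2 => hl _ ?_ ?_⟩
  · change c.arr (Equiv.swap i j r) = c.arr r
    rw [Equiv.swap_apply_of_ne_of_ne (by omega) (by omega)]
  all_goals rw [Equiv.swap_apply_def]; split_ifs <;> omega

theorem rowOp_mulRow {N a b k l : ℕ} (hk : a ≤ k ∧ k < b) (hl : a ≤ l ∧ l < b) (hkl : k ≠ l)
    (c : Config) : RowOp N a b c (c.mulRow N k l) := by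
  refine ⟨by rw [mat_mulRow]; exact rowEquiv_update_mul hk hl hkl _, fun r hr => ?_,
    fun j hj r h1 h2 => ?_⟩
  · exact Function.update_of_ne (by omega) _ _
  · by_cases h : r = l
    · subst h
      simp only [entry, mulRow, charge, Function.update_self, Row.mul]
      rw [show (c.arr k).op j = .I from hj k hk.1 hk.2, show (c.arr r).op j = .I from hj r h1 h2]
      rfl
    · simpa [entry, mulRow, charge, h] using hj r h1 h2

theorem entry_mulRow_self (N k l j : ℕ) (c : Config) :
    (c.mulRow N k l).entry l j = (Pauli.mul (c.entry k j) (c.entry l j)).2 := by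
  simp [entry, mulRow, charge, Row.mul]

theorem arr_mulRow_of_ne {N k l r : ℕ} (h : r ≠ l) (c : Config) :
    (c.mulRow N k l).arr r = c.arr r := Function.update_of_ne h _ _

theorem clearOne_spec {N k a : ℕ} {σ : Pauli} {c : Config} (hk : c.KU ≤ k) (hka : k < a)
    (ha : a ≤ c.KL) (hσ : c.entry k c.NL = σ)
    (hone : ∀ r, a ≤ r → r < c.KL → c.entry r c.NL = .I ∨ c.entry r c.NL = σ) :
    RowOp N c.KU c.KL c (c.clearOne N k a σ) ∧
      (∀ r < a, (c.clearOne N k a σ).arr r = c.arr r) ∧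
      ∀ r, a ≤ r → r < c.KL → (c.clearOne N k a σ).entry r c.NL = .I := by
  have := forRange_induct (f := fun r c => if c.entry r c.NL = σ then c.mulRow N k r else c)
    (c := c) (fun r d => d.NL = c.NL ∧ RowOp N c.KU c.KL c d ∧
      -- The pivot row and the rows not yet reached are still the original ones, so the test in row
      -- `r` refers to the entries of `c`.
      (∀ s, s < a ∨ r ≤ s → d.arr s = c.arr s) ∧
      ∀ s, a ≤ s → s < r → d.entry s c.NL = .I) ha
    ⟨rfl, RowOp.of_arr_eq rfl, fun _ _ => rfl, fun s h1 h2 => by omega⟩ (by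
      rintro r d h1 h2 ⟨hNL, hop, hsame, hI⟩
      have hr : d.entry r c.NL = c.entry r c.NL := by rw [entry, hsame r (Or.inr le_rfl), entry]
      have hk' : d.entry k c.NL = σ := by rw [entry, hsame k (Or.inl hka), ← entry, hσ]
      rw [hNL]
      split_ifs with hc
      · refine ⟨hNL, (hop.trans (rowOp_mulRow (k := k) (l := r) (by omega) (by omega) (by omega) d)).trans
          (RowOp.of_arr_eq rfl), fun s hs => ?_, fun s hs1 hs2 => ?_⟩
        · change (d.mulRow N k r).arr s = _
          rw [arr_mulRow_of_ne (by omega), hsame s (by omega)]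
        · change (d.mulRow N k r).entry s _ = _
          by_cases hsr : s = r
          · subst hsr; rw [entry_mulRow_self, hk', hc, Pauli.mul_self]
          · rw [entry, arr_mulRow_of_ne hsr]; exact hI s hs1 (by omega)
      · refine ⟨hNL, hop.trans (RowOp.of_arr_eq rfl), fun s hs => hsame s (by omega), fun s hs1 hs2 => ?_⟩
        change d.entry s _ = _
        by_cases hsr : s = r
        · subst hsr; have := hone s h1 h2; rw [hr] at hc ⊢; tauto
        · exact hI s hs1 (by omega))
  exact ⟨this.2.1, fun r hr => this.2.2.1 r (Or.inl hr), this.2.2.2⟩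

theorem clearTwo_spec {N k₁ k₂ a : ℕ} {σ₁ σ₂ : Pauli} {c : Config} (hk₁ : c.KU ≤ k₁)
    (hka₁ : k₁ < a) (hk₂ : c.KU ≤ k₂) (hka₂ : k₂ < a) (ha : a ≤ c.KL)
    (hσ₁ : c.entry k₁ c.NL = σ₁) (hσ₂ : c.entry k₂ c.NL = σ₂) (h1I : σ₁ ≠ .I) (h2I : σ₂ ≠ .I)
    (h12 : σ₁ ≠ σ₂) :
    RowOp N c.KU c.KL c (c.clearTwo N k₁ k₂ a σ₁ σ₂) ∧
      (∀ r < a, (c.clearTwo N k₁ k₂ a σ₁ σ₂).arr r = c.arr r) ∧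
      ∀ r, a ≤ r → r < c.KL → (c.clearTwo N k₁ k₂ a σ₁ σ₂).entry r c.NL = .I := by
  -- The three Pauli operators multiply to the identity up to a phase, so a row with the third
  -- symbol is cleared by both pivot rows.
  have third : ∀ τ : Pauli, τ ≠ .I → τ ≠ σ₁ → τ ≠ σ₂ →
      (Pauli.mul σ₂ (Pauli.mul σ₁ τ).2).2 = .I := by
    intro τ; revert h1I h2I h12; cases σ₁ <;> cases σ₂ <;> cases τ <;> simp [Pauli.mul]
  have := forRange_induct (f := fun r c =>
      if c.entry r c.NL = .I then c
      else if c.entry r c.NL = σ₁ then c.mulRow N k₁ r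
      else if c.entry r c.NL = σ₂ then c.mulRow N k₂ r
      else (c.mulRow N k₁ r).mulRow N k₂ r)
    (c := c) (fun r d => d.NL = c.NL ∧ RowOp N c.KU c.KL c d ∧
      (∀ s, s < a ∨ r ≤ s → d.arr s = c.arr s) ∧
      ∀ s, a ≤ s → s < r → d.entry s c.NL = .I) ha
    ⟨rfl, RowOp.of_arr_eq rfl, fun _ _ => rfl, fun s h1 h2 => by omega⟩ (by
      rintro r d h1 h2 ⟨hNL, hop, hsame, hI⟩
      have hk1 : d.entry k₁ c.NL = σ₁ := by rw [entry, hsame k₁ (Or.inl hka₁), ← entry, hσ₁]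
      have hk2 : d.entry k₂ c.NL = σ₂ := by rw [entry, hsame k₂ (Or.inl hka₂), ← entry, hσ₂]
      have key : ∀ e : Config, e.NL = c.NL → RowOp N c.KU c.KL d e →
          (∀ s, s ≠ r → e.arr s = d.arr s) → e.entry r c.NL = .I →
          (e.charge 1).NL = c.NL ∧ RowOp N c.KU c.KL c (e.charge 1) ∧
          (∀ s, s < a ∨ r + 1 ≤ s → (e.charge 1).arr s = c.arr s) ∧
          ∀ s, a ≤ s → s < r + 1 → (e.charge 1).entry s c.NL = .I := by
        intro e he1 he2 he3 he4
        refine ⟨he1, (hop.trans he2).trans (RowOp.of_arr_eq rfl), fun s hs => ?_, fun s hs1 hs2 => ?_⟩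
        · change e.arr s = _
          rw [he3 s (by omega), hsame s (by omega)]
        · change e.entry s _ = _
          by_cases hsr : s = r
          · subst hsr; exact he4
          · rw [entry, he3 s hsr]; exact hI s hs1 (by omega)
      rw [hNL]
      have hm1 := rowOp_mulRow (N := N) (a := c.KU) (b := c.KL) (k := k₁) (l := r) (by omega)
        (by omega) (by omega)
      have hm2 := rowOp_mulRow (N := N) (a := c.KU) (b := c.KL) (k := k₂) (l := r) (by omega)
        (by omega) (by omega)
      split_ifs with hc hc1 hc2
      · exact key d hNL (RowOp.of_arr_eq rfl) (fun _ _ => rfl) hc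
      · exact key _ hNL (hm1 d) (fun s hs => arr_mulRow_of_ne hs _)
          (by rw [entry_mulRow_self, hk1, hc1, Pauli.mul_self])
      · exact key _ hNL (hm2 d) (fun s hs => arr_mulRow_of_ne hs _)
          (by rw [entry_mulRow_self, hk2, hc2, Pauli.mul_self])
      · refine key _ hNL ((hm1 d).trans (hm2 _))
          (fun s hs => by rw [arr_mulRow_of_ne hs, arr_mulRow_of_ne hs]) ?_
        rw [entry_mulRow_self, entry_mulRow_self, entry, arr_mulRow_of_ne (by omega), ← entry, hk1,
          hk2]
        exact third _ hc hc1 hc2)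
  exact ⟨this.2.1, fun r hr => this.2.2.1 r (Or.inl hr), this.2.2.2⟩

/-! ### Searching a column -/

theorem first_eq_none {c : Config} (h : c.first = none) {r : ℕ} (h1 : c.KU ≤ r) (h2 : r < c.KL) :
    c.entry r c.NL = .I := by
  rw [first, List.find?_range'_eq_none] at h
  simpa using h r h1 (by omega)

theorem first_eq_some {c : Config} {k : ℕ} (h : c.first = some k) :
    (c.KU ≤ k ∧ k < c.KL) ∧ c.entry k c.NL ≠ .I ∧ (c.entry c.KU c.NL ≠ .I → k = c.KU) := by
  rw [first, List.find?_range'_eq_some] at h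
  obtain ⟨h1, h2, h3⟩ := h
  rw [List.mem_range'_1] at h2
  refine ⟨by omega, by simpa using h1, fun h4 => ?_⟩
  by_contra hne
  have := h3 c.KU le_rfl (by omega)
  simp [h4] at this

theorem firstOther_eq_none {c : Config} {σ : Pauli} (h : c.firstOther σ = none) {r : ℕ}
    (h1 : c.KU ≤ r) (h2 : r < c.KL) : c.entry r c.NL = .I ∨ c.entry r c.NL = σ := by
  rw [firstOther, List.find?_range'_eq_none] at h
  have := h r h1 (by omega)
  simp at this
  tauto

theorem firstOther_eq_some {c : Config} {σ : Pauli} {k : ℕ} (h : c.firstOther σ = some k) :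
    (c.KU ≤ k ∧ k < c.KL) ∧ c.entry k c.NL ≠ .I ∧ c.entry k c.NL ≠ σ := by
  rw [firstOther, List.find?_range'_eq_some] at h
  obtain ⟨h1, h2, h3⟩ := h
  rw [List.mem_range'_1] at h2
  exact ⟨by omega, by simpa using h1⟩

/-- Rows with two different Pauli operators are brought to the two top positions. -/
theorem swapRows_two {N k₁ k₂ : ℕ} {c : Config} (h₁ : c.first = some k₁)
    (h₂ : c.firstOther (c.entry k₁ c.NL) = some k₂) :
    c.KU + 1 < c.KL ∧
      RowOp N c.KU c.KL c ((c.swapRows N k₁ c.KU).swapRows N k₂ (c.KU + 1)) ∧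
      ((c.swapRows N k₁ c.KU).swapRows N k₂ (c.KU + 1)).arr c.KU = c.arr k₁ ∧
      ((c.swapRows N k₁ c.KU).swapRows N k₂ (c.KU + 1)).arr (c.KU + 1) = c.arr k₂ := by
  obtain ⟨hk1, hI1, hmin⟩ := first_eq_some h₁
  obtain ⟨hk2, hI2, hne⟩ := firstOther_eq_some h₂
  have h12 : k₂ ≠ k₁ := fun e => hne (by rw [e])
  -- If `k₂` were the top row, this row would have a Pauli operator, so the first such row `k₁`
  -- would be the top row too. Hence the first transposition does not move row `k₂`.
  have h2U : k₂ ≠ c.KU := fun e => by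
    subst e
    exact h12 (hmin hI2).symm
  have hlt : c.KU + 1 < c.KL := by omega
  refine ⟨hlt, (rowOp_swapRows (by omega) (by omega) c).trans
    (rowOp_swapRows (by omega) (by omega) _), ?_, ?_⟩
  · change c.arr (Equiv.swap k₁ c.KU (Equiv.swap k₂ (c.KU + 1) c.KU)) = _
    rw [Equiv.swap_apply_of_ne_of_ne h2U.symm (by omega), Equiv.swap_apply_right]
  · change c.arr (Equiv.swap k₁ c.KU (Equiv.swap k₂ (c.KU + 1) (c.KU + 1))) = _
    rw [Equiv.swap_apply_right, Equiv.swap_apply_of_ne_of_ne h12 h2U]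

theorem swapRows_top {N k : ℕ} {c : Config} (h : c.first = some k) :
    RowOp N c.KU c.KL c (c.swapRows N k c.KU) ∧ (c.swapRows N k c.KU).arr c.KU = c.arr k := by
  obtain ⟨hk, -, -⟩ := first_eq_some h
  refine ⟨rowOp_swapRows (by omega) (by omega) c, ?_⟩
  change c.arr (Equiv.swap k c.KU c.KU) = _
  rw [Equiv.swap_apply_right]

end Config

/-! ### Column operations on symbols -/

theorem Rot.act_eq_I {u : Rot} {σ : Pauli} : (u.act σ).2 = .I ↔ σ = .I := by
  cases u <;> cases σ <;> simp [Rot.act]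

theorem Rot.act_toX {σ : Pauli} (h : σ ≠ .I) : ((Rot.toX σ).act σ).2 = .X := by
  cases σ
  · exact absurd rfl h
  all_goals decide

theorem Rot.act_toPair {σ₁ σ₂ τ₁ τ₂ : Pauli} (h₁ : σ₁ ≠ .I) (h₂ : σ₂ ≠ .I) (h : σ₁ ≠ σ₂)
    (h₁' : τ₁ ≠ .I) (h₂' : τ₂ ≠ .I) (h' : τ₁ ≠ τ₂) :
    ((Rot.toPair σ₁ σ₂ τ₁ τ₂).act σ₁).2 = τ₁ ∧ ((Rot.toPair σ₁ σ₂ τ₁ τ₂).act σ₂).2 = τ₂ := by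
  revert h₁ h₂ h h₁' h₂' h'
  cases σ₁ <;> cases σ₂ <;> cases τ₁ <;> cases τ₂ <;> decide

/-! ### Column operations and the invariant of the normal form -/

namespace Config

/-- `d` arises from `c` by operations on the columns `a ≤ j < b`, which act as a Clifford circuit on
all rows. -/
structure ColOp (N a b : ℕ) (c d : Config) : Prop where
  conj : ∃ U ∈ cliffordCircuits N, ∀ r, d.mat N r = U * c.mat N r * star U
  outside : ∀ r j, j < a ∨ b ≤ j → d.entry r j = c.entry r j
  row : ∀ r, (∀ j, a ≤ j → j < b → c.entry r j = .I) → ∀ j, a ≤ j → j < b → d.entry r j = .I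

theorem entry_rotCol_self (K j : ℕ) (u : Rot) (c : Config) (r : ℕ) :
    (c.rotCol K j u).entry r j = (u.act (c.entry r j)).2 := by
  simp [entry, rotCol, charge, Row.rot]

theorem entry_rotCol_of_ne {K i j : ℕ} (h : i ≠ j) (u : Rot) (c : Config) (r : ℕ) :
    (c.rotCol K j u).entry r i = c.entry r i := by
  simp [entry, rotCol, charge, Row.rot, h]

theorem entry_cnotCols_target (K i j : ℕ) (c : Config) (r : ℕ) :
    (c.cnotCols K i j).entry r j = (cnotAct (c.entry r i) (c.entry r j)).2.2 := by
  simp [entry, cnotCols, charge, Row.cnot]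

theorem entry_cnotCols_control {K i j : ℕ} (h : i ≠ j) (c : Config) (r : ℕ) :
    (c.cnotCols K i j).entry r i = (cnotAct (c.entry r i) (c.entry r j)).2.1 := by
  simp [entry, cnotCols, charge, Row.cnot, h]

theorem entry_cnotCols_of_ne {K i j l : ℕ} (hi : l ≠ i) (hj : l ≠ j) (c : Config) (r : ℕ) :
    (c.cnotCols K i j).entry r l = c.entry r l := by
  simp [entry, cnotCols, charge, Row.cnot, hi, hj]

theorem entry_swapCols (K i j l : ℕ) (c : Config) (r : ℕ) :
    (c.swapCols K i j).entry r l = c.entry r (Equiv.swap i j l) := rfl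

theorem colOp_rotCol {N a b j : ℕ} (hj : a ≤ j ∧ j < b) (hb : b ≤ N) (K : ℕ) (u : Rot)
    (c : Config) : ColOp N a b c (c.rotCol K j u) := by
  obtain ⟨U, hU, h⟩ := Row.toMatrix_rot (N := N) (j := j) (by omega) u
  refine ⟨⟨U, hU, fun r => h _⟩, fun r i hi => entry_rotCol_of_ne (by omega) _ _ _,
    fun r hr i h1 h2 => ?_⟩
  by_cases hij : i = j
  · subst hij; rw [entry_rotCol_self, Rot.act_eq_I]; exact hr i h1 h2
  · rw [entry_rotCol_of_ne hij]; exact hr i h1 h2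

theorem colOp_cnotCols {N a b i j : ℕ} (hi : a ≤ i ∧ i < b) (hj : a ≤ j ∧ j < b) (hij : i ≠ j)
    (hb : b ≤ N) (K : ℕ) (c : Config) : ColOp N a b c (c.cnotCols K i j) := by
  obtain ⟨U, hU, h⟩ := Row.toMatrix_cnot (N := N) (i := i) (j := j) (by omega) (by omega) hij
  refine ⟨⟨U, hU, fun r => h _⟩, fun r l hl => entry_cnotCols_of_ne (by omega) (by omega) _ _,
    fun r hr l h1 h2 => ?_⟩
  have e1 := hr i hi.1 hi.2
  have e2 := hr j hj.1 hj.2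
  by_cases hlj : l = j
  · subst hlj; rw [entry_cnotCols_target, e1, e2]; rfl
  · by_cases hli : l = i
    · subst hli; rw [entry_cnotCols_control hij, e1, e2]; rfl
    · rw [entry_cnotCols_of_ne hli hlj]; exact hr l h1 h2

theorem colOp_swapCols {N a b i j : ℕ} (hi : a ≤ i ∧ i < b) (hj : a ≤ j ∧ j < b) (hb : b ≤ N)
    (K : ℕ) (c : Config) : ColOp N a b c (c.swapCols K i j) := by
  obtain ⟨U, hU, h⟩ := Row.toMatrix_swap (N := N) (i := i) (j := j) (by omega) (by omega)
  refine ⟨⟨U, hU, fun r => h _⟩, fun r l hl => ?_, fun r hr l h1 h2 => ?_⟩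
  · rw [entry_swapCols, Equiv.swap_apply_of_ne_of_ne (by omega) (by omega)]
  · rw [entry_swapCols]
    apply hr <;> (rw [Equiv.swap_apply_def]; split_ifs <;> omega)

/-- The invariant of the reduction to normal form: the rows `r < u` are `± X_r`, and the rows
`u ≤ r < hi` are supported on the columns `u ≤ j < m`. The rows `r < lo` and `hi ≤ r` and the
projector of the rows `lo ≤ r < hi` are conjugated by a Clifford circuit. -/
structure CnfInv (N lo hi u m : ℕ) (f : ℕ → Op N) (c : Config) : Prop where
  stage : c.stage = .cnf
  KU : c.KU = u
  KL : c.KL = hi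
  NL : c.NL = u
  NR : c.NR = m
  lo_le : lo ≤ u
  le_hi : u ≤ hi
  u_le : u ≤ m
  m_le : m ≤ N
  single : ∀ r < u, ∀ j, c.entry r j = if j = r then .X else .I
  supp : ∀ r, u ≤ r → r < hi → ∀ j, j < u ∨ m ≤ j → c.entry r j = .I
  invol : InvolFamily (c.mat N) 0 hi
  rel : ∃ U ∈ cliffordCircuits N, (∀ r, r < lo ∨ hi ≤ r → c.mat N r = U * f r * star U) ∧
    proj (c.mat N) lo hi = U * proj f lo hi * star U

section

variable {N lo hi u m B : ℕ} {f : ℕ → Op N} {c d : Config}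

theorem CnfInv.rowOp (h : CnfInv N lo hi u m f c) (hF : Frame B c d)
    (hR : RowOp N c.KU c.KL c d) : CnfInv N lo hi u m f d := by
  rw [h.KU, h.KL] at hR
  exact {
    stage := hF.stage.trans h.stage
    KU := hF.KU.trans h.KU
    KL := hF.KL.trans h.KL
    NL := hF.NL.trans h.NL
    NR := hF.NR.trans h.NR
    lo_le := h.lo_le
    le_hi := h.le_hi
    u_le := h.u_le
    m_le := h.m_le
    single r hr j := by rw [entry, hR.outside r (Or.inl hr)]; exact h.single r hr j
    supp r h1 h2 j hj := hR.col j (fun s h3 h4 => h.supp s h3 h4 j hj) r h1 h2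
    invol := hR.involFamily (Nat.zero_le _) h.invol
    rel := by
      obtain ⟨U, hU, h1, h2⟩ := h.rel
      refine ⟨U, hU, fun r hr => ?_, ?_⟩
      · rw [mat, hR.outside r (by have := h.lo_le; omega)]; exact h1 r hr
      · rw [← h2, hR.proj_eq h.lo_le h.le_hi (h.invol.mono (Nat.zero_le _) le_rfl)] }

/-- Finished rows are trivial on the active columns, hence unaffected by the operation; conjugation
preserves involutions and commutation, and the new unitary is composed with the accumulated one. -/
theorem CnfInv.colOp (h : CnfInv N lo hi u m f c) (hF : Frame B c d) (hC : ColOp N u m c d) :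
    CnfInv N lo hi u m f d := by
  obtain ⟨V, hV, hconj⟩ := hC.conj
  have hVu := cliffordCircuits_le_unitary N hV
  have hV2 : star V * V = 1 := Matrix.mem_unitaryGroup_iff'.mp hVu
  have hV1 : V * star V = 1 := Matrix.mem_unitaryGroup_iff.mp hVu
  have hmul : ∀ A B : Op N, V * A * star V * (V * B * star V) = V * (A * B) * star V :=
    fun A B => by
      rw [show V * A * star V * (V * B * star V) = V * A * (star V * V) * B * star V by
        simp only [mul_assoc], hV2]
      simp only [mul_assoc, mul_one]
  refine ⟨hF.stage.trans h.stage, hF.KU.trans h.KU, hF.KL.trans h.KL, hF.NL.trans h.NL,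
    hF.NR.trans h.NR, h.lo_le, h.le_hi, h.u_le, h.m_le, fun r hr j => ?_, fun r h1 h2 j hj => ?_,
    ⟨fun r s h1 h2 h3 h4 => ?_, fun r h1 h2 => ?_⟩, ?_⟩
  · by_cases hj : u ≤ j ∧ j < m
    · rw [if_neg (by omega)]
      refine hC.row r (fun i hi _ => ?_) j hj.1 hj.2
      rw [h.single r hr, if_neg (by omega)]
    · rw [hC.outside r j (by omega), h.single r hr]
  · rw [hC.outside r j hj, h.supp r h1 h2 j hj]
  · rw [hconj, hconj, Commute, SemiconjBy, hmul, hmul, (h.invol.comm r s h1 h2 h3 h4).eq]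
  · rw [hconj, hmul, h.invol.invol r h1 h2, mul_one, hV1]
  · obtain ⟨U, hU, h1, h2⟩ := h.rel
    refine ⟨V * U, mul_mem hV hU, fun r hr => ?_, ?_⟩
    · rw [hconj, h1 r hr, star_mul]; simp only [mul_assoc]
    · rw [proj_congr (g := fun r => V * c.mat N r * star V) fun r _ _ => hconj r, proj_conj hVu, h2,
        star_mul]
      simp only [mul_assoc]

theorem CnfInv.charge (h : CnfInv N lo hi u m f c) (n : ℕ) :
    CnfInv N lo hi u m f (c.charge n) :=
  h.rowOp (frame_charge n c) (RowOp.of_arr_eq rfl)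

/-- Rows commuting with a row `± X_u` have no `Y` or `Z` in the column `u`. -/
theorem CnfInv.entry_of_single (h : CnfInv N lo hi u m f c) (hum : u < m) (hu : u < hi)
    (hX : c.entry u u = .X) (hrow : ∀ j, u < j → j < m → c.entry u j = .I) {r : ℕ} (hr : r < hi) :
    c.entry r u = .I ∨ c.entry r u = .X := by
  by_contra! hcon
  -- A `Y` or `Z` would have to be compensated by a second anticommuting column, but row `u` is
  -- trivial outside column `u`.
  obtain ⟨j, hj, hju, hne, -⟩ := Row.exists_anticommuting (a := c.arr u) (b := c.arr r) (k := u)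
    (by have := h.m_le; omega) (h.invol.comm u r (Nat.zero_le _) hu (Nat.zero_le _) hr)
    (by change c.entry u u ≠ _; rw [hX]; simp) hcon.1
    (by change c.entry u u ≠ c.entry r u; rw [hX]; exact hcon.2.symm)
  refine hne ?_
  by_cases hjm : u ≤ j ∧ j < m
  · exact hrow j (by omega) hjm.2
  · exact h.supp u le_rfl hu j (by omega)

/-- The CNOTs that clear the top row can reintroduce operators in the pivot column of the other
active rows, but only `Z`. When the top row has become `± X_u`, commutation forbids `Z` there, so
the column is empty after all and can be deleted. -/
theorem CnfInv.cnfOne (h : CnfInv N lo hi u m f c) (hum : u < m) {k K : ℕ}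
    (hk : c.first = some k) (hone : c.firstOther (c.entry k c.NL) = none)
    (hhi : hi ≤ K) :
    CnfInv N lo hi (u + 1) m f (c.cnfOne K N k (c.entry k c.NL)) ∧
      (c.cnfOne K N k (c.entry k c.NL)).cost ≤ c.cost + 34 * (N + K + 1) ^ 2 := by
  obtain ⟨hkr, hkI, -⟩ := first_eq_some hk
  obtain ⟨hRs, hsk⟩ := swapRows_top (N := N) hk
  unfold Config.cnfOne
  generalize hσ : c.entry k c.NL = σ at *
  extract_lets c1 c2 c3 c4 c5
  have hu : u < hi := by have := h.KU; have := h.KL; omega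
  have F1 : Frame (4 * (N + 1)) c c1 := frame_swapRows _ _ _ _
  have I1 : CnfInv N lo hi u m f c1 := h.rowOp F1 hRs
  have F2 : Frame (4 * K) c1 c2 := frame_rotCol _ _ _ _
  have I2 : CnfInv N lo hi u m f c2 := I1.colOp F2
    (colOp_rotCol (j := c1.NL) (by have := I1.NL; omega) h.m_le _ _ _)
  have col1 : ∀ r, u ≤ r → r < hi → c1.entry r u = .I ∨ c1.entry r u = σ := by
    intro r h1 h2
    have : ∀ s, u ≤ s → s < hi → c.entry s u = .I ∨ c.entry s u = σ := fun s h3 h4 => by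
      have := firstOther_eq_none hone (r := s) (by rw [h.KU]; exact h3) (by rw [h.KL]; exact h4)
      rwa [h.NL] at this
    change c.entry (Equiv.swap k c.KU r) u = _ ∨ c.entry (Equiv.swap k c.KU r) u = _
    have h5 := h.KU
    have h6 := h.KL
    refine this _ ?_ ?_ <;> (rw [Equiv.swap_apply_def]; split_ifs <;> omega)
  have top1 : c1.entry u u = σ := by
    have : c1.entry c.KU c.NL = σ := by rw [entry, hsk]; exact hσ
    rwa [h.KU, h.NL] at this
  clear_value c1
  have e2 : ∀ r, c2.entry r u = ((Rot.toX σ).act (c1.entry r u)).2 := fun r => by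
    have : c1.NL = u := I1.NL
    rw [← this]; exact entry_rotCol_self _ _ _ _ _
  have col2 : ∀ r, u ≤ r → r < hi → c2.entry r u = .I ∨ c2.entry r u = .X := fun r h1 h2 => by
    rw [e2]
    rcases col1 r h1 h2 with h3 | h3 <;> rw [h3]
    · exact Or.inl (Rot.act_eq_I.mpr rfl)
    · exact Or.inr (Rot.act_toX hkI)
  have top2 : c2.entry u u = .X := by rw [e2, top1]; exact Rot.act_toX hkI
  clear_value c2
  have F3 : Frame ((c2.KL - (c2.KU + 1)) * (3 * (N + 1) + 1)) c2 c3 := frame_clearOne _ _ _ _ _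
  obtain ⟨hR3, hlt3, hcl3⟩ : RowOp N c2.KU c2.KL c2 c3 ∧ (∀ r < c2.KU + 1, c3.arr r = c2.arr r) ∧
      ∀ r, c2.KU + 1 ≤ r → r < c2.KL → c3.entry r c2.NL = .I := clearOne_spec (N := N) (k := c2.KU) (a := c2.KU + 1) (σ := .X)
    (c := c2) le_rfl (Nat.lt_succ_self _) (by rw [I2.KU, I2.KL]; omega)
    (by rw [I2.KU, I2.NL]; exact top2)
    (fun r h1 h2 => by
      rw [I2.NL]; exact col2 r (by rw [I2.KU] at h1; omega) (by rw [I2.KL] at h2; exact h2))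
  have I3 : CnfInv N lo hi u m f c3 := I2.rowOp F3 hR3
  rw [I2.NL, I2.KU, I2.KL] at hcl3
  rw [I2.KU] at hlt3
  have top3 : c3.entry u u = .X := by
    rw [entry, hlt3 u (by omega)]; exact top2
  have col3 : ∀ r, u < r → r < hi → c3.entry r u = .I := fun r h1 h2 => hcl3 r h1 h2
  clear_value c3
  have F4 : Frame ((c3.NR - (c3.NL + 1)) * (4 * K + 1)) c3 c4 := by
    refine frame_forRange (fun r d => ?_) _ _ _
    split_ifs
    · exact frame_rotCol _ _ _ _
    · exact Frame.refl _ _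
  obtain ⟨I4, e4, row4⟩ : CnfInv N lo hi u m f c4 ∧ (∀ r, c4.entry r u = c3.entry r u) ∧
      ∀ i, u < i → i < m → c4.entry u i = .I ∨ c4.entry u i = .X := by
    have := forRange_induct (c := c3) (f := fun j c =>
      if c.entry c.KU j ≠ .I ∧ c.entry c.KU j ≠ .X
      then c.rotCol K j (Rot.toX (c.entry c.KU j)) else c) (fun j d => CnfInv N lo hi u m f d ∧
      (∀ r, d.entry r u = c3.entry r u) ∧
      ∀ i, u < i → i < j → d.entry u i = .I ∨ d.entry u i = .X) (a := c3.NL + 1) (b := c3.NR)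
      (by rw [I3.NL, I3.NR]; exact hum)
      ⟨I3, fun _ => rfl, fun i h1 h2 => by have := I3.NL; omega⟩ (by
        rintro j d h1 h2 ⟨hd, he, hrow⟩
        rw [I3.NL] at h1
        rw [I3.NR] at h2
        rw [hd.KU]
        split_ifs with hc
        · refine ⟨(hd.colOp (frame_rotCol K j _ d)
            (colOp_rotCol (by omega) h.m_le _ _ _)).charge 1, fun r => ?_, fun i h3 h4 => ?_⟩
          · exact (entry_rotCol_of_ne (K := K) (by omega) _ _ _).trans (he r)
          · change (d.rotCol K j _).entry u i = _ ∨ (d.rotCol K j _).entry u i = _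
            by_cases hij : i = j
            · subst hij; rw [entry_rotCol_self]; exact Or.inr (Rot.act_toX hc.1)
            · rw [entry_rotCol_of_ne hij]; exact hrow i h3 (by omega)
        · refine ⟨hd.charge 1, he, fun i h3 h4 => ?_⟩
          change d.entry u i = _ ∨ d.entry u i = _
          by_cases hij : i = j
          · subst hij; tauto
          · exact hrow i h3 (by omega))
    exact ⟨this.1, this.2.1, fun i h1 h2 => this.2.2 i h1 (by rw [I3.NR]; exact h2)⟩
  clear_value c4
  have F5 : Frame ((c4.NR - (c4.NL + 1)) * (6 * K + 1)) c4 c5 := by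
    refine frame_forRange (fun r d => ?_) _ _ _
    split_ifs
    · exact frame_cnotCols _ _ _ _
    · exact Frame.refl _ _
  obtain ⟨I5, top5, col5, row5⟩ : CnfInv N lo hi u m f c5 ∧ c5.entry u u = .X ∧
      (∀ r, u < r → r < hi → c5.entry r u = .I ∨ c5.entry r u = .Z) ∧
      ∀ i, u < i → i < m → c5.entry u i = .I := by
    have := forRange_induct (c := c4) (f := fun j c =>
      if c.entry c.KU j = .X then c.cnotCols K c.NL j else c) (fun j d =>
      (CnfInv N lo hi u m f d ∧ d.entry u u = .X ∧
      -- CNOT maps a control symbol `1` or `Z` to `1` or `Z`, whatever the target symbol; this is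
      -- all that is recorded about the side effect.
      (∀ r, u < r → r < hi → d.entry r u = .I ∨ d.entry r u = .Z) ∧
      (∀ i, u < i → i < j → d.entry u i = .I)) ∧
      ∀ i, j ≤ i → i < m → d.entry u i = .I ∨ d.entry u i = .X) (a := c4.NL + 1) (b := c4.NR)
      (by rw [I4.NL, I4.NR]; exact hum)
      ⟨⟨I4, by rw [e4]; exact top3, fun r h1 h2 => by rw [e4, col3 r h1 h2]; exact Or.inl rfl,
        fun i h1 h2 => by have := I4.NL; omega⟩, fun i h1 h2 => row4 i (by have := I4.NL; omega) h2⟩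
      (by
        rintro j d h1 h2 ⟨⟨hd, htop, hcol, hrow⟩, hrest⟩
        rw [I4.NL] at h1
        rw [I4.NR] at h2
        rw [hd.KU, hd.NL]
        have huj : u ≠ j := by omega
        split_ifs with hc
        · refine ⟨⟨(hd.colOp (frame_cnotCols K u j d)
            (colOp_cnotCols (by omega) (by omega) huj h.m_le _ _)).charge 1, ?_,
            fun r h3 h4 => ?_, fun i h3 h4 => ?_⟩, fun i h3 h4 => ?_⟩
          · change (d.cnotCols K u j).entry u u = _
            rw [entry_cnotCols_control huj, htop, hc]; rfl
          · change (d.cnotCols K u j).entry r u = _ ∨ (d.cnotCols K u j).entry r u = _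
            rw [entry_cnotCols_control huj]
            rcases hcol r h3 h4 with h5 | h5 <;> rw [h5] <;> cases d.entry r j <;> simp [cnotAct]
          · change (d.cnotCols K u j).entry u i = _
            by_cases hij : i = j
            · subst hij; rw [entry_cnotCols_target, htop, hc]; rfl
            · rw [entry_cnotCols_of_ne (by omega) hij]; exact hrow i h3 (by omega)
          · change (d.cnotCols K u j).entry u i = _ ∨ (d.cnotCols K u j).entry u i = _
            rw [entry_cnotCols_of_ne (by omega) (by omega)]; exact hrest i (by omega) h4
        · refine ⟨⟨hd.charge 1, htop, hcol, fun i h3 h4 => ?_⟩, fun i h3 h4 => ?_⟩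
          · change d.entry u i = _
            by_cases hij : i = j
            · subst hij; have := hrest i le_rfl h2; tauto
            · exact hrow i h3 (by omega)
          · exact hrest i (by omega) h4)
    exact ⟨this.1.1, this.1.2.1, this.1.2.2.1,
      fun i h1 h2 => this.1.2.2.2 i h1 (by rw [I4.NR]; exact h2)⟩
  clear_value c5
  refine ⟨⟨I5.stage, ?_, I5.KL, ?_, I5.NR, by have := h.lo_le; omega, hu, hum, h.m_le,
    fun r hr j => ?_, fun r h1 h2 j hj => ?_, I5.invol, I5.rel⟩, ?_⟩
  · change c5.KU + 1 = _; rw [I5.KU]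
  · change c5.NL + 1 = _; rw [I5.NL]
  · change c5.entry r j = _
    rcases Nat.lt_succ_iff_lt_or_eq.mp hr with hr | rfl
    · exact I5.single r hr j
    · by_cases hj : j = r
      · subst hj; rw [if_pos rfl, top5]
      · rw [if_neg hj]
        by_cases hj' : r < j ∧ j < m
        · exact row5 j hj'.1 hj'.2
        · exact I5.supp r le_rfl hu j (by omega)
  · change c5.entry r j = _
    by_cases hju : j = u
    · subst hju
      -- Commutation leaves `1` or `X`, the side effects leave `1` or `Z`; together only `1`
      -- remains.
      have h3 := I5.entry_of_single hum hu top5 row5 h2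
      have h4 := col5 r h1 h2
      rcases h3 with h3 | h3
      · exact h3
      · rw [h3] at h4; simp at h4
    · exact I5.supp r (by omega) h2 j (by omega)
  · change c5.cost + 2 ≤ _
    -- The loops cost at most `4 + 4 + 6` times the square and the remaining operations are linear;
    -- `34` is a generous constant shared by all kinds of iteration.
    have hc := (((F1.trans F2).trans F3).trans F4).trans F5 |>.cost
    rw [I2.KL, I2.KU, I3.NR, I3.NL, I4.NR, I4.NL] at hc
    have b1 : (hi - (u + 1)) * (3 * (N + 1) + 1) ≤ (N + K + 1) * (4 * (N + K + 1)) :=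
      Nat.mul_le_mul (by omega) (by omega)
    have b2 : (m - (u + 1)) * (4 * K + 1) ≤ (N + K + 1) * (4 * (N + K + 1)) :=
      Nat.mul_le_mul (by have := h.m_le; omega) (by omega)
    have b3 : (m - (u + 1)) * (6 * K + 1) ≤ (N + K + 1) * (6 * (N + K + 1)) :=
      Nat.mul_le_mul (by have := h.m_le; omega) (by omega)
    have b4 : N + K + 1 ≤ (N + K + 1) * (N + K + 1) := Nat.le_mul_of_pos_left _ (by omega)
    rw [pow_two]
    simp only [Nat.mul_left_comm _ 4, Nat.mul_left_comm _ 6] at b1 b2 b3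
    omega

end

end Config

-- A factor with `f r = -1` is zero and one with `f r = 1` is the identity. This is the phase test
-- of the end game, and also what excludes leftover rows in the normal form.
open Classical in
theorem proj_of_sign {N : ℕ} {f : ℕ → Op N} {a b : ℕ}
    (h : ∀ r, a ≤ r → r < b → f r = 1 ∨ f r = -1) :
    proj f a b = if ∃ r, a ≤ r ∧ r < b ∧ f r = -1 then 0 else 1 := by
  split_ifs with hex
  · obtain ⟨r, h1, h2, h3⟩ := hex
    rw [← proj_mul_proj h1 h2.le, proj_succ_left h2, h3, add_neg_cancel, smul_zero, zero_mul,
      mul_zero]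
  · have := proj_mul_of_fixed (f := f) (a := a) (b := b) (W := 1) fun r h1 h2 => by
      rcases h r h1 h2 with h3 | h3
      · rw [h3, one_mul]
      · exact absurd ⟨r, h1, h2, h3⟩ hex
    rwa [mul_one] at this

theorem Row.toMatrix_eq_one_or {N : ℕ} {a : Row} (h : ∀ j < N, a.op j = .I)
    (h2 : a.toMatrix N * a.toMatrix N = 1) :
    (a.phase = 0 ∧ a.toMatrix N = 1) ∨ (a.phase ≠ 0 ∧ a.toMatrix N = -1) := by
  rw [Row.toMatrix_of_forall_eq_I h]
  rcases Row.phase_of_mul_self h2 with h3 | h3 <;> rw [h3]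
  · simp
  · exact Or.inr ⟨by decide, by simp [iPow_two]⟩

theorem Row.toMatrix_single {N r : ℕ} (hr : r < N) {a : Row}
    (h : ∀ j, a.op j = if j = r then .X else .I) (h2 : a.toMatrix N * a.toMatrix N = 1) :
    ∃ s : ℤˣ, (2⁻¹ : ℂ) • (1 + a.toMatrix N) = onQubit ⟨r, hr⟩ (projX s) := by
  have e : a.toMatrix N = iPow a.phase • onQubit ⟨r, hr⟩ Pauli.X.toMatrix := by
    rw [Row.toMatrix, onQubit]
    congr 2; ext1 i
    by_cases hi : i = ⟨r, hr⟩
    · subst hi; simp [h]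
    · have : (i : ℕ) ≠ r := fun e => hi (Fin.ext e)
      simp [h, hi, this, Pauli.toMatrix_I]
  have hadd : ∀ V W : Matrix (Fin 2) (Fin 2) ℂ,
      onQubit (⟨r, hr⟩ : Fin N) (V + W) = onQubit ⟨r, hr⟩ V + onQubit ⟨r, hr⟩ W := fun V W => by
    ext x y
    simp only [onQubit, tensor, Matrix.of_apply, Matrix.add_apply]
    rw [← Finset.mul_prod_erase _ _ (Finset.mem_univ (⟨r, hr⟩ : Fin N)),
      ← Finset.mul_prod_erase _ _ (Finset.mem_univ (⟨r, hr⟩ : Fin N)),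
      ← Finset.mul_prod_erase _ _ (Finset.mem_univ (⟨r, hr⟩ : Fin N))]
    simp only [Function.update_self, Matrix.add_apply, add_mul]
    congr 2 <;> refine Finset.prod_congr rfl fun i hi => ?_ <;>
      rw [Function.update_of_ne (Finset.ne_of_mem_erase hi),
        Function.update_of_ne (Finset.ne_of_mem_erase hi)]
  have hsmul : ∀ (z : ℂ) (V : Matrix (Fin 2) (Fin 2) ℂ),
      onQubit (⟨r, hr⟩ : Fin N) (z • V) = z • onQubit ⟨r, hr⟩ V :=
    fun z V => tensor_update_smul _ _ _ _
  obtain ⟨s, hs⟩ : ∃ s : ℤˣ, iPow a.phase = (((s : ℤˣ) : ℤ) : ℂ) := by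
    rcases Row.phase_of_mul_self h2 with h3 | h3 <;> rw [h3]
    · exact ⟨1, by simp⟩
    · exact ⟨-1, by simp [iPow_two]⟩
  refine ⟨s, ?_⟩
  rw [e, hs, projX, hsmul, hadd, hsmul, onQubit_one]

theorem tensorProj_succ {N r : ℕ} (s : Fin N → ℤˣ) (hr : r < N) :
    tensorProj s r * onQubit ⟨r, hr⟩ (projX (s ⟨r, hr⟩)) = tensorProj s (r + 1) := by
  rw [tensorProj, tensor_mul_tensor_update, tensorProj]
  congr 1; ext1 i
  by_cases hi : i = ⟨r, hr⟩
  · subst hi; simp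
  · have : (i : ℕ) ≠ r := fun e => hi (Fin.ext e)
    have h2 : ((i : ℕ) < r + 1) = ((i : ℕ) < r) := propext (by omega)
    simp [hi, h2]

/-! ### Termination and completeness of the normal form -/

namespace Config

/-- The number of Pauli operators in the top row of the active region. -/
def weight (c : Config) : ℕ :=
  ((Finset.Ico c.NL c.NR).filter fun j => c.entry c.KU j ≠ .I).card

/-- A measure that decreases in each iteration of the reduction to normal form. -/
def cnfMeasure (N : ℕ) (c : Config) : ℕ :=
  (c.NR - c.NL) * (N + 2) + if c.entry c.KU c.NL = .I then N + 1 else c.weight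

theorem weight_le (c : Config) : c.weight ≤ c.NR := by
  refine (Finset.card_filter_le _ _).trans ?_
  rw [Nat.card_Ico]; omega

theorem cnfMeasure_le {N : ℕ} {c : Config} (h : c.NR ≤ N) :
    cnfMeasure N c ≤ (c.NR - c.NL) * (N + 2) + (N + 1) := by
  have := c.weight_le
  rw [cnfMeasure]; split_ifs <;> omega

/-- The second summand of the measure never exceeds `N + 1`, so the loss of one active column,
weighted with `N + 2`, outweighs any growth of it. -/
theorem cnfMeasure_lt {N : ℕ} {c d : Config} (h : d.NR ≤ N) (hlt : d.NR - d.NL < c.NR - c.NL) :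
    cnfMeasure N d < cnfMeasure N c := by
  have h1 := cnfMeasure_le (c := d) h
  have h2 : (c.NR - c.NL) * (N + 2) ≤ cnfMeasure N c := Nat.le_add_right _ _
  have h3 : (d.NR - d.NL + 1) * (N + 2) ≤ (c.NR - c.NL) * (N + 2) :=
    Nat.mul_le_mul_right _ hlt
  rw [add_mul] at h3
  omega

section

variable {N lo hi u m B : ℕ} {f : ℕ → Op N} {c d : Config}

/-- No column is deleted here; progress is visible only in the top row. It acquires `X` in both
columns, and the CNOT turns this `X X` into `X 1`, so it keeps its pivot and loses an entry. -/
theorem CnfInv.cnfTwo (h : CnfInv N lo hi u m f c) (hum : u < m) {k₁ k₂ K : ℕ}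
    (hk₁ : c.first = some k₁) (hk₂ : c.firstOther (c.entry k₁ c.NL) = some k₂) :
    CnfInv N lo hi u m f (c.cnfTwo K N k₁ k₂ (c.entry k₁ c.NL) (c.entry k₂ c.NL)) ∧
      cnfMeasure N (c.cnfTwo K N k₁ k₂ (c.entry k₁ c.NL) (c.entry k₂ c.NL)) < cnfMeasure N c ∧
      (c.cnfTwo K N k₁ k₂ (c.entry k₁ c.NL) (c.entry k₂ c.NL)).cost ≤
        c.cost + 34 * (N + K + 1) ^ 2 := by
  obtain ⟨-, hI1, hmin⟩ := first_eq_some hk₁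
  obtain ⟨-, hI2, hne⟩ := firstOther_eq_some hk₂
  obtain ⟨hlt, hR2, htop, hsnd⟩ := swapRows_two (N := N) hk₁ hk₂
  rw [h.KU, h.KL] at hlt
  unfold Config.cnfTwo
  extract_lets c1 c2 c3 c4
  have F2 : Frame (4 * (N + 1) + 4 * (N + 1)) c c2 :=
    (frame_swapRows N _ _ _).trans (frame_swapRows N _ _ _)
  have I2 : CnfInv N lo hi u m f c2 := h.rowOp F2 hR2
  have row1 : ∀ j, c2.entry u j = c.entry k₁ j := fun j => by
    rw [← h.KU, entry, entry]; exact congrArg (fun a => a.op j) htop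
  have row2 : ∀ j, c2.entry (u + 1) j = c.entry k₂ j := fun j => by
    rw [← h.KU, entry, entry]; exact congrArg (fun a => a.op j) hsnd
  clear_value c2
  clear c1
  have F3 : Frame (4 * K) c2 c3 := frame_rotCol _ _ _ _
  have I3 : CnfInv N lo hi u m f c3 := I2.colOp F3
    (colOp_rotCol (j := c2.NL) (by have := I2.NL; omega) h.m_le _ _ _)
  obtain ⟨p1, p2⟩ := Rot.act_toPair hI1 hI2 hne.symm (τ₁ := .X) (τ₂ := .Z) (by simp) (by simp)
    (by simp)
  have e3 : ∀ r, c3.entry r c2.NL = ((Rot.toPair (c.entry k₁ c.NL) (c.entry k₂ c.NL) .X .Z).act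
      (c2.entry r c2.NL)).2 := fun r => entry_rotCol_self _ _ _ _ _
  have X3 : c3.entry u u = .X := by
    rw [← p1, ← I2.NL, e3, I2.NL, row1, h.NL]
  have Z3 : c3.entry (u + 1) u = .Z := by
    rw [← p2, ← I2.NL, e3, I2.NL, row2, h.NL]
  have o3 : ∀ j, j ≠ u → c3.entry u j = c.entry k₁ j := fun j hj => by
    rw [← row1]; exact entry_rotCol_of_ne (by rw [I2.NL]; exact hj) _ _ _
  clear_value c3
  have F4 : Frame (2 * N) c3 c4 := frame_charge _ _
  have I4 : CnfInv N lo hi u m f c4 := I3.charge _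
  have X4 : c4.entry u u = .X := X3
  have Z4 : c4.entry (u + 1) u = .Z := Z3
  have o4 : ∀ j, j ≠ u → c4.entry u j = c.entry k₁ j := o3
  clear_value c4
  split
  · next hnone =>
    exfalso
    -- The search for a second anticommuting column cannot fail: the two top rows commute and are
    -- trivial outside the active columns.
    obtain ⟨j, hj, hju, h1, h2, h3⟩ := Row.exists_anticommuting (a := c4.arr u)
      (b := c4.arr (u + 1)) (k := u) (by have := h.m_le; omega)
      (I4.invol.comm u (u + 1) (Nat.zero_le _) (by omega) (Nat.zero_le _) hlt)
      (by change c4.entry u u ≠ _; rw [X4]; simp)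
      (by change c4.entry (u + 1) u ≠ _; rw [Z4]; simp)
      (by change c4.entry u u ≠ c4.entry (u + 1) u; rw [X4, Z4]; simp)
    have hjm : u ≤ j ∧ j < m := by
      by_contra hcon
      exact h1 (I4.supp u le_rfl (by omega) j (by omega))
    rw [anticommCol, List.find?_range'_eq_none] at hnone
    have := hnone j (by rw [I4.NL]; omega) (by rw [I4.NL, I4.NR]; omega)
    simp only [I4.KU, entry] at this
    simp_all
  · next l hl =>
    rw [anticommCol, List.find?_range'_eq_some] at hl
    obtain ⟨hl1, hl2, -⟩ := hl
    rw [List.mem_range'_1, I4.NL, I4.NR] at hl2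
    rw [I4.KU] at hl1 ⊢
    simp only [ne_eq, decide_not, Bool.decide_and, Bool.and_eq_true, Bool.not_eq_true',
      decide_eq_false_iff_not] at hl1
    obtain ⟨l1, l2, l12⟩ := hl1
    have hlu : l ≠ u := by omega
    extract_lets c5
    have F5 : Frame (4 * K) c4 c5 := frame_rotCol _ _ _ _
    have I5 : CnfInv N lo hi u m f c5 := I4.colOp F5
      (colOp_rotCol (j := l) (by omega) h.m_le _ _ _)
    have X5 : c5.entry u u = .X := by
      rw [← X4]; exact entry_rotCol_of_ne hlu.symm _ _ _
    have l5 : c5.entry u l = .X :=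
      (entry_rotCol_self _ _ _ _ _).trans (Rot.act_toPair l1 l2 l12 (by simp) (by simp)
        (by simp)).1
    have o5 : ∀ j, j ≠ u → j ≠ l → c5.entry u j = c.entry k₁ j := fun j h1 h2 => by
      rw [← o4 j h1]; exact entry_rotCol_of_ne h2 _ _ _
    have F6 : Frame (6 * K) c5 (c5.cnotCols K c5.NL l) := frame_cnotCols _ _ _ _
    have I6 : CnfInv N lo hi u m f (c5.cnotCols K c5.NL l) := I5.colOp F6
      (by rw [I5.NL]; exact colOp_cnotCols (by omega) (by omega) hlu.symm h.m_le _ _)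
    have X6 : (c5.cnotCols K c5.NL l).entry u u = .X := by
      rw [I5.NL, entry_cnotCols_control hlu.symm, X5, l5]; rfl
    have l6 : (c5.cnotCols K c5.NL l).entry u l = .I := by
      rw [I5.NL, entry_cnotCols_target, X5, l5]; rfl
    have o6 : ∀ j, j ≠ u → j ≠ l → (c5.cnotCols K c5.NL l).entry u j = c.entry k₁ j :=
      fun j h1 h2 => by rw [I5.NL, entry_cnotCols_of_ne h1 h2, o5 j h1 h2]
    generalize c5.cnotCols K c5.NL l = c6 at *
    refine ⟨I6, ?_, ?_⟩
    · rw [cnfMeasure, cnfMeasure, I6.KU, I6.NL, I6.NR, h.KU, h.NL, h.NR]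
      refine Nat.add_lt_add_left ?_ _
      rw [if_neg (by rw [X6]; simp)]
      -- If the old top row had no Pauli operator in the first active column, the measure drops from
      -- its exceptional value `N + 1` to a weight, at most `N`. Otherwise the first transposition
      -- was trivial, and the same top row has lost the entry in column `l`.
      split_ifs with hc
      · have := c6.weight_le; rw [I6.NR] at this; have := h.m_le; omega
      · have hku : k₁ = u := by
          rw [h.KU, h.NL] at hmin; exact hmin hc
        rw [weight, weight, I6.KU, I6.NL, I6.NR, h.KU, h.NL, h.NR]
        refine Finset.card_lt_card (Finset.ssubset_iff_of_subset ?_ |>.mpr ⟨l, ?_, ?_⟩)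
        · intro j hj
          rw [Finset.mem_filter] at hj ⊢
          refine ⟨hj.1, ?_⟩
          by_cases hju : j = u
          · subst hju; exact hc
          · have hjl : j ≠ l := fun e => hj.2 (by rw [e, l6])
            rw [← hku, ← o6 j hju hjl]; exact hj.2
        · rw [Finset.mem_filter, Finset.mem_Ico]
          refine ⟨by omega, ?_⟩
          rw [← hku, ← o4 l hlu]; exact l1
        · rw [Finset.mem_filter]; simp [l6]
    · have := ((((F2.trans F3).trans F4).trans F5).trans F6).cost
      have b4 : N + K + 1 ≤ (N + K + 1) * (N + K + 1) := Nat.le_mul_of_pos_left _ (by omega)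
      rw [pow_two]
      omega

theorem CnfInv.step (h : CnfInv N lo hi u m f c) (hA : c.Active) {K₁ K₂ : ℕ}
    (hhi : hi ≤ K₁ + K₂) :
    (∃ u' m', CnfInv N lo hi u' m' f (c.step K₁ K₂ N)) ∧
      cnfMeasure N (c.step K₁ K₂ N) < cnfMeasure N c ∧
      (c.step K₁ K₂ N).cost ≤ c.cost + 36 * (N + (K₁ + K₂) + 1) ^ 2 := by
  have hum : u < m := by have := hA.1; rw [h.NL, h.NR] at this; exact this
  have hcost : (c.charge (2 * (c.KL - c.KU))).cost ≤ c.cost + 2 * (K₁ + K₂) := by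
    change c.cost + 2 * (c.KL - c.KU) ≤ _
    rw [h.KL]; omega
  have hmeas : cnfMeasure N (c.charge (2 * (c.KL - c.KU))) = cnfMeasure N c := rfl
  have hI := h.charge (2 * (c.KL - c.KU))
  have b4 : N + (K₁ + K₂) + 1 ≤ (N + (K₁ + K₂) + 1) ^ 2 := Nat.le_self_pow (by omega) _
  rw [Config.step, h.stage]
  dsimp only
  rw [cnfStep, if_pos hA]
  extract_lets c'
  change CnfInv N lo hi u m f c' at hI
  change c'.cost ≤ _ at hcost
  change cnfMeasure N c' = _ at hmeas
  clear_value c'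
  split
  · next hnone =>
    have F : Frame (4 * (K₁ + K₂)) c' (c'.swapCols (K₁ + K₂) c'.NL (c'.NR - 1)) :=
      frame_swapCols _ _ _ _
    have hC : ColOp N u m c' (c'.swapCols (K₁ + K₂) c'.NL (c'.NR - 1)) := by
      rw [hI.NL, hI.NR]
      exact colOp_swapCols (by omega) (by omega) h.m_le _ _
    have I := hI.colOp F hC
    -- The column without Pauli operators now stands in the last active place.
    have hcol : ∀ r, u ≤ r → r < hi →
        (c'.swapCols (K₁ + K₂) c'.NL (c'.NR - 1)).entry r (m - 1) = .I := fun r h1 h2 => by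
      rw [entry_swapCols, hI.NR, Equiv.swap_apply_right]
      exact first_eq_none hnone (by rw [hI.KU]; exact h1) (by rw [hI.KL]; exact h2)
    set d := c'.swapCols (K₁ + K₂) c'.NL (c'.NR - 1)
    refine ⟨⟨u, m - 1, I.stage, I.KU, I.KL, I.NL, ?_, I.lo_le, I.le_hi, by omega,
      by have := h.m_le; omega, I.single, fun r h1 h2 j hj => ?_, I.invol, I.rel⟩, ?_, ?_⟩
    · change c'.NR - 1 = _; rw [hI.NR]
    · change d.entry r j = _
      by_cases hjm : j = m - 1
      · subst hjm; exact hcol r h1 h2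
      · exact I.supp r h1 h2 j (by omega)
    · rw [← hmeas]
      refine cnfMeasure_lt ?_ ?_
      · change c'.NR - 1 ≤ _; rw [hI.NR]; have := h.m_le; omega
      · change c'.NR - 1 - d.NL < _; rw [hI.NR, I.NL, hI.NL]; omega
    · change d.cost + 1 ≤ _
      have := F.cost
      omega
  · next k₁ hk₁ =>
    split
    · next hnone =>
      obtain ⟨I, hc⟩ := hI.cnfOne hum hk₁ hnone hhi
      refine ⟨⟨_, _, I⟩, ?_, by omega⟩
      rw [← hmeas]
      refine cnfMeasure_lt ?_ ?_
      · rw [I.NR]; exact h.m_le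
      · rw [I.NR, I.NL, hI.NR, hI.NL]; omega
    · next k₂ hk₂ =>
      obtain ⟨I, hm, hc⟩ := hI.cnfTwo (K := K₁ + K₂) hum hk₁ hk₂
      exact ⟨⟨_, _, I⟩, by rw [← hmeas]; exact hm, by omega⟩

theorem CnfInv.conj (h : CnfInv N lo hi u m f c) : ∃ U ∈ cliffordCircuits N,
    (∀ r, hi ≤ r → c.mat N r = U * f r * star U) ∧
    proj (c.mat N) 0 lo = U * proj f 0 lo * star U ∧
    proj (c.mat N) 0 hi = U * proj f 0 hi * star U := by
  obtain ⟨U, hU, h1, h2⟩ := h.rel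
  have hUu := cliffordCircuits_le_unitary N hU
  have hU2 : star U * U = 1 := Matrix.mem_unitaryGroup_iff'.mp hUu
  have hlo : proj (c.mat N) 0 lo = U * proj f 0 lo * star U := by
    rw [← proj_conj hUu]
    exact proj_congr fun r _ hr => h1 r (Or.inl hr)
  refine ⟨U, hU, fun r hr => h1 r (Or.inr hr), hlo, ?_⟩
  have hle := h.lo_le.trans h.le_hi
  rw [← proj_mul_proj (Nat.zero_le lo) hle, ← proj_mul_proj (Nat.zero_le lo) hle, hlo, h2,
    show U * proj f 0 lo * star U * (U * proj f lo hi * star U) =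
      U * proj f 0 lo * (star U * U) * proj f lo hi * star U by simp only [mul_assoc], hU2, mul_one]
  simp only [mul_assoc]

/-- Row `r` has its only Pauli operator in column `r`, so the rows in their order already form an
echelon. -/
theorem traceScalar_single {k : ℕ} (hk : k ≤ N)
    (h : ∀ r < k, ∀ j, c.entry r j = if j = r then .X else .I) :
    TraceScalar k k (proj (c.mat N) 0 k) := by
  induction k with
  | zero => rw [proj_of_le le_rfl]; exact traceScalar_one
  | succ k ih =>
    rw [proj_succ_right (Nat.zero_le _)]
    refine (ih (by omega) fun r hr => h r (by omega)).mul_half_one_add (by omega)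
      (fun j hj => ?_) ?_
    · exact (h k (by omega) j).trans (if_neg (by omega))
    · rw [show (c.arr k).op k = _ from h k (by omega) k, if_pos rfl]; simp

/-- One choice of signs serves all initial segments of the rows. This is needed because the tensor
forms of `P₁` and of `P₁ P₂ P₁` share their first signs. -/
theorem exists_tensorProj {k : ℕ} (hk : k ≤ N)
    (h : ∀ r < k, ∀ j, c.entry r j = if j = r then .X else .I)
    (h2 : ∀ r < k, c.mat N r * c.mat N r = 1) :
    ∃ s : Fin N → ℤˣ, ∀ l ≤ k, proj (c.mat N) 0 l = tensorProj s l := by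
  have key : ∀ r : Fin N, ∃ s : ℤˣ, (r : ℕ) < k →
      (2⁻¹ : ℂ) • (1 + c.mat N r) = onQubit r (projX s) := fun r => by
    by_cases hr : (r : ℕ) < k
    · obtain ⟨s, hs⟩ := Row.toMatrix_single (N := N) r.2 (h r hr) (h2 r hr)
      exact ⟨s, fun _ => hs⟩
    · exact ⟨1, fun h => absurd h hr⟩
  choose s hs using key
  refine ⟨s, fun l hl => ?_⟩
  induction l with
  | zero =>
    rw [proj_of_le le_rfl, tensorProj]
    simp [tensor_one]
  | succ l ih =>
    rw [proj_succ_right (Nat.zero_le _), ih (by omega),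
      hs ⟨l, by omega⟩ (Nat.lt_of_succ_le hl), tensorProj_succ]

/-- A rank count. If active rows were left, no active column would be, so these rows would be `± 1`;
the projector would then be zero or have trace `2 ^ (N - u)`, whereas conjugation preserves the
trace `2 ^ (N - hi)`. -/
theorem CnfInv.eq_hi (h : CnfInv N lo hi u m f c) (hA : ¬ c.Active)
    (ht : 2 ^ hi * (proj f 0 hi).trace = 2 ^ N) : u = hi := by
  by_contra hne
  have hlt : u < hi := lt_of_le_of_ne h.le_hi hne
  have hmu : m ≤ u := by
    rw [Active, h.NL, h.NR, h.KU, h.KL] at hA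
    omega
  obtain ⟨U, hU, -, -, hp⟩ := h.conj
  have hU2 : star U * U = 1 := Matrix.mem_unitaryGroup_iff'.mp (cliffordCircuits_le_unitary N hU)
  have ht' : 2 ^ hi * (proj (c.mat N) 0 hi).trace = 2 ^ N := by
    rw [hp, Matrix.trace_mul_comm, ← mul_assoc, hU2, one_mul, ht]
  have h1 := (traceScalar_single (N := N) (by have := h.u_le; have := h.m_le; omega)
    h.single).two_pow_mul_trace
  rw [← proj_mul_proj (Nat.zero_le u) h.le_hi, proj_of_sign (a := u) fun r hr1 hr2 => by
    rcases Row.toMatrix_eq_one_or (N := N) (a := c.arr r)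
      (fun j _ => h.supp r hr1 hr2 j (by omega))
      (h.invol.invol r (Nat.zero_le _) hr2) with h3 | h3
    · exact Or.inl h3.2
    · exact Or.inr h3.2] at ht'
  split_ifs at ht'
  · rw [mul_zero, Matrix.trace_zero, mul_zero] at ht'
    exact pow_ne_zero N two_ne_zero ht'.symm
  · rw [mul_one] at ht'
    have h0 : (proj (c.mat N) 0 u).trace ≠ 0 := fun e => by
      rw [e, mul_zero] at h1
      exact pow_ne_zero N two_ne_zero h1.symm
    have h2 := mul_right_cancel₀ h0 (h1.trans ht'.symm)
    have h3 : (2 : ℕ) ^ u = 2 ^ hi := by exact_mod_cast h2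
    exact hne (Nat.pow_right_injective le_rfl h3)

/-- The reduction to normal form terminates with the active rows used up. -/
theorem CnfInv.exists_normalForm (h : CnfInv N lo hi u m f c) {K₁ K₂ : ℕ} (hhi : hi ≤ K₁ + K₂)
    (ht : 2 ^ hi * (proj f 0 hi).trace = 2 ^ N) :
    ∃ n m', CnfInv N lo hi hi m' f ((Config.step K₁ K₂ N)^[n] c) ∧
      ((Config.step K₁ K₂ N)^[n] c).cost ≤
        c.cost + (N * (N + 2) + (N + 1)) * (36 * (N + (K₁ + K₂) + 1) ^ 2) := by
  obtain ⟨n, ⟨u', m', hn⟩, hA, hc⟩ := exists_iterate (Config.step K₁ K₂ N)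
    (fun c => ∃ u m, CnfInv N lo hi u m f c) Active (cnfMeasure N) Config.cost
    (36 * (N + (K₁ + K₂) + 1) ^ 2) (fun d ⟨u, m, hd⟩ ha => hd.step ha hhi) c ⟨u, m, h⟩
  have hu := hn.eq_hi hA ht
  subst hu
  refine ⟨n, m', hn, hc.trans (Nat.add_le_add_left (Nat.mul_le_mul_right _ ?_) _)⟩
  have h1 : c.NR ≤ N := by rw [h.NR]; exact h.m_le
  refine (cnfMeasure_le h1).trans (Nat.add_le_add_right (Nat.mul_le_mul_right _ ?_) _)
  omega

end

end Config

/-- Deletion of an involution that anticommutes with a symmetry of `A`. -/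
theorem mul_half_one_add_mul_of_anticommute {N : ℕ} {A x g R : Op N} (hA : A * x = A)
    (hA' : x * A = A) (hg : x * g = -(g * x)) (hR : Commute x R) :
    A * (((2⁻¹ : ℂ) • (1 + g)) * R) * A = (2⁻¹ : ℂ) • (A * R * A) := by
  -- The symmetry `x` is created at the left `A`, moved through `g` at the price of a sign, and
  -- absorbed by the right `A`.
  have h : A * g * R * A = -(A * g * R * A) := calc
    A * g * R * A = A * x * g * R * A := by rw [hA]
    _ = A * (x * g) * R * A := by rw [mul_assoc A x g]
    _ = -(A * g * (x * R) * A) := by rw [hg]; simp only [mul_neg, neg_mul, mul_assoc]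
    _ = -(A * g * R * (x * A)) := by rw [hR.eq]; simp only [mul_assoc]
    _ = -(A * g * R * A) := by rw [hA']
  have h0 : A * g * R * A = 0 := by
    rw [eq_neg_iff_add_eq_zero, ← two_smul ℂ] at h
    exact (smul_eq_zero.mp h).resolve_left two_ne_zero
  rw [Matrix.smul_mul, Matrix.mul_smul, Matrix.smul_mul, add_mul, mul_add, add_mul, one_mul,
    ← mul_assoc A g R, h0, add_zero]

/-! ### Elimination of the first array's columns from the second array -/

namespace Config

section

variable {N k u b j : ℕ} {c d : Config}

/-- The rows `r < k` are `± X_r`. -/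
structure Single (N k : ℕ) (c : Config) : Prop where
  le : k ≤ N
  entry : ∀ r < k, ∀ j, c.entry r j = if j = r then .X else .I
  invol : ∀ r < k, c.mat N r * c.mat N r = 1

theorem Single.of_arr_eq (h : Single N k c) (he : ∀ r < k, d.arr r = c.arr r) : Single N k d :=
  ⟨h.le, fun r hr j => by rw [Config.entry, he r hr]; exact h.entry r hr j,
    fun r hr => by rw [mat, he r hr]; exact h.invol r hr⟩

theorem Single.involFamily (h : Single N k c) : InvolFamily (c.mat N) 0 k := by
  refine ⟨fun r s _ hr _ hs => Row.commute_of_forall fun j _ => ?_, fun r _ hr => h.invol r hr⟩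
  have h1 := h.entry r hr j
  have h2 := h.entry s hs j
  rw [Config.entry] at h1 h2
  rw [h1, h2]
  split_ifs <;> simp

theorem Single.commute (h : Single N k c) (hj : j < k) {r : ℕ}
    (hr : c.entry r j = .I ∨ c.entry r j = .X) : Commute (c.mat N j) (c.mat N r) := by
  refine Row.commute_of_forall fun i _ => ?_
  have h1 := h.entry j hj i
  rw [Config.entry] at h1
  rw [h1]
  split_ifs with hi
  · subst hi; rcases hr with h2 | h2 <;> rw [Config.entry] at h2 <;> simp [h2]
  · simp

theorem Single.anticommute (h : Single N k c) (hj : j < k) {r : ℕ} (h1 : c.entry r j ≠ .I)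
    (h2 : c.entry r j ≠ .X) : c.mat N j * c.mat N r = -(c.mat N r * c.mat N j) := by
  have h3 : ∀ i, (c.arr j).op i = if i = j then .X else .I := h.entry j hj
  refine Row.anticommute_of_unique (k := j) (by have := h.le; omega) (by rw [h3]; simp) h1 ?_
    fun i _ hi => ?_
  · rw [h3, if_pos rfl]; exact h2.symm
  · rw [h3, if_neg hi]; exact Or.inl rfl

theorem Single.fixedBy (h : Single N k c) (hj : j < k) :
    c.mat N j * proj (c.mat N) 0 k = proj (c.mat N) 0 k ∧
      proj (c.mat N) 0 k * c.mat N j = proj (c.mat N) 0 k :=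
  h.involFamily.fixedBy_proj j (Nat.zero_le _) hj

/-- With `Y` or `Z` in column `j`, row `u` anticommutes with the row `± X_j`, while the other active
rows commute with it; sandwiched between the projectors of the first array, the factor of row `u`
reduces to `1 / 2`. -/
theorem Single.delete (h : Single N k c) (hj : j < k) (hub : u < b) (h1 : c.entry u j ≠ .I)
    (h2 : c.entry u j ≠ .X)
    (hr : ∀ r, u < r → r < b → c.entry r j = .I ∨ c.entry r j = .X) :
    proj (c.mat N) 0 k * proj (c.mat N) u b * proj (c.mat N) 0 k =
      (2⁻¹ : ℂ) • (proj (c.mat N) 0 k * proj (c.mat N) (u + 1) b * proj (c.mat N) 0 k) := by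
  rw [proj_succ_left hub]
  exact mul_half_one_add_mul_of_anticommute (h.fixedBy hj).2 (h.fixedBy hj).1
    (h.anticommute hj h1 h2) (commute_proj fun r h3 h4 => h.commute hj (hr r h3 h4))

/-- Row `j` lies outside the active family, so this is not a row equivalence and the projector of
the active rows does change. Only its product with the projector of the first array is preserved,
since the latter absorbs row `j`. -/
theorem Single.multiply (h : Single N k c) (hj : j < k) (hub : u < b)
    (hr : ∀ r, u ≤ r → r < b → c.entry r j = .I ∨ c.entry r j = .X)
    (hc : InvolFamily (c.mat N) u b) :
    InvolFamily ((c.mulRow N j u).mat N) u b ∧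
      proj (c.mat N) 0 k * proj ((c.mulRow N j u).mat N) u b =
        proj (c.mat N) 0 k * proj (c.mat N) u b := by
  have hcom : ∀ r, u ≤ r → r < b → Commute (c.mat N j) (c.mat N r) := fun r h1 h2 =>
    h.commute hj (hr r h1 h2)
  rw [mat_mulRow]
  constructor
  · have hx : ∀ r, u < r → r < b → Commute (c.mat N j * c.mat N u) (c.mat N r) := fun r h1 h2 =>
      (hcom r h1.le h2).mul_left (hc.comm u r le_rfl hub h1.le h2)
    refine ⟨fun r s h1 h2 h3 h4 => ?_, fun r h1 h2 => ?_⟩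
    · rcases Nat.eq_or_lt_of_le h1 with rfl | h1' <;> rcases Nat.eq_or_lt_of_le h3 with rfl | h3'
      · exact Commute.refl _
      · rw [Function.update_self, Function.update_of_ne (by omega)]; exact hx s h3' h4
      · rw [Function.update_self, Function.update_of_ne (by omega)]; exact (hx r h1' h2).symm
      · rw [Function.update_of_ne (by omega), Function.update_of_ne (by omega)]
        exact hc.comm r s h1 h2 h3 h4
    · rcases Nat.eq_or_lt_of_le h1 with rfl | h1'
      · rw [Function.update_self, (hcom u le_rfl hub).symm.mul_mul_mul_comm, h.invol j hj,
          hc.invol u le_rfl hub, one_mul]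
      · rw [Function.update_of_ne (by omega)]; exact hc.invol r h1 h2
  · rw [proj_succ_left hub, proj_succ_left hub, Function.update_self,
      proj_congr (a := u + 1) (g := c.mat N) fun r h1 _ => Function.update_of_ne (by omega) _ _,
      ← mul_assoc, ← mul_assoc]
    congr 1
    rw [Matrix.mul_smul, Matrix.mul_smul, mul_add, mul_add, ← mul_assoc, (h.fixedBy hj).2]

theorem Single.entry_mulRow (h : Single N k c) (hj : j < k) (u i : ℕ) :
    (c.mulRow N j u).entry u i =
      if i = j then (Pauli.mul .X (c.entry u j)).2 else c.entry u i := by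
  rw [entry_mulRow_self, h.entry j hj]
  split_ifs with hi
  · rw [hi]
  · rfl

end

/-- The invariant of the elimination: `A` is the projector of the first array in normal form, `B`
is the projector of the second array at the start. -/
structure TraceInv (N K₁ K₂ : ℕ) (A B : Op N) (c : Config) : Prop where
  stage : c.stage = .trace
  KL : c.KL = K₁ + K₂
  NR : c.NR = K₁
  R₁ : c.R₁ = K₁
  NL_le : c.NL ≤ K₁
  le_KU : K₁ ≤ c.KU
  KU_le : c.KU ≤ K₁ + K₂
  single : Single N K₁ c
  supp : ∀ r, c.KU ≤ r → r < K₁ + K₂ → ∀ j < c.NL, c.entry r j = .I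
  invol : InvolFamily (c.mat N) c.KU (K₁ + K₂)
  first : proj (c.mat N) 0 K₁ = A
  T : c.T = (1 / 2) ^ (c.KU - K₁)
  product : A * B * A = (c.T : ℂ) • (A * proj (c.mat N) c.KU (K₁ + K₂) * A)

section

variable {N K₁ K₂ m : ℕ} {A B : Op N} {c d : Config}

theorem TraceInv.rowOp (h : TraceInv N K₁ K₂ A B c) (hF : Frame m c d)
    (hR : RowOp N c.KU c.KL c d) : TraceInv N K₁ K₂ A B d := by
  rw [h.KL] at hR
  have hle := h.le_KU
  have hsame : ∀ r < K₁, d.arr r = c.arr r := fun r hr => hR.outside r (by omega)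
  exact {
    stage := hF.stage.trans h.stage
    KL := hF.KL.trans h.KL
    NR := hF.NR.trans h.NR
    R₁ := hF.R₁.trans h.R₁
    NL_le := by rw [hF.NL]; exact h.NL_le
    le_KU := by rw [hF.KU]; exact h.le_KU
    KU_le := by rw [hF.KU]; exact h.KU_le
    single := h.single.of_arr_eq hsame
    supp := by
      rw [hF.KU, hF.NL]
      exact fun r h1 h2 j hj => hR.col j (fun s h3 h4 => h.supp s h3 h4 j hj) r h1 h2
    invol := by rw [hF.KU]; exact hR.involFamily le_rfl h.invol
    first := by
      rw [← h.first]
      exact proj_congr fun r _ hr => by rw [mat, hsame r hr, mat]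
    T := by rw [hF.T, hF.KU, h.T]
    product := by rw [hF.T, hF.KU, hR.proj_eq le_rfl h.KU_le h.invol, h.product] }

theorem TraceInv.charge (h : TraceInv N K₁ K₂ A B c) (n : ℕ) :
    TraceInv N K₁ K₂ A B (c.charge n) :=
  h.rowOp (frame_charge n c) (RowOp.of_arr_eq rfl)

/-- Deletion of the top row. -/
theorem TraceInv.delete (h : TraceInv N K₁ K₂ A B c) (hNL : c.NL < K₁) (hKU : c.KU < K₁ + K₂)
    (h1 : c.entry c.KU c.NL ≠ .I) (h2 : c.entry c.KU c.NL ≠ .X)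
    (hr : ∀ r, c.KU < r → r < K₁ + K₂ → c.entry r c.NL = .I ∨ c.entry r c.NL = .X) :
    TraceInv N K₁ K₂ A B { c with T := c.T / 2, KU := c.KU + 1 } where
  stage := h.stage
  KL := h.KL
  NR := h.NR
  R₁ := h.R₁
  NL_le := h.NL_le
  le_KU := h.le_KU.trans (Nat.le_succ _)
  KU_le := hKU
  single := h.single.of_arr_eq fun _ _ => rfl
  supp r h3 h4 j hj := h.supp r (by dsimp at h3; omega) h4 j hj
  invol := h.invol.mono (Nat.le_succ _) le_rfl
  first := h.first
  T := by
    dsimp only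
    rw [h.T, show c.KU + 1 - K₁ = c.KU - K₁ + 1 by have := h.le_KU; omega, pow_succ]
    ring
  product := by
    have := h.single.delete hNL hKU h1 h2 hr
    rw [h.first] at this
    change _ = ((c.T / 2 : ℚ) : ℂ) • (A * proj (c.mat N) (c.KU + 1) _ * A)
    rw [h.product, this, smul_smul]
    push_cast
    rw [div_eq_mul_inv]

/-- Multiplication of the top row with the row `± X` of the first array. -/
theorem TraceInv.multiply (h : TraceInv N K₁ K₂ A B c) (hNL : c.NL < K₁) (hKU : c.KU < K₁ + K₂)
    (h1 : c.entry c.KU c.NL = .X)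
    (hr : ∀ r, c.KU < r → r < K₁ + K₂ → c.entry r c.NL = .I) :
    TraceInv N K₁ K₂ A B { c.mulRow N c.NL c.KU with NL := c.NL + 1 } := by
  have hle := h.le_KU
  obtain ⟨hinv, hproj⟩ := h.single.multiply hNL hKU (fun r h3 h4 => by
    rcases Nat.eq_or_lt_of_le h3 with rfl | h3'
    · exact Or.inr h1
    · exact Or.inl (hr r h3' h4)) h.invol
  have hsame : ∀ r < K₁, (c.mulRow N c.NL c.KU).arr r = c.arr r := fun r hr =>
    arr_mulRow_of_ne (by omega) _
  exact {
    stage := h.stage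
    KL := h.KL
    NR := h.NR
    R₁ := h.R₁
    NL_le := hNL
    le_KU := h.le_KU
    KU_le := h.KU_le
    single := h.single.of_arr_eq hsame
    supp := fun r h3 h4 j hj => by
      change (c.mulRow N c.NL c.KU).entry r j = _
      change c.KU ≤ r at h3
      change j < c.NL + 1 at hj
      rcases Nat.eq_or_lt_of_le h3 with rfl | h3'
      · rw [h.single.entry_mulRow hNL, h1]
        split_ifs with hj'
        · rfl
        · exact h.supp _ le_rfl h4 j (by omega)
      · rw [entry, arr_mulRow_of_ne (by omega)]
        by_cases hj' : j = c.NL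
        · subst hj'; exact hr r h3' h4
        · exact h.supp r h3 h4 j (by omega)
    invol := hinv
    first := by
      rw [← h.first]
      exact proj_congr fun r _ hr => by rw [mat, mat]; exact congrArg _ (hsame r hr)
    T := h.T
    product := by
      rw [h.first] at hproj
      change _ = (c.T : ℂ) • (A * proj ((c.mulRow N c.NL c.KU).mat N) c.KU _ * A)
      rw [hproj, h.product] }

theorem TraceInv.next (h : TraceInv N K₁ K₂ A B c) (hNL : c.NL < K₁)
    (hr : ∀ r, c.KU ≤ r → r < K₁ + K₂ → c.entry r c.NL = .I) :
    TraceInv N K₁ K₂ A B { c with NL := c.NL + 1 } :=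
  { h with
    NL_le := hNL
    single := h.single.of_arr_eq fun _ _ => rfl
    supp := fun r h1 h2 j hj => by
      change c.entry r j = _
      change j < c.NL + 1 at hj
      by_cases hj' : j = c.NL
      · subst hj'; exact hr r h1 h2
      · exact h.supp r h1 h2 j (by omega) }

theorem TraceInv.traceOne (h : TraceInv N K₁ K₂ A B c) (hNL : c.NL < K₁) {k : ℕ}
    (hk : c.first = some k) (hone : c.firstOther (c.entry k c.NL) = none) :
    TraceInv N K₁ K₂ A B (c.traceOne N k (c.entry k c.NL)) ∧
      (c.traceOne N k (c.entry k c.NL)).NL = c.NL + 1 ∧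
      (c.traceOne N k (c.entry k c.NL)).cost ≤ c.cost + 34 * (N + (K₁ + K₂) + 1) ^ 2 := by
  obtain ⟨hkr, hkI, -⟩ := first_eq_some hk
  obtain ⟨hRs, hsk⟩ := swapRows_top (N := N) hk
  have hKL := h.KL
  have hKU : c.KU < K₁ + K₂ := by omega
  unfold Config.traceOne
  generalize hσ : c.entry k c.NL = σ at *
  extract_lets c1 c2 c3
  have F1 : Frame (4 * (N + 1)) c c1 := frame_swapRows _ _ _ _
  have I1 : TraceInv N K₁ K₂ A B c1 := h.rowOp F1 hRs
  have col1 : ∀ r, c1.KU ≤ r → r < c1.KL → c1.entry r c1.NL = .I ∨ c1.entry r c1.NL = σ := by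
    intro r h1 h2
    change c.KU ≤ r at h1
    change r < c.KL at h2
    change c.entry (Equiv.swap k c.KU r) c.NL = _ ∨ c.entry (Equiv.swap k c.KU r) c.NL = _
    refine firstOther_eq_none hone ?_ ?_ <;>
      (rw [Equiv.swap_apply_def]; split_ifs <;> omega)
  have top1 : c1.entry c1.KU c1.NL = σ := by
    rw [← hσ, entry, entry]; exact congrArg (fun a : Row => a.op c.NL) hsk
  have hKU1 : c1.KU < c1.KL := by rw [F1.KU, F1.KL]; omega
  clear_value c1
  have F2 : Frame ((c1.KL - (c1.KU + 1)) * (3 * (N + 1) + 1)) c1 c2 := frame_clearOne _ _ _ _ _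
  obtain ⟨hR2, hlt2, hcl2⟩ : RowOp N c1.KU c1.KL c1 c2 ∧ (∀ r < c1.KU + 1, c2.arr r = c1.arr r) ∧
      ∀ r, c1.KU + 1 ≤ r → r < c1.KL → c2.entry r c1.NL = .I :=
    clearOne_spec le_rfl (Nat.lt_succ_self _) hKU1 top1
      fun r h1 h2 => col1 r (by omega) h2
  have I2 := I1.rowOp F2 hR2
  have hNL2 : c2.NL = c.NL := by rw [F2.NL, F1.NL]
  have hKU2 : c2.KU = c.KU := by rw [F2.KU, F1.KU]
  have top2 : c2.entry c2.KU c2.NL = σ := by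
    rw [F2.KU, F2.NL, ← top1, entry, entry, hlt2 _ (Nat.lt_succ_self _)]
  have rest2 : ∀ r, c2.KU < r → r < K₁ + K₂ → c2.entry r c2.NL = .I := fun r h1 h2 => by
    rw [F2.NL]; exact hcl2 r (by rw [← F2.KU]; exact h1) (by rw [I1.KL]; exact h2)
  have hc2 := (F1.trans F2).cost
  rw [I1.KL, F1.KU] at hc2
  clear_value c2
  have b1 : (K₁ + K₂ - (c.KU + 1)) * (3 * (N + 1) + 1) ≤
      (N + (K₁ + K₂) + 1) * (4 * (N + (K₁ + K₂) + 1)) := Nat.mul_le_mul (by omega) (by omega)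
  have b4 : N + (K₁ + K₂) + 1 ≤ (N + (K₁ + K₂) + 1) * (N + (K₁ + K₂) + 1) :=
    Nat.le_mul_of_pos_left _ (by omega)
  simp only [Nat.mul_left_comm _ 4] at b1
  -- An `X` is removed by multiplication with the row of the first array; a `Y` or `Z` makes the top
  -- row anticommute with that row, and the top row is deleted.
  by_cases hX : σ = .X
  · have e3 : c3 = c2.mulRow N c2.NL c2.KU := if_pos hX
    clear_value c3
    subst e3
    refine ⟨(I2.multiply (by rw [hNL2]; exact hNL) (by rw [hKU2]; exact hKU) (by rw [top2, hX])
      rest2).charge 1, congrArg (· + 1) hNL2, ?_⟩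
    change c2.cost + 3 * (N + 1) + 1 ≤ _
    rw [pow_two]; omega
  · have e3 : c3 = ({ c2 with T := c2.T / 2, KU := c2.KU + 1 } : Config).charge 2 := if_neg hX
    clear_value c3
    subst e3
    refine ⟨(((I2.delete (by rw [hNL2]; exact hNL) (by rw [hKU2]; exact hKU) (by rw [top2]; exact hkI)
      (by rw [top2]; exact hX) fun r h1 h2 => Or.inl (rest2 r h1 h2)).charge 2).next
      (by change c2.NL < _; rw [hNL2]; exact hNL) fun r h1 h2 => rest2 r h1 h2).charge 1,
      congrArg (· + 1) hNL2, ?_⟩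
    change c2.cost + 2 + 1 ≤ _
    rw [pow_two]; omega

theorem TraceInv.traceTwo (h : TraceInv N K₁ K₂ A B c) (hNL : c.NL < K₁) {k₁ k₂ : ℕ}
    (hk₁ : c.first = some k₁) (hk₂ : c.firstOther (c.entry k₁ c.NL) = some k₂) :
    TraceInv N K₁ K₂ A B (c.traceTwo N k₁ k₂ (c.entry k₁ c.NL) (c.entry k₂ c.NL)) ∧
      (c.traceTwo N k₁ k₂ (c.entry k₁ c.NL) (c.entry k₂ c.NL)).NL = c.NL + 1 ∧
      (c.traceTwo N k₁ k₂ (c.entry k₁ c.NL) (c.entry k₂ c.NL)).cost ≤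
        c.cost + 34 * (N + (K₁ + K₂) + 1) ^ 2 := by
  obtain ⟨-, hI1, -⟩ := first_eq_some hk₁
  obtain ⟨-, hI2, hne⟩ := firstOther_eq_some hk₂
  obtain ⟨hlt, hR2, htop, hsnd⟩ := swapRows_two (N := N) hk₁ hk₂
  rw [h.KL] at hlt
  unfold Config.traceTwo
  generalize hσ₁ : c.entry k₁ c.NL = σ₁ at *
  generalize hσ₂ : c.entry k₂ c.NL = σ₂ at *
  extract_lets c1 c2 c3 c4 c5
  have F2 : Frame (4 * (N + 1) + 4 * (N + 1)) c c2 :=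
    (frame_swapRows N _ _ _).trans (frame_swapRows N _ _ _)
  have I2 : TraceInv N K₁ K₂ A B c2 := h.rowOp F2 hR2
  have top2 : c2.entry c2.KU c2.NL = σ₁ := by
    rw [← hσ₁, entry, entry]; exact congrArg (fun a : Row => a.op c.NL) htop
  have snd2 : c2.entry (c2.KU + 1) c2.NL = σ₂ := by
    rw [← hσ₂, entry, entry]; exact congrArg (fun a : Row => a.op c.NL) hsnd
  have hlt2 : c2.KU + 1 < c2.KL := by rw [F2.KU, I2.KL]; exact hlt
  clear_value c2
  clear c1
  have F3 : Frame ((c2.KL - (c2.KU + 2)) * (6 * (N + 1) + 1)) c2 c3 := frame_clearTwo _ _ _ _ _ _ _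
  obtain ⟨hR3, hsame3, hcl3⟩ : RowOp N c2.KU c2.KL c2 c3 ∧ (∀ r < c2.KU + 2, c3.arr r = c2.arr r) ∧
      ∀ r, c2.KU + 2 ≤ r → r < c2.KL → c3.entry r c2.NL = .I :=
    clearTwo_spec le_rfl (by omega) (Nat.le_succ _) (by omega) hlt2 top2 snd2 hI1 hI2 hne.symm
  have I3 := I2.rowOp F3 hR3
  have top3 : c3.entry c3.KU c3.NL = σ₁ := by
    rw [F3.KU, F3.NL, ← top2, entry, entry, hsame3 _ (by omega)]
  have snd3 : c3.entry (c3.KU + 1) c3.NL = σ₂ := by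
    rw [F3.KU, F3.NL, ← snd2, entry, entry, hsame3 _ (by omega)]
  have rest3 : ∀ r, c3.KU + 2 ≤ r → r < K₁ + K₂ → c3.entry r c3.NL = .I := fun r h1 h2 => by
    rw [F3.NL]; exact hcl3 r (by rw [← F3.KU]; exact h1) (by rw [I2.KL]; exact h2)
  have hlt3 : c3.KU + 1 < c3.KL := by rw [F3.KU, F3.KL]; exact hlt2
  have hc3 := (F2.trans F3).cost
  rw [I2.KL, F2.KU] at hc3
  have hNL3 : c3.NL = c.NL := by rw [F3.NL, F2.NL]
  have hKU3 : c3.KU = c.KU := by rw [F3.KU, F2.KU]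
  clear_value c3
  -- All three branches end with `X` in the second row and `Y` or `Z` in the top row. If neither
  -- symbol is `X`, they are `Y` and `Z`, whose product is `X` up to a phase.
  have key : Frame (4 * (N + 1)) c3 c4 ∧ RowOp N c3.KU c3.KL c3 c4 ∧
      c4.entry c3.KU c3.NL ≠ .I ∧ c4.entry c3.KU c3.NL ≠ .X ∧
      c4.entry (c3.KU + 1) c3.NL = .X ∧
      ∀ r, c3.KU + 2 ≤ r → c4.arr r = c3.arr r := by
    by_cases hX1 : σ₁ = .X
    · have e4 : c4 = c3.swapRows N c3.KU (c3.KU + 1) := if_pos hX1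
      have t4 : c4.entry c3.KU c3.NL = σ₂ := by
        rw [e4, ← snd3]
        exact congrArg (fun r => c3.entry r c3.NL) (Equiv.swap_apply_left _ _)
      have s4 : c4.entry (c3.KU + 1) c3.NL = σ₁ := by
        rw [e4, ← top3]
        exact congrArg (fun r => c3.entry r c3.NL) (Equiv.swap_apply_right _ _)
      rw [t4, s4, e4]
      refine ⟨frame_swapRows _ _ _ _, rowOp_swapRows (by omega) (by omega) _, hI2, ?_, hX1,
        fun r hr => ?_⟩
      · rw [← hX1]; exact hne
      · exact congrArg c3.arr (Equiv.swap_apply_of_ne_of_ne (by omega) (by omega))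
    · by_cases hX2 : σ₂ = .X
      · have e4 : c4 = c3 := (if_neg hX1).trans (if_pos hX2)
        rw [e4, top3, snd3]
        exact ⟨Frame.refl _ _, RowOp.of_arr_eq rfl, hI1, hX1, hX2, fun _ _ => rfl⟩
      · have e4 : c4 = c3.mulRow N c3.KU (c3.KU + 1) := (if_neg hX1).trans (if_neg hX2)
        rw [e4, entry_mulRow_self, top3, snd3, entry, arr_mulRow_of_ne (by omega), ← entry, top3]
        refine ⟨(frame_mulRow _ _ _ _).mono (by omega),
          rowOp_mulRow (by omega) (by omega) (by omega) _, hI1, hX1, ?_,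
          fun r hr => arr_mulRow_of_ne (by omega) _⟩
        clear_value c4
        clear e4
        revert hI1 hI2 hne hX1 hX2
        clear * -
        cases σ₁ <;> cases σ₂ <;> simp [Pauli.mul]
  obtain ⟨F4, hR4, t4, t4', s4, same4⟩ := key
  have I4 := I3.rowOp F4 hR4
  rw [← F4.KU, ← F4.NL] at t4 t4' s4
  have rest4 : ∀ r, c4.KU + 2 ≤ r → r < K₁ + K₂ → c4.entry r c4.NL = .I := fun r h1 h2 => by
    rw [F4.KU] at h1
    rw [entry, same4 r h1, F4.NL]
    exact rest3 r h1 h2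
  have hNL4 : c4.NL = c.NL := by rw [F4.NL, hNL3]
  have hKU4 : c4.KU = c.KU := by rw [F4.KU, hKU3]
  have hc4 := F4.cost
  clear_value c4
  -- The algorithm multiplies before it deletes; here the order is reversed, with the same resulting
  -- configuration. Without the top row, which anticommutes with the row of the first array, all
  -- active rows commute with that row, as the multiplication requires.
  have Id := I4.delete (by rw [hNL4]; exact hNL) (by rw [hKU4]; omega) t4 t4' fun r h1 h2 => by
    by_cases hr : r = c4.KU + 1
    · exact Or.inr (by rw [hr]; exact s4)
    · exact Or.inl (rest4 r (by omega) h2)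
  have Im := Id.multiply (by change c4.NL < _; rw [hNL4]; exact hNL)
    (by change c4.KU + 1 < _; rw [hKU4]; exact hlt) s4 fun r h1 h2 => rest4 r h1 h2
  refine ⟨Im.charge 3, congrArg (· + 1) hNL4, ?_⟩
  change c4.cost + 3 * (N + 1) + 3 ≤ _
  have b1 : (K₁ + K₂ - (c.KU + 2)) * (6 * (N + 1) + 1) ≤
      (N + (K₁ + K₂) + 1) * (7 * (N + (K₁ + K₂) + 1)) := Nat.mul_le_mul (by omega) (by omega)
  have b4 : N + (K₁ + K₂) + 1 ≤ (N + (K₁ + K₂) + 1) * (N + (K₁ + K₂) + 1) :=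
    Nat.le_mul_of_pos_left _ (by omega)
  simp only [Nat.mul_left_comm _ 7] at b1
  rw [pow_two]; omega

theorem TraceInv.step (h : TraceInv N K₁ K₂ A B c) (hA : c.Active) :
    TraceInv N K₁ K₂ A B (c.step K₁ K₂ N) ∧
      (c.step K₁ K₂ N).NR - (c.step K₁ K₂ N).NL < c.NR - c.NL ∧
      (c.step K₁ K₂ N).cost ≤ c.cost + 36 * (N + (K₁ + K₂) + 1) ^ 2 := by
  have hNL : c.NL < c.NR := hA.1
  have hcost : (c.charge (2 * (c.KL - c.KU))).cost ≤ c.cost + 2 * (K₁ + K₂) := by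
    change c.cost + 2 * (c.KL - c.KU) ≤ _
    rw [h.KL]; omega
  have hI := h.charge (2 * (c.KL - c.KU))
  have hNL' : (c.charge (2 * (c.KL - c.KU))).NL = c.NL := rfl
  have b4 : N + (K₁ + K₂) + 1 ≤ (N + (K₁ + K₂) + 1) ^ 2 := Nat.le_self_pow (by omega) _
  rw [Config.step, h.stage]
  dsimp only
  rw [traceStep, if_pos hA]
  rw [h.NR] at hNL ⊢
  extract_lets c'
  change TraceInv N K₁ K₂ A B c' at hI
  change c'.cost ≤ _ at hcost
  change c'.NL = _ at hNL'
  clear_value c'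
  have hlt : c'.NL < K₁ := by rw [hNL']; exact hNL
  split
  · next hnone =>
    refine ⟨(hI.next hlt fun r h1 h2 =>
      first_eq_none hnone h1 (by rw [hI.KL]; exact h2)).charge 1, ?_, ?_⟩
    · change c'.NR - (c'.NL + 1) < _
      rw [hI.NR]; omega
    · change c'.cost + 1 ≤ _
      omega
  · next k₁ hk₁ =>
    split
    · next hnone =>
      obtain ⟨I, h1, h2⟩ := hI.traceOne hlt hk₁ hnone
      exact ⟨I, by rw [I.NR, h1]; omega, by omega⟩
    · next k₂ hk₂ =>
      obtain ⟨I, h1, h2⟩ := hI.traceTwo hlt hk₁ hk₂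
      exact ⟨I, by rw [I.NR, h1]; omega, by omega⟩

theorem TraceInv.exists_eliminated (h : TraceInv N K₁ K₂ A B c) :
    ∃ n, TraceInv N K₁ K₂ A B ((Config.step K₁ K₂ N)^[n] c) ∧
      ¬ ((Config.step K₁ K₂ N)^[n] c).Active ∧
      ((Config.step K₁ K₂ N)^[n] c).cost ≤
        c.cost + N * (36 * (N + (K₁ + K₂) + 1) ^ 2) := by
  obtain ⟨n, hn, hA, hc⟩ := exists_iterate (Config.step K₁ K₂ N) (TraceInv N K₁ K₂ A B) Active
    (fun c => c.NR - c.NL) Config.cost (36 * (N + (K₁ + K₂) + 1) ^ 2)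
    (fun d hd ha => hd.step ha) c h
  refine ⟨n, hn, hA, hc.trans (Nat.add_le_add_left (Nat.mul_le_mul_right _ ?_) _)⟩
  have := h.single.le
  rw [h.NR]; omega

end

end Config

/-! ### Echelon form of the remaining block and the final result -/

namespace Config

/-- The invariant of the reduction to echelon form; `D` is the first row that takes part in it. -/
structure RrefInv (N K₁ K₂ D : ℕ) (A B : Op N) (c : Config) : Prop where
  stage : c.stage = .rref
  KL : c.KL = K₁ + K₂
  NR : c.NR = N
  R₁ : c.R₁ = K₁
  le_NL : K₁ ≤ c.NL
  NL_le : c.NL ≤ N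
  le_D : K₁ ≤ D
  D_le : D ≤ c.KU
  KU_le : c.KU ≤ K₁ + K₂
  R₂ : c.R₂ = c.KU - D
  single : Single N K₁ c
  low : ∀ r, D ≤ r → r < K₁ + K₂ → ∀ j < K₁, c.entry r j = .I
  supp : ∀ r, c.KU ≤ r → r < K₁ + K₂ → ∀ j < c.NL, c.entry r j = .I
  invol : InvolFamily (c.mat N) D (K₁ + K₂)
  first : proj (c.mat N) 0 K₁ = A
  T : c.T = (1 / 2) ^ (D - K₁)
  product : A * B * A = (c.T : ℂ) • (A * proj (c.mat N) D (K₁ + K₂) * A)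
  trace : TraceScalar (K₁ + (c.KU - D)) c.NL (A * proj (c.mat N) D c.KU)

section

variable {N K₁ K₂ D m : ℕ} {A B : Op N} {c d : Config}

theorem RrefInv.rowOp (h : RrefInv N K₁ K₂ D A B c) (hF : Frame m c d)
    (hR : RowOp N c.KU c.KL c d) : RrefInv N K₁ K₂ D A B d := by
  rw [h.KL] at hR
  have hle := h.D_le
  have hle' := h.le_D
  have hsame : ∀ r < c.KU, d.arr r = c.arr r := fun r hr => hR.outside r (by omega)
  exact {
    stage := hF.stage.trans h.stage
    KL := hF.KL.trans h.KL
    NR := hF.NR.trans h.NR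
    R₁ := hF.R₁.trans h.R₁
    le_NL := by rw [hF.NL]; exact h.le_NL
    NL_le := by rw [hF.NL]; exact h.NL_le
    le_D := h.le_D
    D_le := by rw [hF.KU]; exact h.D_le
    KU_le := by rw [hF.KU]; exact h.KU_le
    R₂ := by rw [hF.R₂, hF.KU, h.R₂]
    single := h.single.of_arr_eq fun r hr => hsame r (by omega)
    low := fun r h1 h2 j hj => by
      rcases lt_or_ge r c.KU with h3 | h3
      · rw [entry, hsame r h3]; exact h.low r h1 h2 j hj
      · exact hR.col j (fun s h4 h5 => h.low s (by omega) h5 j hj) r h3 h2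
    supp := by
      rw [hF.KU, hF.NL]
      exact fun r h1 h2 j hj => hR.col j (fun s h3 h4 => h.supp s h3 h4 j hj) r h1 h2
    invol := hR.involFamily hle h.invol
    first := by
      rw [← h.first]
      exact proj_congr fun r _ hr => by rw [mat, hsame r (by omega), mat]
    T := by rw [hF.T, h.T]
    product := by rw [hF.T, hR.proj_eq hle h.KU_le h.invol, h.product]
    trace := by
      rw [hF.KU, hF.NL, proj_congr (g := c.mat N) fun r _ hr => by rw [mat, hsame r hr, mat]]
      exact h.trace }

theorem RrefInv.charge (h : RrefInv N K₁ K₂ D A B c) (n : ℕ) :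
    RrefInv N K₁ K₂ D A B (c.charge n) :=
  h.rowOp (frame_charge n c) (RowOp.of_arr_eq rfl)

theorem RrefInv.next (h : RrefInv N K₁ K₂ D A B c) (hNL : c.NL < N)
    (hr : ∀ r, c.KU ≤ r → r < K₁ + K₂ → c.entry r c.NL = .I) :
    RrefInv N K₁ K₂ D A B { c with NL := c.NL + 1 } :=
  { h with
    le_NL := h.le_NL.trans (Nat.le_succ _)
    NL_le := hNL
    single := h.single.of_arr_eq fun _ _ => rfl
    supp := fun r h1 h2 j hj => by
      change c.entry r j = _
      change j < c.NL + 1 at hj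
      by_cases hj' : j = c.NL
      · subst hj'; exact hr r h1 h2
      · exact h.supp r h1 h2 j (by omega)
    trace := h.trace.mono (Nat.le_succ _) }

/-- Unlike in the elimination, the deleted row stays a factor of the product and `T` is unchanged.
It only passes to the pivot rows, whose trace is recorded. -/
theorem RrefInv.delete_one (h : RrefInv N K₁ K₂ D A B c) (hNL : c.NL < N) (hKU : c.KU < K₁ + K₂)
    (h1 : c.entry c.KU c.NL ≠ .I)
    (hr : ∀ r, c.KU < r → r < K₁ + K₂ → c.entry r c.NL = .I) :
    RrefInv N K₁ K₂ D A B { c with KU := c.KU + 1, NL := c.NL + 1, R₂ := c.R₂ + 1 } := by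
  have hle := h.D_le
  have hs : c.KU + 1 - D = c.KU - D + 1 := by omega
  exact { h with
    le_NL := h.le_NL.trans (Nat.le_succ _)
    NL_le := hNL
    D_le := hle.trans (Nat.le_succ _)
    KU_le := hKU
    R₂ := by dsimp only; rw [hs, h.R₂]
    single := h.single.of_arr_eq fun _ _ => rfl
    supp := fun r h3 h4 j hj => by
      change c.entry r j = _
      change j < c.NL + 1 at hj
      change c.KU + 1 ≤ r at h3
      by_cases hj' : j = c.NL
      · subst hj'; exact hr r h3 h4
      · exact h.supp r (by omega) h4 j (by omega)
    trace := by
      change TraceScalar (K₁ + (c.KU + 1 - D)) (c.NL + 1) (A * proj (c.mat N) D (c.KU + 1))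
      rw [hs, proj_succ_right hle, ← mul_assoc]
      exact h.trace.mul_half_one_add hNL (fun j hj => h.supp _ le_rfl hKU j hj) h1 }

theorem RrefInv.delete_two (h : RrefInv N K₁ K₂ D A B c) (hNL : c.NL < N)
    (hKU : c.KU + 1 < K₁ + K₂) (h1 : c.entry c.KU c.NL ≠ .I) (h2 : c.entry (c.KU + 1) c.NL ≠ .I)
    (h12 : c.entry c.KU c.NL ≠ c.entry (c.KU + 1) c.NL)
    (hr : ∀ r, c.KU + 2 ≤ r → r < K₁ + K₂ → c.entry r c.NL = .I) :
    RrefInv N K₁ K₂ D A B { c with KU := c.KU + 2, NL := c.NL + 1, R₂ := c.R₂ + 2 } := by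
  have hle := h.D_le
  have hs : c.KU + 2 - D = c.KU - D + 2 := by omega
  exact { h with
    le_NL := h.le_NL.trans (Nat.le_succ _)
    NL_le := hNL
    D_le := hle.trans (Nat.le_add_right _ _)
    KU_le := hKU
    R₂ := by dsimp only; rw [hs, h.R₂]
    single := h.single.of_arr_eq fun _ _ => rfl
    supp := fun r h3 h4 j hj => by
      change c.entry r j = _
      change j < c.NL + 1 at hj
      change c.KU + 2 ≤ r at h3
      by_cases hj' : j = c.NL
      · subst hj'; exact hr r h3 h4
      · exact h.supp r (by omega) h4 j (by omega)
    trace := by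
      change TraceScalar (K₁ + (c.KU + 2 - D)) (c.NL + 1) (A * proj (c.mat N) D (c.KU + 1 + 1))
      rw [hs, proj_succ_right (by omega), proj_succ_right hle, ← mul_assoc, ← mul_assoc]
      exact h.trace.mul_half_one_add_two hNL (fun j hj => h.supp _ le_rfl (by omega) j hj) h1
        (fun j hj => h.supp _ (Nat.le_succ _) hKU j hj) h2 h12 }

theorem RrefInv.rrefOne (h : RrefInv N K₁ K₂ D A B c) (hNL : c.NL < N) {k : ℕ}
    (hk : c.first = some k) (hone : c.firstOther (c.entry k c.NL) = none) :
    RrefInv N K₁ K₂ D A B (c.rrefOne N k (c.entry k c.NL)) ∧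
      (c.rrefOne N k (c.entry k c.NL)).NL = c.NL + 1 ∧
      (c.rrefOne N k (c.entry k c.NL)).cost ≤ c.cost + 34 * (N + (K₁ + K₂) + 1) ^ 2 := by
  obtain ⟨hkr, hkI, -⟩ := first_eq_some hk
  obtain ⟨hRs, hsk⟩ := swapRows_top (N := N) hk
  have hKL := h.KL
  have hKU : c.KU < K₁ + K₂ := by omega
  unfold Config.rrefOne
  generalize hσ : c.entry k c.NL = σ at *
  extract_lets c1 c2
  have F1 : Frame (4 * (N + 1)) c c1 := frame_swapRows _ _ _ _
  have I1 : RrefInv N K₁ K₂ D A B c1 := h.rowOp F1 hRs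
  have col1 : ∀ r, c1.KU ≤ r → r < c1.KL → c1.entry r c1.NL = .I ∨ c1.entry r c1.NL = σ := by
    intro r h1 h2
    change c.KU ≤ r at h1
    change r < c.KL at h2
    change c.entry (Equiv.swap k c.KU r) c.NL = _ ∨ c.entry (Equiv.swap k c.KU r) c.NL = _
    refine firstOther_eq_none hone ?_ ?_ <;>
      (rw [Equiv.swap_apply_def]; split_ifs <;> omega)
  have top1 : c1.entry c1.KU c1.NL = σ := by
    rw [← hσ, entry, entry]; exact congrArg (fun a : Row => a.op c.NL) hsk
  have hKU1 : c1.KU < c1.KL := by rw [F1.KU, F1.KL]; omega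
  clear_value c1
  have F2 : Frame ((c1.KL - (c1.KU + 1)) * (3 * (N + 1) + 1)) c1 c2 := frame_clearOne _ _ _ _ _
  obtain ⟨hR2, hlt2, hcl2⟩ : RowOp N c1.KU c1.KL c1 c2 ∧ (∀ r < c1.KU + 1, c2.arr r = c1.arr r) ∧
      ∀ r, c1.KU + 1 ≤ r → r < c1.KL → c2.entry r c1.NL = .I :=
    clearOne_spec le_rfl (Nat.lt_succ_self _) hKU1 top1
      fun r h1 h2 => col1 r (by omega) h2
  have I2 := I1.rowOp F2 hR2
  have hNL2 : c2.NL = c.NL := by rw [F2.NL, F1.NL]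
  have hKU2 : c2.KU = c.KU := by rw [F2.KU, F1.KU]
  have top2 : c2.entry c2.KU c2.NL = σ := by
    rw [F2.KU, F2.NL, ← top1, entry, entry, hlt2 _ (Nat.lt_succ_self _)]
  have rest2 : ∀ r, c2.KU < r → r < K₁ + K₂ → c2.entry r c2.NL = .I := fun r h1 h2 => by
    rw [F2.NL]; exact hcl2 r (by rw [← F2.KU]; exact h1) (by rw [I1.KL]; exact h2)
  have hc2 := (F1.trans F2).cost
  rw [I1.KL, F1.KU] at hc2
  clear_value c2
  have b1 : (K₁ + K₂ - (c.KU + 1)) * (3 * (N + 1) + 1) ≤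
      (N + (K₁ + K₂) + 1) * (4 * (N + (K₁ + K₂) + 1)) := Nat.mul_le_mul (by omega) (by omega)
  have b4 : N + (K₁ + K₂) + 1 ≤ (N + (K₁ + K₂) + 1) * (N + (K₁ + K₂) + 1) :=
    Nat.le_mul_of_pos_left _ (by omega)
  simp only [Nat.mul_left_comm _ 4] at b1
  refine ⟨(I2.delete_one (by rw [hNL2]; exact hNL) (by rw [hKU2]; exact hKU)
    (by rw [top2]; exact hkI) rest2).charge 3, congrArg (· + 1) hNL2, ?_⟩
  change c2.cost + 3 ≤ _
  rw [pow_two]; omega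

theorem RrefInv.rrefTwo (h : RrefInv N K₁ K₂ D A B c) (hNL : c.NL < N) {k₁ k₂ : ℕ}
    (hk₁ : c.first = some k₁) (hk₂ : c.firstOther (c.entry k₁ c.NL) = some k₂) :
    RrefInv N K₁ K₂ D A B (c.rrefTwo N k₁ k₂ (c.entry k₁ c.NL) (c.entry k₂ c.NL)) ∧
      (c.rrefTwo N k₁ k₂ (c.entry k₁ c.NL) (c.entry k₂ c.NL)).NL = c.NL + 1 ∧
      (c.rrefTwo N k₁ k₂ (c.entry k₁ c.NL) (c.entry k₂ c.NL)).cost ≤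
        c.cost + 34 * (N + (K₁ + K₂) + 1) ^ 2 := by
  obtain ⟨-, hI1, -⟩ := first_eq_some hk₁
  obtain ⟨-, hI2, hne⟩ := firstOther_eq_some hk₂
  obtain ⟨hlt, hR2, htop, hsnd⟩ := swapRows_two (N := N) hk₁ hk₂
  rw [h.KL] at hlt
  unfold Config.rrefTwo
  generalize hσ₁ : c.entry k₁ c.NL = σ₁ at *
  generalize hσ₂ : c.entry k₂ c.NL = σ₂ at *
  extract_lets c1 c2 c3
  have F2 : Frame (4 * (N + 1) + 4 * (N + 1)) c c2 :=
    (frame_swapRows N _ _ _).trans (frame_swapRows N _ _ _)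
  have I2 : RrefInv N K₁ K₂ D A B c2 := h.rowOp F2 hR2
  have top2 : c2.entry c2.KU c2.NL = σ₁ := by
    rw [← hσ₁, entry, entry]; exact congrArg (fun a : Row => a.op c.NL) htop
  have snd2 : c2.entry (c2.KU + 1) c2.NL = σ₂ := by
    rw [← hσ₂, entry, entry]; exact congrArg (fun a : Row => a.op c.NL) hsnd
  have hlt2 : c2.KU + 1 < c2.KL := by rw [F2.KU, I2.KL]; exact hlt
  clear_value c2
  clear c1
  have F3 : Frame ((c2.KL - (c2.KU + 2)) * (6 * (N + 1) + 1)) c2 c3 := frame_clearTwo _ _ _ _ _ _ _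
  obtain ⟨hR3, hsame3, hcl3⟩ : RowOp N c2.KU c2.KL c2 c3 ∧ (∀ r < c2.KU + 2, c3.arr r = c2.arr r) ∧
      ∀ r, c2.KU + 2 ≤ r → r < c2.KL → c3.entry r c2.NL = .I :=
    clearTwo_spec le_rfl (by omega) (Nat.le_succ _) (by omega) hlt2 top2 snd2 hI1 hI2 hne.symm
  have I3 := I2.rowOp F3 hR3
  have top3 : c3.entry c3.KU c3.NL = σ₁ := by
    rw [F3.KU, F3.NL, ← top2, entry, entry, hsame3 _ (by omega)]
  have snd3 : c3.entry (c3.KU + 1) c3.NL = σ₂ := by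
    rw [F3.KU, F3.NL, ← snd2, entry, entry, hsame3 _ (by omega)]
  have rest3 : ∀ r, c3.KU + 2 ≤ r → r < K₁ + K₂ → c3.entry r c3.NL = .I := fun r h1 h2 => by
    rw [F3.NL]; exact hcl3 r (by rw [← F3.KU]; exact h1) (by rw [I2.KL]; exact h2)
  have hc3 := (F2.trans F3).cost
  rw [I2.KL, F2.KU] at hc3
  have hNL3 : c3.NL = c.NL := by rw [F3.NL, F2.NL]
  have hKU3 : c3.KU = c.KU := by rw [F3.KU, F2.KU]
  clear_value c3
  have b1 : (K₁ + K₂ - (c.KU + 2)) * (6 * (N + 1) + 1) ≤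
      (N + (K₁ + K₂) + 1) * (7 * (N + (K₁ + K₂) + 1)) := Nat.mul_le_mul (by omega) (by omega)
  have b4 : N + (K₁ + K₂) + 1 ≤ (N + (K₁ + K₂) + 1) * (N + (K₁ + K₂) + 1) :=
    Nat.le_mul_of_pos_left _ (by omega)
  simp only [Nat.mul_left_comm _ 7] at b1
  refine ⟨(I3.delete_two (by rw [hNL3]; exact hNL) (by rw [hKU3]; exact hlt)
    (by rw [top3]; exact hI1) (by rw [snd3]; exact hI2) (by rw [top3, snd3]; exact hne.symm)
    rest3).charge 3, congrArg (· + 1) hNL3, ?_⟩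
  change c3.cost + 3 ≤ _
  rw [pow_two]; omega

theorem RrefInv.step (h : RrefInv N K₁ K₂ D A B c) (hA : c.Active) :
    RrefInv N K₁ K₂ D A B (c.step K₁ K₂ N) ∧
      (c.step K₁ K₂ N).NR - (c.step K₁ K₂ N).NL < c.NR - c.NL ∧
      (c.step K₁ K₂ N).cost ≤ c.cost + 36 * (N + (K₁ + K₂) + 1) ^ 2 := by
  have hNL : c.NL < c.NR := hA.1
  have hcost : (c.charge (2 * (c.KL - c.KU))).cost ≤ c.cost + 2 * (K₁ + K₂) := by
    change c.cost + 2 * (c.KL - c.KU) ≤ _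
    rw [h.KL]; omega
  have hI := h.charge (2 * (c.KL - c.KU))
  have hNL' : (c.charge (2 * (c.KL - c.KU))).NL = c.NL := rfl
  have b4 : N + (K₁ + K₂) + 1 ≤ (N + (K₁ + K₂) + 1) ^ 2 := Nat.le_self_pow (by omega) _
  rw [Config.step, h.stage]
  dsimp only
  rw [rrefStep, if_pos hA]
  rw [h.NR] at hNL ⊢
  extract_lets c'
  change RrefInv N K₁ K₂ D A B c' at hI
  change c'.cost ≤ _ at hcost
  change c'.NL = _ at hNL'
  clear_value c'
  have hlt : c'.NL < N := by rw [hNL']; exact hNL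
  split
  · next hnone =>
    refine ⟨(hI.next hlt fun r h1 h2 =>
      first_eq_none hnone h1 (by rw [hI.KL]; exact h2)).charge 1, ?_, ?_⟩
    · change c'.NR - (c'.NL + 1) < _
      rw [hI.NR]; omega
    · change c'.cost + 1 ≤ _
      omega
  · next k₁ hk₁ =>
    split
    · next hnone =>
      obtain ⟨I, h1, h2⟩ := hI.rrefOne hlt hk₁ hnone
      exact ⟨I, by rw [I.NR, h1]; omega, by omega⟩
    · next k₂ hk₂ =>
      obtain ⟨I, h1, h2⟩ := hI.rrefTwo hlt hk₁ hk₂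
      exact ⟨I, by rw [I.NR, h1]; omega, by omega⟩

theorem RrefInv.exists_echelonForm (h : RrefInv N K₁ K₂ D A B c) :
    ∃ n, RrefInv N K₁ K₂ D A B ((Config.step K₁ K₂ N)^[n] c) ∧
      ¬ ((Config.step K₁ K₂ N)^[n] c).Active ∧
      ((Config.step K₁ K₂ N)^[n] c).cost ≤
        c.cost + N * (36 * (N + (K₁ + K₂) + 1) ^ 2) := by
  obtain ⟨n, hn, hA, hc⟩ := exists_iterate (Config.step K₁ K₂ N) (RrefInv N K₁ K₂ D A B) Active
    (fun c => c.NR - c.NL) Config.cost (36 * (N + (K₁ + K₂) + 1) ^ 2)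
    (fun d hd ha => hd.step ha) c h
  refine ⟨n, hn, hA, hc.trans (Nat.add_le_add_left (Nat.mul_le_mul_right _ ?_) _)⟩
  rw [h.NR]; omega

/-- The passage from the elimination to the reduction to echelon form. -/
theorem TraceInv.rrefInv (h : TraceInv N K₁ K₂ A B c) (hA : ¬ c.Active) :
    RrefInv N K₁ K₂ c.KU A B (c.step K₁ K₂ N) ∧
      (c.step K₁ K₂ N).cost = c.cost + 3 := by
  rw [Config.step, h.stage]
  dsimp only
  rw [traceStep, if_neg hA]
  -- The elimination stops when columns or rows run out: in the first case the columns up to `K₁`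
  -- are cleared, in the second no row is left to be checked.
  have hlow : ∀ r, c.KU ≤ r → r < K₁ + K₂ → ∀ j < K₁, c.entry r j = .I := fun r h1 h2 j hj => by
    have := h.KL
    have := h.NR
    have : ¬ (c.NL < c.NR ∧ c.KU < c.KL) := hA
    exact h.supp r h1 h2 j (by omega)
  refine ⟨⟨rfl, h.KL, rfl, h.R₁, h.R₁.ge, ?_, h.le_KU, le_rfl, h.KU_le, (Nat.sub_self _).symm,
    h.single.of_arr_eq fun _ _ => rfl, hlow, fun r h1 h2 j hj => ?_, h.invol, h.first, h.T,
    h.product, ?_⟩, rfl⟩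
  · change c.R₁ ≤ N
    rw [h.R₁]; exact h.single.le
  · change j < c.R₁ at hj
    rw [h.R₁] at hj
    exact hlow r h1 h2 j hj
  · change TraceScalar (K₁ + (c.KU - c.KU)) c.R₁ (A * proj (c.mat N) c.KU c.KU)
    rw [Nat.sub_self, proj_of_le le_rfl, mul_one, h.R₁, ← h.first]
    exact traceScalar_single h.single.le h.single.entry

/-- The configuration in which the normal form of the rows of the first array and of the rows
deleted in the reduction to echelon form is computed. -/
def rankConfig (N K₁ D R : ℕ) (c : Config) : Config where
  stage := .cnf
  arr r :=
    let a := c.arr (if r < K₁ then r else r - K₁ + D)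
    -- The cut at column `N` does not affect the operators; it is made because `CnfInv` demands
    -- trivial entries in all columns `≥ N`, which `RrefInv` does not record.
    ⟨a.phase, fun j => if j < N then a.op j else .I⟩
  KU := K₁
  KL := K₁ + R
  NL := K₁
  NR := N
  R₁ := 0
  R₂ := 0
  T := 1
  C := 1
  cost := 0

theorem mat_rankConfig (D R r : ℕ) (c : Config) :
    (c.rankConfig N K₁ D R).mat N r = c.mat N (if r < K₁ then r else r - K₁ + D) := by
  simp [mat, rankConfig, Row.toMatrix]

theorem RrefInv.commute_first (h : RrefInv N K₁ K₂ D A B c) {r : ℕ} (h1 : D ≤ r)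
    (h2 : r < K₁ + K₂) : Commute A (c.mat N r) := by
  rw [← h.first]
  exact (commute_proj fun s _ hs =>
    (h.single.commute hs (Or.inl (h.low r h1 h2 s hs))).symm).symm

/-- The `K₁` rows `± X_r` count as finished and the pivot rows are the active ones. They commute
with the former because they are trivial on the first `K₁` columns, so the reduction can resume from
there without disturbing the normal form of the first array. -/
theorem RrefInv.rankConfig (h : RrefInv N K₁ K₂ D A B c) :
    CnfInv N K₁ (K₁ + c.R₂) K₁ N ((c.rankConfig N K₁ D c.R₂).mat N)
      (c.rankConfig N K₁ D c.R₂) := by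
  have hR := h.R₂
  have hD := h.D_le
  have hKU := h.KU_le
  have hD' := h.le_D
  have e1 : ∀ r < K₁, (c.rankConfig N K₁ D c.R₂).mat N r = c.mat N r := fun r hr => by
    rw [mat_rankConfig, if_pos hr]
  have e2 : ∀ r, K₁ ≤ r → (c.rankConfig N K₁ D c.R₂).mat N r = c.mat N (r - K₁ + D) :=
    fun r hr => by rw [mat_rankConfig, if_neg (by omega)]
  refine ⟨rfl, rfl, rfl, rfl, rfl, le_rfl, Nat.le_add_right _ _, h.single.le, le_rfl,
    fun r hr j => ?_, fun r h1 h2 j hj => ?_, ⟨fun r s _ h1 _ h2 => ?_, fun r _ h1 => ?_⟩,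
    1, one_mem _, by simp, by simp⟩
  · have := h.single.entry r hr j
    have hN := h.single.le
    simp only [entry, Config.rankConfig, if_pos hr] at this ⊢
    split_ifs at this ⊢ with h1 h2 <;> first | exact this | omega | rfl
  · simp only [entry, Config.rankConfig, if_neg (show ¬ r < K₁ by omega)]
    split_ifs with h3
    · exact h.low _ (by omega) (by omega) j (by omega)
    · rfl
  · rcases lt_or_ge r K₁ with hr | hr <;> rcases lt_or_ge s K₁ with hs | hs
    · rw [e1 r hr, e1 s hs]
      exact h.single.involFamily.comm r s (Nat.zero_le _) hr (Nat.zero_le _) hs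
    · rw [e1 r hr, e2 s hs]
      exact h.single.commute hr (Or.inl (h.low _ (by omega) (by omega) r hr))
    · rw [e2 r hr, e1 s hs]
      exact (h.single.commute hs (Or.inl (h.low _ (by omega) (by omega) s hs))).symm
    · rw [e2 r hr, e2 s hs]
      exact h.invol.comm _ _ (by omega) (by omega) (by omega) (by omega)
  · rcases lt_or_ge r K₁ with hr | hr
    · rw [e1 r hr]; exact h.single.invol r hr
    · rw [e2 r hr]; exact h.invol.invol _ (by omega) (by omega)

theorem proj_rankConfig_first (h : proj (c.mat N) 0 K₁ = A) (R : ℕ) :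
    proj ((c.rankConfig N K₁ D R).mat N) 0 K₁ = A := by
  rw [← h]
  exact proj_congr fun r _ hr => by rw [mat_rankConfig, if_pos hr]

theorem proj_rankConfig (h : proj (c.mat N) 0 K₁ = A) (R : ℕ) :
    proj ((c.rankConfig N K₁ D R).mat N) 0 (K₁ + R) = A * proj (c.mat N) D (D + R) := by
  rw [← proj_mul_proj (Nat.zero_le K₁) (Nat.le_add_right K₁ R), proj_rankConfig_first h]
  congr 1
  induction R with
  | zero => rw [proj_of_le (by simp), proj_of_le (by simp)]
  | succ R ih =>
    have e : proj ((c.rankConfig N K₁ D (R + 1)).mat N) K₁ (K₁ + R) =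
        proj ((c.rankConfig N K₁ D R).mat N) K₁ (K₁ + R) :=
      proj_congr fun r _ _ => by rw [mat_rankConfig, mat_rankConfig]
    rw [← add_assoc, ← add_assoc, proj_succ_right (by omega), proj_succ_right (by omega), e, ih,
      mat_rankConfig, if_neg (by omega), Nat.add_sub_cancel_left, Nat.add_comm R D]

/-- The result of the end game. -/
theorem RrefInv.finish (h : RrefInv N K₁ K₂ D A B c) (hA : ¬ c.Active) :
    (c.step K₁ K₂ N).stage = .halt ∧ (c.step K₁ K₂ N).R₁ = K₁ ∧
      (c.step K₁ K₂ N).cost ≤ c.cost + (N + (K₁ + K₂) + 3) ∧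
      (c.step K₁ K₂ N).R₂ ≤ K₂ ∧ K₁ + (c.step K₁ K₂ N).R₂ ≤ N ∧
      (c.step K₁ K₂ N).C = 2 ^ (N - K₁ - (c.step K₁ K₂ N).R₂) ∧
      ((c.step K₁ K₂ N).T = 0 ∨ ∃ j, (c.step K₁ K₂ N).R₂ + j ≤ K₂ ∧
        (c.step K₁ K₂ N).T = (1 / 2 : ℚ) ^ j) ∧
      ∃ U ∈ cliffordCircuits N, ∃ s : Fin N → ℤˣ, U * A * star U = tensorProj s K₁ ∧
        U * (A * B * A) * star U =
          ((c.step K₁ K₂ N).T : ℂ) • tensorProj s (K₁ + (c.step K₁ K₂ N).R₂) := by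
  have hR := h.R₂
  have hD := h.D_le
  have hKU := h.KU_le
  have hD' := h.le_D
  have hKL := h.KL
  obtain ⟨T', hT'⟩ : ∃ T' : ℚ, T' = if ∃ r ∈ List.range' c.KU (c.KL - c.KU), (c.arr r).phase ≠ 0
    then 0 else c.T := ⟨_, rfl⟩
  have hstep : c.step K₁ K₂ N = ({ c with
      stage := .halt
      T := T'
      C := 2 ^ (N - c.R₁ - c.R₂) } : Config).charge ((c.KL - c.KU) + N + 3) := by
    rw [Config.step, h.stage]
    dsimp only
    rw [rrefStep, if_neg hA, hT']
  rw [hstep]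
  change _ = _ ∧ c.R₁ = K₁ ∧ c.cost + ((c.KL - c.KU) + N + 3) ≤ _ ∧ c.R₂ ≤ K₂ ∧
    K₁ + c.R₂ ≤ N ∧
    (2 : ℚ) ^ (N - c.R₁ - c.R₂) = 2 ^ (N - K₁ - c.R₂) ∧
    (T' = 0 ∨ ∃ j, c.R₂ + j ≤ K₂ ∧ T' = (1 / 2 : ℚ) ^ j) ∧
    ∃ U ∈ cliffordCircuits N, ∃ s : Fin N → ℤˣ, U * A * star U = tensorProj s K₁ ∧
        U * (A * B * A) * star U = (T' : ℂ) • tensorProj s (K₁ + c.R₂)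
  have hrest : ∀ r, c.KU ≤ r → r < K₁ + K₂ → ∀ j < N, c.entry r j = .I := fun r h1 h2 j hj => by
    have := h.NR
    have : ¬ (c.NL < c.NR ∧ c.KU < c.KL) := hA
    exact h.supp r h1 h2 j (by omega)
  have hsign : ∀ r, c.KU ≤ r → r < K₁ + K₂ →
      ((c.arr r).phase = 0 ∧ c.mat N r = 1) ∨ ((c.arr r).phase ≠ 0 ∧ c.mat N r = -1) :=
    fun r h1 h2 => Row.toMatrix_eq_one_or (hrest r h1 h2) (h.invol.invol r (by omega) h2)
  -- The leftover rows are `± 1`, so their projector is `1` or `0`, exactly as the phase test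
  -- updates `T`.
  have hproj : (c.T : ℂ) • proj (c.mat N) c.KU (K₁ + K₂) = (T' : ℂ) • (1 : Op N) := by
    rw [proj_of_sign fun r h1 h2 => by
      rcases hsign r h1 h2 with h3 | h3
      · exact Or.inl h3.2
      · exact Or.inr h3.2, hT']
    have hiff : (∃ r, c.KU ≤ r ∧ r < K₁ + K₂ ∧ c.mat N r = -1) ↔
        ∃ r ∈ List.range' c.KU (c.KL - c.KU), (c.arr r).phase ≠ 0 := by
      constructor
      · rintro ⟨r, h1, h2, h3⟩
        refine ⟨r, List.mem_range'_1.mpr (by omega), ?_⟩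
        rcases hsign r h1 h2 with h4 | h4
        · exfalso
          have h5 := congrFun (congrFun (h3.symm.trans h4.2) 0) 0
          norm_num at h5
        · exact h4.1
      · rintro ⟨r, h1, h2⟩
        rw [List.mem_range'_1] at h1
        refine ⟨r, h1.1, by omega, ?_⟩
        rcases hsign r h1.1 (by omega) with h4 | h4
        · exact absurd h4.1 h2
        · exact h4.2
    by_cases hex : ∃ r ∈ List.range' c.KU (c.KL - c.KU), (c.arr r).phase ≠ 0
    · rw [if_pos hex, if_pos (hiff.mpr hex)]; simp
    · rw [if_neg hex, if_neg (mt hiff.mp hex)]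
  have hAA : A * A = A := by rw [← h.first]; exact h.single.involFamily.proj_mul_self
  have hcomm : Commute A (proj (c.mat N) D c.KU) :=
    commute_proj fun r h1 h2 => h.commute_first h1 (by omega)
  have hprod : A * B * A = (T' : ℂ) • (A * proj (c.mat N) D c.KU) := by
    calc A * B * A
        = A * proj (c.mat N) D c.KU * ((c.T : ℂ) • proj (c.mat N) c.KU (K₁ + K₂)) * A := by
          rw [h.product, ← proj_mul_proj hD hKU, Matrix.mul_smul, Matrix.smul_mul]
          simp only [mul_assoc]
      _ = (T' : ℂ) • (A * proj (c.mat N) D c.KU) := by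
          rw [hproj, Matrix.mul_smul, mul_one, Matrix.smul_mul, mul_assoc, ← hcomm.eq, ← mul_assoc,
            hAA]
  have hDR : D + c.R₂ = c.KU := by omega
  have hW : proj ((c.rankConfig N K₁ D c.R₂).mat N) 0 (K₁ + c.R₂) = A * proj (c.mat N) D c.KU := by
    rw [proj_rankConfig h.first, hDR]
  -- The second run serves only to produce the unitary, and its cost is discarded. The trace
  -- recorded in the echelon form provides the rank that it needs; the columns used by its result
  -- give `K₁ + R₂ ≤ N`.
  obtain ⟨n, m', hn, -⟩ := h.rankConfig.exists_normalForm (K₁ := K₁ + c.R₂) (K₂ := 0) le_rfl (by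
    rw [hW]
    have := h.trace.two_pow_mul_trace
    rwa [← h.R₂] at this)
  obtain ⟨U, hU, -, hU1, hU2⟩ := hn.conj
  have hle : K₁ + c.R₂ ≤ N := hn.u_le.trans hn.m_le
  obtain ⟨s, hs⟩ := exists_tensorProj hle hn.single
    fun r hr => hn.invol.invol r (Nat.zero_le _) hr
  refine ⟨rfl, h.R₁, by omega, by omega, hle, by rw [h.R₁], ?_, U, hU, s, ?_, ?_⟩
  · rw [hT']
    split_ifs
    · exact Or.inl rfl
    -- `D - K₁` rows were deleted in the elimination and `R₂` in the end game, together at most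
    -- `K₂`; this later bounds the exponent of the overlap.
    · exact Or.inr ⟨D - K₁, by omega, h.T⟩
  · rw [← hs K₁ (Nat.le_add_right _ _), hU1, proj_rankConfig_first h.first]
  · rw [← hs _ le_rfl, hU2, hW, hprod, Matrix.mul_smul, Matrix.smul_mul]

end

end Config

/-! ### Correctness of the algorithm -/

/-- A bound for the number of elementary steps. -/
noncomputable def costBound : Polynomial ℕ :=
  Polynomial.X * (Polynomial.X + 1) +
    (Polynomial.X * (Polynomial.X + 2) + (Polynomial.X + 1)) *
      (36 * (Polynomial.X + 1) ^ 2) +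
    -- The elimination and the echelon form take at most `N` iterations each. The constant collects
    -- the passages between stages and the end: `6 + 3 + 3`.
    2 * (Polynomial.X * (36 * (Polynomial.X + 1) ^ 2)) + Polynomial.X + 12

section

variable {K₁ K₂ N : ℕ} (g₁ : Fin K₁ → StabOp N) (g₂ : Fin K₂ → StabOp N)

theorem mat_initial_left (k : Fin K₁) : (initial g₁ g₂).mat N k = (g₁ k).toMatrix := by
  have h : (k : ℕ) < K₁ + K₂ := by omega
  have : (⟨k, h⟩ : Fin (K₁ + K₂)) = Fin.castAdd K₂ k := rfl
  rw [Config.mat, initial]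
  simp only [dif_pos h]
  rw [this, Fin.append_left, StabOp.toMatrix_toRow]

theorem mat_initial_right (k : Fin K₂) :
    (initial g₁ g₂).mat N (K₁ + k) = (g₂ k).toMatrix := by
  have h : K₁ + (k : ℕ) < K₁ + K₂ := by omega
  have : (⟨K₁ + k, h⟩ : Fin (K₁ + K₂)) = Fin.natAdd K₁ k := rfl
  rw [Config.mat, initial]
  simp only [dif_pos h]
  rw [this, Fin.append_right, StabOp.toMatrix_toRow]

variable {g₁ g₂}

theorem involFamily_of_isGeneratorSet {K : ℕ} {g : Fin K → StabOp N} (hg : IsGeneratorSet g)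
    {f : ℕ → Op N} {a : ℕ} (h : ∀ k : Fin K, f (a + k) = (g k).toMatrix) :
    InvolFamily f a (a + K) := by
  have key : ∀ r, a ≤ r → r < a + K → ∃ k : Fin K, f r = (g k).toMatrix := fun r h1 h2 =>
    ⟨⟨r - a, by omega⟩, by rw [← h]; congr 1; simp; omega⟩
  refine ⟨fun r s h1 h2 h3 h4 => ?_, fun r h1 h2 => ?_⟩
  · obtain ⟨i, hi⟩ := key r h1 h2
    obtain ⟨j, hj⟩ := key s h3 h4
    rw [hi, hj]; exact hg.comm i j
  · obtain ⟨i, hi⟩ := key r h1 h2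
    rw [hi, StabOp.toMatrix_mul_self]

theorem cnfInv_initial (hg₁ : IsGeneratorSet g₁) :
    Config.CnfInv N 0 K₁ 0 N ((initial g₁ g₂).mat N) (initial g₁ g₂) := by
  refine ⟨rfl, rfl, rfl, rfl, rfl, le_rfl, Nat.zero_le _, Nat.zero_le _, le_rfl,
    fun r hr => absurd hr (Nat.not_lt_zero _), fun r _ hr j hj => ?_, ?_, 1, one_mem _, by simp,
    by simp⟩
  · rw [Config.entry, initial]
    simp only [dif_pos (show r < K₁ + K₂ by omega), StabOp.toRow]
    rw [dif_neg (by omega)]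
  · have := involFamily_of_isGeneratorSet hg₁ (f := (initial g₁ g₂).mat N) (a := 0)
      fun k => by rw [Nat.zero_add]; exact mat_initial_left g₁ g₂ k
    rwa [Nat.zero_add] at this

/-- The algorithm halts after polynomially many steps and computes the normal form of
`P₁ P₂ P₁`. -/
theorem exists_output (hg₁ : IsGeneratorSet g₁) (hg₂ : IsGeneratorSet g₂) :
    ∃ out : Config, Halts g₁ g₂ out ∧ out.cost ≤ costBound.eval (N + K₁ + K₂) ∧
      out.R₁ = K₁ ∧ out.R₂ ≤ K₂ ∧ K₁ + out.R₂ ≤ N ∧ out.C = 2 ^ (N - K₁ - out.R₂) ∧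
      (out.T = 0 ∨ ∃ j, out.R₂ + j ≤ K₂ ∧ out.T = (1 / 2 : ℚ) ^ j) ∧
      ∃ U ∈ cliffordCircuits N, ∃ s : Fin N → ℤˣ,
        U * stabProj g₁ * star U = tensorProj s K₁ ∧
        U * (stabProj g₁ * stabProj g₂ * stabProj g₁) * star U =
          (out.T : ℂ) • tensorProj s (K₁ + out.R₂) := by
  set f := (initial g₁ g₂).mat N with hf
  have hP₁ : stabProj g₁ = proj f 0 K₁ := by
    have := stabProj_eq_proj g₁ (f := f) (a := 0)
      fun k => by rw [Nat.zero_add]; exact mat_initial_left g₁ g₂ k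
    rwa [Nat.zero_add] at this
  have hP₂ : stabProj g₂ = proj f K₁ (K₁ + K₂) :=
    stabProj_eq_proj g₂ fun k => mat_initial_right g₁ g₂ k
  have hI₂ : InvolFamily f K₁ (K₁ + K₂) :=
    involFamily_of_isGeneratorSet hg₂ fun k => mat_initial_right g₁ g₂ k
  obtain ⟨n₁, m', h₁, hc₁⟩ := (cnfInv_initial (g₂ := g₂) hg₁).exists_normalForm (K₁ := K₁)
    (K₂ := K₂) (Nat.le_add_right _ _) (by rw [← hP₁]; exact hg₁.two_pow_mul_trace)
  set c₁ := (Config.step K₁ K₂ N)^[n₁] (initial g₁ g₂) with hc₁def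
  obtain ⟨U₁, hU₁, hrow, -, hA⟩ := h₁.conj
  have hU₁u := cliffordCircuits_le_unitary N hU₁
  have hUU : star U₁ * U₁ = 1 := Matrix.mem_unitaryGroup_iff'.mp hU₁u
  have hB : proj (c₁.mat N) K₁ (K₁ + K₂) = U₁ * proj f K₁ (K₁ + K₂) * star U₁ := by
    rw [← proj_conj hU₁u]
    exact proj_congr fun r hr _ => hrow r hr
  have hA' : proj (c₁.mat N) 0 K₁ = U₁ * stabProj g₁ * star U₁ := by rw [hP₁]; exact hA
  have hB' : proj (c₁.mat N) K₁ (K₁ + K₂) = U₁ * stabProj g₂ * star U₁ := by rw [hP₂]; exact hB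
  have hconj : ∀ X Y : Op N, U₁ * X * star U₁ * (U₁ * Y * star U₁) = U₁ * (X * Y) * star U₁ :=
    fun X Y => by
      rw [show U₁ * X * star U₁ * (U₁ * Y * star U₁) = U₁ * X * (star U₁ * U₁) * Y * star U₁ by
        simp only [mul_assoc], hUU, mul_one]
      simp only [mul_assoc]
  have hstep₁ : c₁.step K₁ K₂ N = ({ c₁ with
      stage := .trace, R₁ := c₁.KU, KU := K₁, KL := K₁ + K₂, NL := 0, NR := c₁.KU,
      T := 1 } : Config).charge 6 := by
    rw [Config.step, h₁.stage]
    dsimp only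
    rw [Config.cnfStep, if_neg]
    rintro ⟨-, h⟩
    rw [h₁.KU, h₁.KL] at h
    exact lt_irrefl _ h
  have hT₀ : Config.TraceInv N K₁ K₂ (proj (c₁.mat N) 0 K₁) (proj (c₁.mat N) K₁ (K₁ + K₂))
      { c₁ with
        stage := .trace, R₁ := c₁.KU, KU := K₁, KL := K₁ + K₂, NL := 0, NR := c₁.KU,
        T := 1 } := by
    refine ⟨rfl, rfl, h₁.KU, h₁.KU, Nat.zero_le _, le_rfl,
      Nat.le_add_right _ _, ⟨h₁.u_le.trans h₁.m_le, h₁.single,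
        fun r hr => h₁.invol.invol r (Nat.zero_le _) hr⟩,
      fun r _ _ j hj => absurd hj (Nat.not_lt_zero _), ⟨fun r s h1 h2 h3 h4 => ?_,
      fun r h1 h2 => ?_⟩, rfl, by simp, ?_⟩
    · change Commute (c₁.mat N r) (c₁.mat N s)
      rw [hrow r h1, hrow s h3, Commute, SemiconjBy, hconj, hconj,
        (hI₂.comm r s h1 h2 h3 h4).eq]
    · change c₁.mat N r * c₁.mat N r = 1
      rw [hrow r h1, hconj, hI₂.invol r h1 h2, mul_one]
      exact Matrix.mem_unitaryGroup_iff.mp hU₁u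
    · simp only [Rat.cast_one, one_smul]
      rfl
  have hT : Config.TraceInv N K₁ K₂ (proj (c₁.mat N) 0 K₁) (proj (c₁.mat N) K₁ (K₁ + K₂))
      (c₁.step K₁ K₂ N) := by
    rw [hstep₁]
    exact hT₀.charge 6
  obtain ⟨n₂, h₂, hA₂, hc₂⟩ := hT.exists_eliminated
  obtain ⟨h₃, hc₃⟩ := h₂.rrefInv hA₂
  obtain ⟨n₃, h₄, hA₄, hc₄⟩ := h₃.exists_echelonForm
  obtain ⟨hst, hR₁, hc₅, hR₂, hle, hC, hT', U₂, hU₂, s, hU₂A, hU₂AB⟩ := h₄.finish hA₄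
  -- Each of the three loops is followed by one iteration that changes the stage. `U₁` comes from
  -- the column operations of the algorithm, `U₂` from the theoretical second normal form.
  refine ⟨_, ⟨hst, 1 + (n₃ + (1 + (n₂ + (1 + n₁)))), ?_⟩, ?_, hR₁, hR₂, hle, hC, hT', U₂ * U₁,
    mul_mem hU₂ hU₁, s, ?_, ?_⟩
  · rw [run]
    simp only [Function.iterate_add_apply, Function.iterate_one]
    rfl
  · have hcost : (c₁.step K₁ K₂ N).cost = c₁.cost + 6 := by rw [hstep₁]; rfl
    have hcost₀ : (initial g₁ g₂).cost = (K₁ + K₂) * (N + 1) := rfl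
    rw [hcost₀] at hc₁
    have hN : N ≤ N + K₁ + K₂ := by omega
    have hx : N + (K₁ + K₂) = N + K₁ + K₂ := by omega
    rw [hx] at hc₁ hc₂ hc₄ hc₅
    have b1 : (K₁ + K₂) * (N + 1) ≤ (N + K₁ + K₂) * (N + K₁ + K₂ + 1) :=
      Nat.mul_le_mul (by omega) (by omega)
    have b2 : (N * (N + 2) + (N + 1)) * (36 * (N + K₁ + K₂ + 1) ^ 2) ≤
        ((N + K₁ + K₂) * (N + K₁ + K₂ + 2) + (N + K₁ + K₂ + 1)) *
          (36 * (N + K₁ + K₂ + 1) ^ 2) := by gcongr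
    have b3 : N * (36 * (N + K₁ + K₂ + 1) ^ 2) ≤
        (N + K₁ + K₂) * (36 * (N + K₁ + K₂ + 1) ^ 2) := by gcongr
    have he : costBound.eval (N + K₁ + K₂) = (N + K₁ + K₂) * (N + K₁ + K₂ + 1) +
        ((N + K₁ + K₂) * (N + K₁ + K₂ + 2) + (N + K₁ + K₂ + 1)) *
          (36 * (N + K₁ + K₂ + 1) ^ 2) +
        2 * ((N + K₁ + K₂) * (36 * (N + K₁ + K₂ + 1) ^ 2)) + (N + K₁ + K₂) + 12 := by
      simp [costBound]
    rw [he]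
    omega
  · rw [← hU₂A, hA', star_mul]
    simp only [mul_assoc]
  · rw [← hU₂AB, hA', hB', hconj, hconj, star_mul]
    simp only [mul_assoc]

end

/-! ### Overlap and fidelity -/

section

variable {N : ℕ}

theorem star_projX (s : ℤˣ) : star (projX s) = projX s := by
  rcases Int.units_eq_one_or s with rfl | rfl <;> ext a b <;> fin_cases a <;> fin_cases b <;>
    simp [projX, Pauli.toMatrix, Matrix.star_apply]

theorem projX_mul_self (s : ℤˣ) : projX s * projX s = projX s := by
  rcases Int.units_eq_one_or s with rfl | rfl <;> ext a b <;> fin_cases a <;> fin_cases b <;>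
    norm_num [projX, Pauli.toMatrix, Matrix.mul_apply]

theorem trace_projX (s : ℤˣ) : (projX s).trace = 1 := by
  rcases Int.units_eq_one_or s with rfl | rfl <;>
    norm_num [projX, Pauli.toMatrix, Matrix.trace_fin_two]

theorem star_tensorProj (s : Fin N → ℤˣ) (r : ℕ) : star (tensorProj s r) = tensorProj s r := by
  rw [tensorProj, star_tensor]
  congr 1; ext1 i
  split_ifs
  · exact star_projX _
  · exact star_one _

theorem tensorProj_mul_self (s : Fin N → ℤˣ) (r : ℕ) :
    tensorProj s r * tensorProj s r = tensorProj s r := by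
  rw [tensorProj, tensor_mul]
  congr 1; ext1 i
  split_ifs
  · exact projX_mul_self _
  · exact one_mul _

theorem two_pow_mul_trace_tensorProj (s : Fin N → ℤˣ) {r : ℕ} (hr : r ≤ N) :
    2 ^ r * (tensorProj s r).trace = 2 ^ N := by
  have h1 : ∀ i : Fin N, (if (i : ℕ) < r then projX (s i) else 1).trace =
      if (i : ℕ) < r then (1 : ℂ) else 2 := fun i => by
    split_ifs
    · exact trace_projX _
    · simp
  rw [tensorProj, trace_tensor, Finset.prod_congr rfl fun i _ => h1 i,
    Fin.prod_univ_eq_prod_range (fun i => if i < r then (1 : ℂ) else 2) N,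
    ← Finset.prod_range_mul_prod_Ico _ hr,
    Finset.prod_congr rfl fun i hi => if_pos (Finset.mem_range.mp hi),
    Finset.prod_congr (s₁ := Finset.Ico r N) rfl fun i hi =>
      if_neg (not_lt.mpr (Finset.mem_Ico.mp hi).1)]
  simp only [Finset.prod_const, one_pow, one_mul, Nat.card_Ico]
  rw [← pow_add, Nat.add_sub_of_le hr]

/-- Turns trace identities into statements on integers and allows ranks of products to be compared.
-/
theorem rank_eq_trace {P : Op N} (h : P * P = P) : (P.rank : ℂ) = P.trace := by
  have h1 : IsIdempotentElem (Matrix.toLin' P) := by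
    rw [IsIdempotentElem, Module.End.mul_eq_comp, ← Matrix.toLin'_mul, h]
  rw [← Matrix.trace_toLin'_eq, (LinearMap.IsIdempotentElem.isProj_range _ h1).trace]
  rfl

open scoped ComplexOrder in
-- The positive square root is unique, and a projector is positive because `P = star P * P`.
theorem sqrt_smul_proj {P : Op N} (hs : star P = P) (hP : P * P = P) {a : ℝ} (ha : 0 ≤ a) :
    CFC.sqrt ((a : ℂ) • P) = ((Real.sqrt a : ℝ) : ℂ) • P := by
  refine CFC.sqrt_unique ?_ ?_
  · rw [smul_mul_smul_comm, hP, ← Complex.ofReal_mul, Real.mul_self_sqrt ha]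
  · have h1 : (0 : Op N) ≤ P := by
      have := star_mul_self_nonneg P
      rwa [hs, hP] at this
    rw [Matrix.nonneg_iff_posSemidef] at h1 ⊢
    exact h1.smul (Complex.zero_le_real.mpr (Real.sqrt_nonneg a))

end

/-! ### Ranks, overlaps and fidelities of stabiliser states -/

section

variable {N : ℕ}

theorem IsGeneratorSet.stabProj_mul_self {K : ℕ} {g : Fin K → StabOp N} (hg : IsGeneratorSet g) :
    stabProj g * stabProj g = stabProj g := by
  obtain ⟨f, h⟩ : ∃ f : ℕ → Op N, ∀ k : Fin K, f (0 + k) = (g k).toMatrix :=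
    ⟨fun r => if h : r < K then (g ⟨r, h⟩).toMatrix else 1, fun k => by simp⟩
  rw [stabProj_eq_proj g h]
  exact (involFamily_of_isGeneratorSet hg h).proj_mul_self

/-- The rank of a stabiliser projector. -/
theorem IsGeneratorSet.two_pow_mul_rank {K : ℕ} {g : Fin K → StabOp N} (hg : IsGeneratorSet g) :
    2 ^ K * (stabProj g).rank = 2 ^ N := by
  have := hg.two_pow_mul_trace
  rw [← rank_eq_trace hg.stabProj_mul_self] at this
  exact_mod_cast this

theorem IsGeneratorSet.le {K : ℕ} {g : Fin K → StabOp N} (hg : IsGeneratorSet g) : K ≤ N :=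
  (Nat.pow_dvd_pow_iff_le_right one_lt_two).mp ⟨_, hg.two_pow_mul_rank.symm⟩

section

variable {K₁ K₂ R : ℕ} {g₁ : Fin K₁ → StabOp N} {g₂ : Fin K₂ → StabOp N} {T : ℝ} {Q : Op N}

theorem trace_eq_zpow (hr : K₁ + R ≤ N) (hQ : 2 ^ (K₁ + R) * Q.trace = 2 ^ N) :
    Q.trace = (((2 : ℝ) ^ (N - K₁ - R) : ℝ) : ℂ) := by
  rw [show (2 : ℂ) ^ N = 2 ^ (K₁ + R) * 2 ^ (N - K₁ - R) by rw [← pow_add]; congr 1; omega] at hQ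
  have := mul_left_cancel₀ (pow_ne_zero _ two_ne_zero) hQ
  rw [this]; push_cast; rfl

/-- By cyclicity and `P₁ P₁ = P₁`, the traces of `P₁ P₂` and `P₁ P₂ P₁` agree. -/
theorem overlap_eq (hg₁ : IsGeneratorSet g₁) (hr : K₁ + R ≤ N)
    (hQ : 2 ^ (K₁ + R) * Q.trace = 2 ^ N)
    (h : stabProj g₁ * stabProj g₂ * stabProj g₁ = (T : ℂ) • Q) :
    overlap (stabState g₁) (stabState g₂) =
      (((2 : ℝ) ^ (N - K₁ - R) * T / (2 : ℝ) ^ (((N : ℤ) - K₁) + ((N : ℤ) - K₂)) : ℝ) : ℂ) := by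
  have h1 : (stabProj g₁ * stabProj g₂).trace = (T : ℂ) * Q.trace := by
    rw [← smul_eq_mul (T : ℂ), ← Matrix.trace_smul, ← h, Matrix.trace_mul_comm (stabProj g₁ * stabProj g₂),
      ← mul_assoc, hg₁.stabProj_mul_self]
  rw [overlap, stabState, stabState, smul_mul_smul_comm, Matrix.trace_smul, h1,
    trace_eq_zpow hr hQ, smul_eq_mul, ← zpow_add₀ two_ne_zero, ← neg_add, zpow_neg]
  push_cast
  ring

/-- Both square roots are those of multiples of projectors: `√ρ₁` is a multiple of `P₁`, so the
sandwiched operator is a multiple of `P₁ P₂ P₁`, hence of `Q`. -/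
theorem uhlmannFidelity_eq (hr : K₁ + R ≤ N) (hT : 0 ≤ T)
    (hP : star (stabProj g₁) = stabProj g₁) (hP' : stabProj g₁ * stabProj g₁ = stabProj g₁)
    (hs : star Q = Q) (hQ' : Q * Q = Q) (hQ : 2 ^ (K₁ + R) * Q.trace = 2 ^ N)
    (h : stabProj g₁ * stabProj g₂ * stabProj g₁ = (T : ℂ) • Q) :
    uhlmannFidelity (stabState g₁) (stabState g₂) =
      (2 : ℝ) ^ (N - K₁ - R) * Real.sqrt (T / (2 : ℝ) ^ (((N : ℤ) - K₁) + ((N : ℤ) - K₂))) := by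
  have e : ∀ K : ℕ, ∀ g : Fin K → StabOp N,
      stabState g = (((2 : ℝ) ^ (-((N : ℤ) - K)) : ℝ) : ℂ) • stabProj g := fun K g => by
    rw [stabState]; push_cast; rfl
  have hpos : ∀ K : ℕ, (0 : ℝ) ≤ 2 ^ (-((N : ℤ) - K)) := fun K => by positivity
  have e2 : (2 : ℝ) ^ (-((N : ℤ) - K₁)) * 2 ^ (-((N : ℤ) - K₂)) * T =
      T / (2 : ℝ) ^ (((N : ℤ) - K₁) + ((N : ℤ) - K₂)) := by
    rw [← zpow_add₀ two_ne_zero, ← neg_add, zpow_neg]; ring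
  have e3 : CFC.sqrt (stabState g₁) * stabState g₂ * CFC.sqrt (stabState g₁) =
      ((T / (2 : ℝ) ^ (((N : ℤ) - K₁) + ((N : ℤ) - K₂)) : ℝ) : ℂ) • Q := by
    rw [← e2, e K₁ g₁, e K₂ g₂, sqrt_smul_proj hP hP' (hpos K₁), smul_mul_smul_comm,
      smul_mul_smul_comm, h, smul_smul, ← Complex.ofReal_mul, ← Complex.ofReal_mul,
      ← Complex.ofReal_mul]
    congr 2
    linear_combination ((2 : ℝ) ^ (-((N : ℤ) - K₂)) * T) * Real.mul_self_sqrt (hpos K₁)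
  rw [uhlmannFidelity, e3, sqrt_smul_proj hs hQ' (by positivity), Matrix.trace_smul,
    trace_eq_zpow hr hQ, smul_eq_mul, ← Complex.ofReal_mul, Complex.ofReal_re, mul_comm]

theorem two_pow_mul_sqrt (hr : K₁ + R ≤ N) (hT : 0 ≤ T) :
    (2 : ℝ) ^ (N - K₁ - R) * Real.sqrt (T / (2 : ℝ) ^ (((N : ℤ) - K₁) + ((N : ℤ) - K₂))) =
      (2 : ℝ) ^ (((K₂ : ℝ) - (K₁ : ℝ)) / 2 - (R : ℝ)) * Real.sqrt T := by
  have h1 : ((N - K₁ - R : ℕ) : ℝ) = (N : ℝ) - K₁ - R := by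
    rw [Nat.cast_sub (by omega), Nat.cast_sub (by omega)]
  rw [div_eq_mul_inv, Real.sqrt_mul hT, ← zpow_neg, ← Real.rpow_intCast, Real.sqrt_eq_rpow (_ ^ _),
    ← Real.rpow_mul two_pos.le, ← Real.rpow_natCast, h1, mul_comm (Real.sqrt T), ← mul_assoc,
    ← Real.rpow_add two_pos]
  congr 2
  push_cast
  ring

/-- If `P₁P₂P₁` is a nonzero multiple of a projector of rank `2 ^ (N - K₁ - R)`, comparison with the
rank of `P₂` gives `K₂ ≤ K₁ + R`. -/
theorem le_add_of_smul_eq (hg₂ : IsGeneratorSet g₂) (hT : T ≠ 0) (hQ' : Q * Q = Q)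
    (hQ : 2 ^ (K₁ + R) * Q.trace = 2 ^ N)
    (h : stabProj g₁ * stabProj g₂ * stabProj g₁ = (T : ℂ) • Q) : K₂ ≤ K₁ + R := by
  have h1 : Q.rank ≤ (stabProj g₂).rank := by
    have hT' : (T : ℂ) ≠ 0 := by exact_mod_cast hT
    -- `T ≠ 0` exhibits `Q` as a product with the factor `P₂`, so its rank cannot exceed that of
    -- `P₂`.
    have : Q = ((T : ℂ)⁻¹ • stabProj g₁) * stabProj g₂ * stabProj g₁ := by
      rw [Matrix.smul_mul, Matrix.smul_mul, h, smul_smul, inv_mul_cancel₀ hT', one_smul]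
    rw [this]
    exact (Matrix.rank_mul_le_left _ _).trans (Matrix.rank_mul_le_right _ _)
  have h2 : 2 ^ (K₁ + R) * Q.rank = 2 ^ N := by
    rw [← rank_eq_trace hQ'] at hQ
    exact_mod_cast hQ
  have h3 := hg₂.two_pow_mul_rank
  have h4 : 0 < (stabProj g₂).rank := by
    rcases Nat.eq_zero_or_pos (stabProj g₂).rank with h0 | h0
    · rw [h0, mul_zero] at h3
      exact absurd h3.symm (by positivity)
    · exact h0
  refine (Nat.pow_le_pow_iff_right one_lt_two).mp (Nat.le_of_mul_le_mul_right ?_ h4)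
  rw [h3, ← h2]
  exact Nat.mul_le_mul_left _ h1

end

end

end StabOverlap

theorem mainTheorem3 :
    ∃ p : Polynomial ℕ, ∀ (N K₁ K₂ : ℕ)
      (g₁ : Fin K₁ → StabOverlap.StabOp N) (g₂ : Fin K₂ → StabOverlap.StabOp N),
      StabOverlap.IsGeneratorSet g₁ → StabOverlap.IsGeneratorSet g₂ →
      ∃ out : StabOverlap.Config,
        -- the algorithm terminates after polynomially many elementary steps
        StabOverlap.Halts g₁ g₂ out ∧ out.cost ≤ p.eval (N + K₁ + K₂) ∧
        -- its output
        out.R₁ = K₁ ∧ out.R₂ ≤ K₂ ∧ K₁ + out.R₂ ≤ N ∧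
        (out.T = 0 ∨ ∃ j : ℕ, out.T = (1 / 2 : ℚ) ^ j) ∧
        -- `P₁ P₂ P₁` in tensor product form, in the frame where `P₁` is in normal form
        (∃ U ∈ StabOverlap.cliffordCircuits N, ∃ s : Fin N → ℤˣ,
          U ∈ Matrix.unitaryGroup (Fin N → Fin 2) ℂ ∧
          U * StabOverlap.stabProj g₁ * star U = StabOverlap.tensorProj s K₁ ∧
          U * (StabOverlap.stabProj g₁ * StabOverlap.stabProj g₂ * StabOverlap.stabProj g₁) * star U
            = (out.T : ℂ) • StabOverlap.tensorProj s (K₁ + out.R₂)) ∧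
        -- overlap
        StabOverlap.overlap (StabOverlap.stabState g₁) (StabOverlap.stabState g₂)
          = ((out.overlapValue K₁ K₂ N : ℝ) : ℂ) ∧
        StabOverlap.overlap (StabOverlap.stabState g₁) (StabOverlap.stabState g₂)
          = (2 : ℂ) ^ (-((N : ℤ) - (K₂ : ℤ) + (out.R₂ : ℤ))) * (out.T : ℂ) ∧
        (StabOverlap.overlap (StabOverlap.stabState g₁) (StabOverlap.stabState g₂) = 0 ∨
          ∃ j : ℕ, j ≤ N ∧
            StabOverlap.overlap (StabOverlap.stabState g₁) (StabOverlap.stabState g₂)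
              = (1 / 2 : ℂ) ^ j) ∧
        -- Uhlmann fidelity
        StabOverlap.uhlmannFidelity (StabOverlap.stabState g₁) (StabOverlap.stabState g₂)
          = out.fidelityValue K₁ K₂ N ∧
        StabOverlap.uhlmannFidelity (StabOverlap.stabState g₁) (StabOverlap.stabState g₂)
          = (2 : ℝ) ^ (((K₂ : ℝ) - (K₁ : ℝ)) / 2 - (out.R₂ : ℝ)) * Real.sqrt (out.T : ℝ) ∧
        StabOverlap.uhlmannFidelity (StabOverlap.stabState g₁) (StabOverlap.stabState g₂) ≤ 1 ∧
        -- Bures distance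
        StabOverlap.buresDistance (StabOverlap.stabState g₁) (StabOverlap.stabState g₂)
          = 2 * Real.sqrt (1 -
              (2 : ℝ) ^ (((K₂ : ℝ) - (K₁ : ℝ)) / 2 - (out.R₂ : ℝ)) * Real.sqrt (out.T : ℝ)) := by
  refine ⟨StabOverlap.costBound, fun N K₁ K₂ g₁ g₂ hg₁ hg₂ => ?_⟩
  obtain ⟨out, hH, hcost, hR₁, hR₂, hle, hC, hT, U, hU, s, hUP, hUPPP⟩ :=
    StabOverlap.exists_output hg₁ hg₂
  have hUu := StabOverlap.cliffordCircuits_le_unitary N hU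
  have hUU : star U * U = 1 := Matrix.mem_unitaryGroup_iff'.mp hUu
  have hUU' : U * star U = 1 := Matrix.mem_unitaryGroup_iff.mp hUu
  have hback : ∀ M : StabOverlap.Op N, M = star U * (U * M * star U) * U := fun M => by
    rw [show star U * (U * M * star U) * U = (star U * U) * M * (star U * U) by
      simp only [mul_assoc], hUU, one_mul, mul_one]
  have hP : star (StabOverlap.stabProj g₁) = StabOverlap.stabProj g₁ := by
    -- Self-adjointness is read off from the tensor product form in the rotated frame.
    rw [hback (StabOverlap.stabProj g₁), hUP]
    simp only [star_mul, star_star, StabOverlap.star_tensorProj, mul_assoc]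
  set Q := star U * StabOverlap.tensorProj s (K₁ + out.R₂) * U with hQdef
  have hQs : star Q = Q := by
    rw [hQdef]
    simp only [star_mul, star_star, StabOverlap.star_tensorProj, mul_assoc]
  have hQQ : Q * Q = Q := by
    rw [hQdef, show ∀ X : StabOverlap.Op N, star U * X * U * (star U * X * U) =
      star U * (X * (U * star U) * X) * U from fun X => by simp only [mul_assoc], hUU', mul_one,
      StabOverlap.tensorProj_mul_self]
  have hQt : 2 ^ (K₁ + out.R₂) * Q.trace = 2 ^ N := by
    rw [hQdef, Matrix.trace_mul_comm, ← mul_assoc, hUU', one_mul,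
      StabOverlap.two_pow_mul_trace_tensorProj s hle]
  have hPPP : StabOverlap.stabProj g₁ * StabOverlap.stabProj g₂ * StabOverlap.stabProj g₁ =
      (((out.T : ℝ)) : ℂ) • Q := by
    rw [hback (_ * _ * _), hUPPP, Matrix.mul_smul, Matrix.smul_mul, hQdef]
    norm_cast
  have hT0 : (0 : ℝ) ≤ (out.T : ℝ) := by
    rcases hT with h | ⟨j, -, h⟩ <;> rw [h] <;> simp
  have hov := StabOverlap.overlap_eq (g₂ := g₂) hg₁ hle hQt hPPP
  have hov' : StabOverlap.overlap (StabOverlap.stabState g₁) (StabOverlap.stabState g₂)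
      = (2 : ℂ) ^ (-((N : ℤ) - (K₂ : ℤ) + (out.R₂ : ℤ))) * (out.T : ℂ) := by
    -- The exponents match because `K₁ + R₂ ≤ N` makes the truncated difference `N - K₁ - R₂` an
    -- honest one.
    have e : (2 : ℂ) ^ (-((N : ℤ) - (K₂ : ℤ) + (out.R₂ : ℤ))) =
        (2 : ℂ) ^ (N - K₁ - out.R₂) / (2 : ℂ) ^ (((N : ℤ) - K₁) + ((N : ℤ) - K₂)) := by
      rw [← zpow_natCast, ← zpow_sub₀ two_ne_zero]
      congr 1
      omega
    rw [hov, e]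
    push_cast
    ring
  have hfid := StabOverlap.uhlmannFidelity_eq (g₂ := g₂) hle hT0 hP hg₁.stabProj_mul_self hQs hQQ
    hQt hPPP
  have hfid' := hfid.trans (StabOverlap.two_pow_mul_sqrt hle hT0)
  refine ⟨out, hH, hcost, hR₁, hR₂, hle, ?_, ⟨U, hU, s, hUu, hUP, hUPPP⟩, ?_, hov', ?_, ?_, hfid',
    ?_, ?_⟩
  · rcases hT with h | ⟨j, -, h⟩
    · exact Or.inl h
    · exact Or.inr ⟨j, h⟩
  · rw [hov, StabOverlap.Config.overlapValue, hC]
    push_cast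
    rfl
  · rcases hT with h | ⟨j, hj, h⟩
    · left; rw [hov', h]; simp
    · right
      have hK₂ := hg₂.le
      -- The exponent is at most `N` because `R₂ + j ≤ K₂ ≤ N`.
      refine ⟨N - K₂ + out.R₂ + j, by omega, ?_⟩
      rw [hov', h, zpow_neg, ← inv_zpow, one_div]
      push_cast
      rw [one_div, ← zpow_natCast, ← zpow_natCast, ← zpow_add₀ (by norm_num)]
      congr 1
      omega
  · rw [hfid, StabOverlap.Config.fidelityValue, hC]
    push_cast
    rfl
  · rw [hfid']
    rcases hT with h | ⟨j, -, h⟩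
    · rw [h]; simp
    · have hTne : (out.T : ℝ) ≠ 0 := by rw [h]; simp
      have hle' := StabOverlap.le_add_of_smul_eq hg₂ hTne hQQ hQt hPPP
      have hle'' : (K₂ : ℝ) ≤ K₁ + out.R₂ := by exact_mod_cast hle'
      have hR0 : (0 : ℝ) ≤ out.R₂ := Nat.cast_nonneg _
      -- From `K₂ - K₁ ≤ R₂` the exponent of `2` is at most `-R₂ / 2 ≤ 0`.
      refine mul_le_one₀ (Real.rpow_le_one_of_one_le_of_nonpos one_le_two (by linarith))
        (Real.sqrt_nonneg _) (Real.sqrt_le_one.mpr ?_)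
      rw [h]; push_cast
      exact pow_le_one₀ (by norm_num) (by norm_num)
  · rw [StabOverlap.buresDistance, hfid']
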